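/- Let $n\ge 2$. A \emph{stable colored ribbon tree} $T$ with $n$ leaves is a finite planar rooted tree with finite edges $E(T)$ and semi-infinite edges $e_0,\dots,e_n$ (in this cyclic order; $e_0$ is the root edge, the others are the leaves), with a set $V_{\rm col}(T)$ of colored vertices such that every path from a leaf to the root contains exactly one colored vertex; colored vertices have valence at least $2$ and the others at least $3$. $T$ is \emph{maximal} if these valences are exactly $2$ and $3$. \emph{Metric trees.} Let $\overline{\mathcal W}_{n,1,T}$ be the compact cell of all $\lambda:E(T)\to[0,\infty]$ such that for every vertex $v$ the sum of the lengths along the path from $v$ to a colored vertex beyond $v$ (as seen from the root) does not depend on that colored vertex. Let $\overline{\mathcal W}_{n,1}$ be the quotient of $\bigsqcup_T\overline{\mathcal W}_{n,1,T}$, with the quotient topology, by contraction of the edges of length $0$ (and isomorphism). The image of $\overline{\mathcal W}_{n,1,T}$ in $\overline{\mathcal W}_{n,1}$ is denoted by the same symbol. \emph{Quilted disks.} Let $\overline M_{n,1}$ be the set of isomorphism classes of stable nodal quilted disks with markings $z_0,\dots,z_n$: a closed disk for each vertex of a stable colored ribbon tree, with distinct special points (nodes for the finite edges, markings for the semi-infinite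 ones) on its boundary, in the counterclockwise order given by the tree, and, for colored vertices, an inner circle (seam) tangent to the boundary at the special point on the root side; isomorphisms are holomorphic on each disk and preserve nodes, markings and seams. Let $M_{n,1,T}$ be the subset of combinatorial type $T$. The topology of $\overline M_{n,1}$ is pulled back along all cross-ratios $\rho_{ijkl}\in[-\infty,0]$ ($0\le i<j<k<l\le n$) and $\rho_{ij}\in[0,\infty]$ ($1\le i<j\le n$). Here $\rho_{ijkl}=\frac{(w_j-w_k)(w_l-w_i)}{(w_i-w_j)(w_k-w_l)}$ on the component where the four branches towards $z_i,z_j,z_k,z_l$ meet, and it is $-\infty$ (resp. $0$) if a finite edge separates $z_i,z_j$ from $z_k,z_l$ (resp. $z_i,z_l$ from $z_j,z_k$). On the component where the branches towards $z_0,z_i,z_j$ meet, $\rho_{ij}=y/(z_j-z_i)$ if it is quilted (in half-plane coordinates in which the special point on the root side is $\infty$ and the seam is the line at height $y$), $\rho_{ij}=\infty$ if the colored vertex lies on the root side of this component, and $\rho_{ij}=0$ otherwise. \emph{Exponentiation.} Let $T$ be maximal, let $v_i$ be its vertex where the leaves $e_i,e_{i+1}$ meet ($1\le i\le n-1$), and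 let $S$ be a nodal quilted disk whose type is obtained from $T$ by contracting edges. In half-plane coordinates as above, put $x_i=z_{i+1}-z_i$. The \emph{simple ratio} $\phi_{T,e}(S)\in[0,\infty)$ is $x_i/x_j$ if $e$ joins $v_i$ to its parent $v_j$, measured on the component where $z_j,z_{j+1},z_0$ are distinct; it is $x_i/y$ (resp. $y/x_i$) if $e$ joins $v_i$ to a colored parent (resp. a colored vertex to its parent $v_i$), measured on the component where $z_i,z_{i+1},z_0$ are distinct, and $0$ if that component is not quilted. \textbf{Theorem.} There is exactly one map $\Theta:\overline{\mathcal W}_{n,1}\to\overline M_{n,1}$ such that for every maximal $T$ and every $\lambda\in\overline{\mathcal W}_{n,1,T}$ the point $\Theta(\lambda)$ has type obtained from $T$ by contracting edges and satisfies $\phi_{T,e}(\Theta(\lambda))=e^{-\lambda(e)}$ for all $e\in E(T)$ (with $e^{-\infty}=0$). This map $\Theta$ is a homeomorphism, and for every combinatorial type $T$ (maximal or not) the set $\Theta(\overline{\mathcal W}_{n,1,T})\cap M_{n,1,T}$ consists of exactly one point. -/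

import Mathlib

/-!
Stable coloured (metric) ribbon trees with `n` leaves, stable `n`-marked nodal quilted disks,
their spaces, and the exponentiation map between them.
-/

/-- A stable coloured rooted ribbon tree with semi-infinite edges `e_0, ..., e_n`.
The vertex set is `Fin m`; the root edge `e_0` is attached to `root`; every other vertex has a
finite edge to its `parent`; the leaf `e_{i+1}` is attached to the vertex `leaf i`.

The cyclic orders at the vertices are those of the planar tree whose semi-infinite edges are
`e_0, ..., e_n` in this cyclic order.  They exist, and are then unique (every vertex of a stable
tree has a leaf beyond it), exactly when the leaves beyond each vertex are consecutive, which is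
the field `ribbon`. -/
structure ColoredTree (n : ℕ) where
  m : ℕ
  root : Fin m
  parent : Fin m → Fin m
  parent_root : parent root = root
  reaches_root : ∀ v, ∃ t : ℕ, parent^[t] v = root
  leaf : Fin n → Fin m
  ribbon : ∀ (v : Fin m) (i j k : Fin n), i < j → j < k →
    (∃ t : ℕ, parent^[t] (leaf i) = v) → (∃ t : ℕ, parent^[t] (leaf k) = v) →
    ∃ t : ℕ, parent^[t] (leaf j) = v
  /-- the coloured vertices -/
  col : Finset (Fin m)
  col_path : ∀ i : Fin n, ∃! v, v ∈ col ∧ ∃ t : ℕ, parent^[t] (leaf i) = v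
  /-- uncoloured vertices have valence at least `3`: besides the edge on the root side there are at
  least two further finite edges or leaves -/
  stable_uncolored : ∀ v, v ∉ col →
    2 ≤ Nat.card {c : Fin m // c ≠ root ∧ parent c = v} + Nat.card {i : Fin n // leaf i = v}
  /-- coloured vertices have valence at least `2` -/
  stable_colored : ∀ v, v ∈ col →
    1 ≤ Nat.card {c : Fin m // c ≠ root ∧ parent c = v} + Nat.card {i : Fin n // leaf i = v}

namespace ColoredTree

variable {n : ℕ}

/-- The vertex `v` lies on the path from `u` to the root. -/
def Below (T : ColoredTree n) (u v : Fin T.m) : Prop := ∃ t : ℕ, T.parent^[t] u = v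

/-- Finite edges; the edge joining `v` to its parent is represented by `v`. -/
abbrev Edge (T : ColoredTree n) : Type := {v : Fin T.m // v ≠ T.root}

/-- Finite edges and leaves. Each of them is attached, at its end nearest the root, to the vertex
`target`. -/
abbrev InEdge (T : ColoredTree n) : Type := T.Edge ⊕ Fin n

def target (T : ColoredTree n) : T.InEdge → Fin T.m
  | .inl e => T.parent e.1
  | .inr i => T.leaf i

/-- The path from leaf `i` to the root uses the edge `a`. -/
def Carries (T : ColoredTree n) : T.InEdge → Fin n → Prop
  | .inl e, i => T.Below (T.leaf i) e.1
  | .inr j, i => j = i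

/-- The paths from the leaves `i` and `j` to the root first meet at `v`. -/
def Meets (T : ColoredTree n) (v : Fin T.m) (i j : Fin n) : Prop :=
  ∃ a b : T.InEdge, a ≠ b ∧ T.target a = v ∧ T.target b = v ∧ T.Carries a i ∧ T.Carries b j

/-- The unique vertex at which the paths from two distinct leaves to the root first meet. -/
noncomputable def meet (T : ColoredTree n) (i j : Fin n) : Fin T.m :=
  @Classical.epsilon _ ⟨T.root⟩ (fun v => T.Meets v i j)

/-- A maximal tree: coloured vertices are bivalent, all other vertices are trivalent. -/
def IsMaximal (T : ColoredTree n) : Prop :=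
  ∀ v, Nat.card {a : T.InEdge // T.target a = v} = if v ∈ T.col then 1 else 2

/-- A morphism of coloured ribbon trees: `f` exhibits `T'` as the result of contracting
a set of finite edges of `T`.  The edge from `v` to its parent is contracted when
`f (T.parent v) = f v`; the last condition says that each fibre is non-empty and connected
(it has exactly one vertex closest to the root). -/
structure IsMorphism (T T' : ColoredTree n) (f : Fin T.m → Fin T'.m) : Prop where
  root : f T.root = T'.root
  leaf : ∀ i, f (T.leaf i) = T'.leaf i
  parent : ∀ v, f (T.parent v) = f v ∨ f (T.parent v) = T'.parent (f v)
  col : ∀ w, w ∈ T'.col ↔ ∃ v ∈ T.col, f v = w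
  fibre : ∀ w, ∃! v, f v = w ∧ (v = T.root ∨ f (T.parent v) ≠ f v)

/-- An isomorphism of coloured ribbon trees. -/
structure IsIso (T T' : ColoredTree n) (σ : Fin T.m ≃ Fin T'.m) : Prop where
  root : σ T.root = T'.root
  leaf : ∀ i, σ (T.leaf i) = T'.leaf i
  parent : ∀ v, σ (T.parent v) = T'.parent (σ v)
  col : ∀ v, σ v ∈ T'.col ↔ v ∈ T.col

open Classical in
/-- The sum of the edge lengths along the path from `c` to a vertex `v` on the root side of `c`. -/
noncomputable def pathLength (T : ColoredTree n) (len : T.Edge → ENNReal) (c v : Fin T.m) :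
    ENNReal :=
  ∑ e : T.Edge, if T.Below c e.1 ∧ T.Below e.1 v ∧ e.1 ≠ v then len e else 0

/-- The compactified closed cell of `T`: edge lengths in `[0, ∞]`, subject to the balancing
relation that from any vertex `v` the distance to all coloured vertices beyond `v` is the same.
(For finite lengths this is the same as the relation for `v` the root.) -/
def Cell (T : ColoredTree n) : Type :=
  {len : T.Edge → ENNReal // ∀ v, ∀ c ∈ T.col, ∀ c' ∈ T.col, T.Below c v → T.Below c' v →
    T.pathLength len c v = T.pathLength len c' v}

instance (T : ColoredTree n) : TopologicalSpace T.Cell := instTopologicalSpaceSubtype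

end ColoredTree

/-- `(T', len')` is the coloured metric tree obtained from `(T, len)` by contracting exactly the
edges of length zero, the other edges keeping their lengths. -/
def Collapse {n : ℕ} (p q : Σ T : ColoredTree n, T.Cell) : Prop :=
  ∃ f : Fin p.1.m → Fin q.1.m, p.1.IsMorphism q.1 f ∧
    (∀ e : p.1.Edge, f (p.1.parent e.1) = f e.1 ↔ p.2.1 e = 0) ∧
    ∀ (e : p.1.Edge) (e' : q.1.Edge), f e.1 = e'.1 → f (p.1.parent e.1) ≠ f e.1 →
      q.2.1 e' = p.2.1 e

/-- The compactified space of stable coloured metric ribbon trees with `n` leaves: the closed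
cells of all trees, glued by contracting the edges of length zero.  Every class contains a tree
with lengths in `(0, ∞]`, unique up to isomorphism. -/
def MetricTrees (n : ℕ) : Type := Quot (Collapse (n := n))

instance (n : ℕ) : TopologicalSpace (MetricTrees n) := instTopologicalSpaceQuot

namespace MetricTrees

def mk {n : ℕ} (T : ColoredTree n) (len : T.Cell) : MetricTrees n := Quot.mk _ ⟨T, len⟩

/-- The (compactified) closed cell of `T` in the space of metric trees. -/
def closedCell {n : ℕ} (T : ColoredTree n) : Set (MetricTrees n) := Set.range (mk T)

end MetricTrees

/-- The points `p, q, r` of the unit circle are distinct and in counterclockwise order. -/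
def Counterclockwise (p q r : Circle) : Prop :=
  0 < ((starRingEnd ℂ) ((q : ℂ) - p) * ((r : ℂ) - p)).im

/-- A stable nodal quilted disk with markings `z_0, ..., z_n`.  Its components are copies of the
closed unit disk, one for each vertex of the tree.  On the component of `v`, the special point on
the root side (the marking `z_0` if `v` is the root, otherwise the node shared with the component
of the parent) is `out v`.  The point `inc (.inl e)` is the node of the edge `e`, on the component
of the parent, and `inc (.inr i)` is the marking `z_{i+1}`.  A component of a coloured vertex
carries as a seam the circle of radius `radius v` that is internally tangent to the unit circle at
`out v`. -/
structure NodalQuiltedDisk (n : ℕ) where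
  tree : ColoredTree n
  out : Fin tree.m → Circle
  inc : tree.InEdge → Circle
  inc_ne_out : ∀ a, inc a ≠ out (tree.target a)
  inc_ne_inc : ∀ a b, tree.target a = tree.target b → a ≠ b → inc a ≠ inc b
  ordered : ∀ a b i j, a ≠ b → tree.target a = tree.target b → tree.Carries a i →
    tree.Carries b j → i < j → Counterclockwise (out (tree.target a)) (inc a) (inc b)
  radius : {v // v ∈ tree.col} → ℝ
  radius_mem : ∀ v, radius v ∈ Set.Ioo (0 : ℝ) 1

/-- Holomorphic automorphisms of the closed unit disk (values outside the disk are irrelevant). -/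
def IsDiskIso (φ : ℂ → ℂ) : Prop :=
  ∃ ψ : ℂ → ℂ,
    (DiffContOnCl ℂ φ (Metric.ball 0 1) ∧ Set.MapsTo φ (Metric.ball 0 1) (Metric.ball 0 1) ∧
      Set.MapsTo φ (Metric.closedBall 0 1) (Metric.closedBall 0 1)) ∧
    (DiffContOnCl ℂ ψ (Metric.ball 0 1) ∧ Set.MapsTo ψ (Metric.ball 0 1) (Metric.ball 0 1) ∧
      Set.MapsTo ψ (Metric.closedBall 0 1) (Metric.closedBall 0 1)) ∧
    Set.LeftInvOn ψ φ (Metric.closedBall 0 1) ∧ Set.LeftInvOn φ ψ (Metric.closedBall 0 1)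

/-- The cross-ratio of four points. -/
noncomputable def crossRatio (w₁ w₂ w₃ w₄ : ℂ) : ℂ :=
  ((w₂ - w₃) * (w₄ - w₁)) / ((w₁ - w₂) * (w₃ - w₄))

namespace NodalQuiltedDisk

variable {n : ℕ}

/-- The seam of a quilted component. -/
def seam (S : NodalQuiltedDisk n) (v : {v // v ∈ S.tree.col}) : Set ℂ :=
  Metric.sphere (((1 - S.radius v : ℝ) : ℂ) * (S.out v.1 : ℂ)) (S.radius v)

/-- Isomorphism of nodal quilted disks: holomorphic isomorphisms of the components that are
compatible with nodes, markings and seams. -/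
def Iso (S S' : NodalQuiltedDisk n) : Prop :=
  ∃ σ : Fin S.tree.m ≃ Fin S'.tree.m, S.tree.IsIso S'.tree σ ∧
  ∃ φ : Fin S.tree.m → ℂ → ℂ, (∀ v, IsDiskIso (φ v)) ∧
    (∀ v, φ v (S.out v) = S'.out (σ v)) ∧
    (∀ i, φ (S.tree.leaf i) (S.inc (.inr i)) = S'.inc (.inr i)) ∧
    (∀ (e : S.tree.Edge) (e' : S'.tree.Edge), σ e.1 = e'.1 →
      φ (S.tree.parent e.1) (S.inc (.inl e)) = S'.inc (.inl e')) ∧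
    ∀ (c : {v // v ∈ S.tree.col}) (c' : {v // v ∈ S'.tree.col}), σ c.1 = c'.1 →
      φ c.1 '' S.seam c = S'.seam c'

open Classical in
/-- The special point of the component of `v` that is the marking of leaf `i`, or the node through
which that marking is reached from the component of `v`. -/
noncomputable def leafPoint (S : NodalQuiltedDisk n) (v : Fin S.tree.m) (i : Fin n) : Circle :=
  if h : ∃ a, S.tree.target a = v ∧ S.tree.Carries a i then S.inc h.choose else S.out v

/-- The same for all markings `z_0, ..., z_n`. -/
noncomputable def point (S : NodalQuiltedDisk n) (v : Fin S.tree.m) (i : Fin (n + 1)) : Circle :=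
  Fin.cases (S.out v) (S.leafPoint v) i

open Classical in
/-- The cross-ratio `ρ_{ijkl} ∈ [-∞, 0]` of the markings `z_i, z_j, z_k, z_l`, for `i < j < k < l`.
It is `-∞` if the subtree spanned by these markings has a finite edge separating `i, j` from
`k, l`; it is the cross-ratio on the component where the four branches meet, if there is one; and
it is `0` otherwise, that is, if `j, k` are separated from `i, l`. -/
noncomputable def rhoFour (S : NodalQuiltedDisk n) (i j k l : Fin (n + 1)) : EReal :=
  if ∃ v, S.point v i ≠ S.point v j ∧ S.point v k = S.point v l ∧
      S.point v i ≠ S.point v k ∧ S.point v j ≠ S.point v k then ⊥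
  else if h : ∃ v, S.point v i ≠ S.point v j ∧ S.point v i ≠ S.point v k ∧
      S.point v i ≠ S.point v l ∧ S.point v j ≠ S.point v k ∧ S.point v j ≠ S.point v l ∧
      S.point v k ≠ S.point v l then
    (((crossRatio (S.point h.choose i) (S.point h.choose j) (S.point h.choose k)
      (S.point h.choose l)).re : ℝ) : EReal)
  else 0

open Classical in
/-- The number `ρ_{ij} ∈ [0, ∞]` for two leaves `i < j`, with `v` the vertex at which they meet.
If `v` is quilted, it is the imaginary part of the cross-ratio of `z_i, z_j, z_0` and a point `w`
of the seam other than `z_0` (all seam points give the same value; the one opposite to `z_0` is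
used).  In the half-plane with `z_0` at infinity it is `y / (z_j - z_i)`, where the seam is the
line at height `y`.  It is `∞` if the coloured vertex is on the root side of `v`, and `0` if the
coloured vertices are beyond `v`. -/
noncomputable def rhoTwo (S : NodalQuiltedDisk n) (i j : Fin n) : EReal :=
  if h : S.tree.meet i j ∈ S.tree.col then
    (((crossRatio (S.leafPoint (S.tree.meet i j) i) (S.leafPoint (S.tree.meet i j) j)
      (S.out (S.tree.meet i j))
      (((1 - 2 * S.radius ⟨S.tree.meet i j, h⟩ : ℝ) : ℂ) * (S.out (S.tree.meet i j) : ℂ))).im : ℝ)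
      : EReal)
  else if ∃ c ∈ S.tree.col, S.tree.Below (S.tree.meet i j) c then ⊤
  else 0

/-- All cross-ratios together. -/
noncomputable def crossRatios (S : NodalQuiltedDisk n) :
    ({q : Fin 4 → Fin (n + 1) // StrictMono q} → EReal) ×
      ({p : Fin n × Fin n // p.1 < p.2} → EReal) :=
  (fun q => S.rhoFour (q.1 0) (q.1 1) (q.1 2) (q.1 3), fun p => S.rhoTwo p.1.1 p.1.2)

end NodalQuiltedDisk

theorem IsDiskIso.id : IsDiskIso (fun z => z) :=
  ⟨fun z => z, ⟨differentiable_id.diffContOnCl, fun _ h => h, fun _ h => h⟩,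
    ⟨differentiable_id.diffContOnCl, fun _ h => h, fun _ h => h⟩, fun _ _ => rfl, fun _ _ => rfl⟩

theorem IsDiskIso.comp {φ φ' : ℂ → ℂ} (h : IsDiskIso φ) (h' : IsDiskIso φ') :
    IsDiskIso (fun z => φ' (φ z)) := by
  obtain ⟨ψ, ⟨a1, a2, a3⟩, ⟨b1, b2, b3⟩, c, d⟩ := h
  obtain ⟨ψ', ⟨a1', a2', a3'⟩, ⟨b1', b2', b3'⟩, c', d'⟩ := h'
  refine ⟨fun z => ψ (ψ' z), ⟨a1'.comp a1 a2, fun z hz => a2' (a2 hz), fun z hz => a3' (a3 hz)⟩,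
    ⟨b1.comp b1' b2', fun z hz => b2 (b2' hz), fun z hz => b3 (b3' hz)⟩, ?_, ?_⟩
  · intro z hz
    show ψ (ψ' (φ' (φ z))) = z
    rw [c' (a3 hz), c hz]
  · intro z hz
    show φ' (φ (ψ (ψ' z))) = z
    rw [d (b3' hz), d' hz]

theorem IsDiskIso.exists_inverse {φ : ℂ → ℂ} (h : IsDiskIso φ) :
    ∃ ψ, IsDiskIso ψ ∧ Set.LeftInvOn ψ φ (Metric.closedBall 0 1) := by
  obtain ⟨ψ, a, b, c, d⟩ := h
  exact ⟨ψ, ⟨φ, b, a, d, c⟩, c⟩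

theorem Circle.coe_mem_closedBall (p : Circle) : (p : ℂ) ∈ Metric.closedBall (0 : ℂ) 1 := by
  rw [mem_closedBall_zero_iff, Circle.norm_coe]

namespace NodalQuiltedDisk

variable {n : ℕ}

theorem seam_subset (S : NodalQuiltedDisk n) (v : {v // v ∈ S.tree.col}) :
    S.seam v ⊆ Metric.closedBall (0 : ℂ) 1 := by
  intro z hz
  have h1 := S.radius_mem v
  have h2 : ‖z - ((1 - S.radius v : ℝ) : ℂ) * (S.out v.1 : ℂ)‖ = S.radius v := by
    simpa [seam, dist_eq_norm] using hz
  have h3 : ‖((1 - S.radius v : ℝ) : ℂ) * (S.out v.1 : ℂ)‖ = 1 - S.radius v := by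
    rw [norm_mul, Circle.norm_coe, mul_one, Complex.norm_real, Real.norm_eq_abs, abs_of_nonneg]
    linarith [h1.2]
  have h4 := norm_add_le (z - ((1 - S.radius v : ℝ) : ℂ) * (S.out v.1 : ℂ))
    (((1 - S.radius v : ℝ) : ℂ) * (S.out v.1 : ℂ))
  rw [sub_add_cancel, h2, h3] at h4
  simpa using h4

theorem Iso.refl (S : NodalQuiltedDisk n) : S.Iso S := by
  refine ⟨Equiv.refl _, ⟨rfl, fun _ => rfl, fun _ => rfl, fun _ => Iff.rfl⟩, fun _ z => z,
    fun _ => IsDiskIso.id, fun _ => rfl, fun _ => rfl, ?_, ?_⟩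
  · intro e e' h
    have : e = e' := Subtype.ext h
    rw [this]
  · intro c c' h
    have : c = c' := Subtype.ext h
    rw [this]
    simp

theorem Iso.symm {S S' : NodalQuiltedDisk n} (h : S.Iso S') : S'.Iso S := by
  obtain ⟨σ, hσ, φ, h1, h2, h3, h4, h5⟩ := h
  choose ψ hψ hinv using fun v => (h1 v).exists_inverse
  have hp : ∀ w, σ.symm (S'.tree.parent w) = S.tree.parent (σ.symm w) := by
    intro w
    rw [Equiv.symm_apply_eq, hσ.parent, Equiv.apply_symm_apply]
  have hl : ∀ i, σ.symm (S'.tree.leaf i) = S.tree.leaf i := by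
    intro i
    rw [Equiv.symm_apply_eq, hσ.leaf]
  refine ⟨σ.symm, ⟨?_, hl, hp, ?_⟩, fun w => ψ (σ.symm w), fun w => hψ _, ?_, ?_, ?_, ?_⟩
  · rw [Equiv.symm_apply_eq, hσ.root]
  · intro w
    rw [← hσ.col, Equiv.apply_symm_apply]
  · intro w
    have := h2 (σ.symm w)
    rw [Equiv.apply_symm_apply] at this
    beta_reduce
    rw [← this, hinv _ (Circle.coe_mem_closedBall _)]
  · intro i
    beta_reduce
    rw [hl, ← h3 i, hinv _ (Circle.coe_mem_closedBall _)]
  · intro e' e he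
    have he' : σ e.1 = e'.1 := by rw [← he, Equiv.apply_symm_apply]
    beta_reduce
    rw [hp, he, ← h4 e e' he', hinv _ (Circle.coe_mem_closedBall _)]
  · intro c' c hc
    have hc' : σ c.1 = c'.1 := by rw [← hc, Equiv.apply_symm_apply]
    beta_reduce
    rw [hc, ← h5 c c' hc', Set.image_image]
    ext z
    constructor
    · rintro ⟨w, hw, rfl⟩
      beta_reduce
      rwa [hinv _ (S.seam_subset c hw)]
    · intro hz
      exact ⟨z, hz, hinv _ (S.seam_subset c hz)⟩

theorem Iso.trans {S S' S'' : NodalQuiltedDisk n} (h : S.Iso S') (h' : S'.Iso S'') :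
    S.Iso S'' := by
  obtain ⟨σ, hσ, φ, h1, h2, h3, h4, h5⟩ := h
  obtain ⟨τ, hτ, χ, k1, k2, k3, k4, k5⟩ := h'
  refine ⟨σ.trans τ, ⟨?_, ?_, ?_, ?_⟩, fun v z => χ (σ v) (φ v z),
    fun v => (h1 v).comp (k1 _), ?_, ?_, ?_, ?_⟩
  · rw [Equiv.trans_apply, hσ.root, hτ.root]
  · intro i
    rw [Equiv.trans_apply, hσ.leaf, hτ.leaf]
  · intro v
    rw [Equiv.trans_apply, hσ.parent, hτ.parent, Equiv.trans_apply]
  · intro v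
    rw [Equiv.trans_apply, hτ.col, hσ.col]
  · intro v
    beta_reduce
    rw [h2, k2, Equiv.trans_apply]
  · intro i
    beta_reduce
    rw [h3, hσ.leaf, k3]
  · intro e e'' he
    have hne : σ e.1 ≠ S'.tree.root := by
      rw [← hσ.root]
      exact fun hh => e.2 (σ.injective hh)
    have q := h4 e ⟨σ e.1, hne⟩ rfl
    have q' := k4 ⟨σ e.1, hne⟩ e'' he
    beta_reduce
    rw [q, hσ.parent, q']
  · intro c c'' hc
    have hm : σ c.1 ∈ S'.tree.col := (hσ.col _).2 c.2
    have q := h5 c ⟨σ c.1, hm⟩ rfl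
    have q' := k5 ⟨σ c.1, hm⟩ c'' hc
    rw [← q', ← q, Set.image_image]

instance setoid (n : ℕ) : Setoid (NodalQuiltedDisk n) :=
  ⟨Iso, Iso.refl, Iso.symm, Iso.trans⟩

end NodalQuiltedDisk

/-- The moduli space of stable `n`-marked nodal quilted disks: the set of isomorphism classes. -/
def QuiltedDisks (n : ℕ) : Type := Quotient (NodalQuiltedDisk.setoid n)

/-- The topology on the moduli space is pulled back along the cross-ratios (which take the same
values on isomorphic nodal disks). -/
noncomputable instance (n : ℕ) : TopologicalSpace (QuiltedDisks n) :=
  TopologicalSpace.induced (fun x => NodalQuiltedDisk.crossRatios (Quotient.out x)) inferInstance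

/-- The class of a nodal disk. -/
def QuiltedDisks.mk {n : ℕ} (S : NodalQuiltedDisk n) : QuiltedDisks n := Quotient.mk _ S

/-- The stratum of classes of nodal disks of combinatorial type `T`. -/
def QuiltedDisks.stratum {n : ℕ} (T : ColoredTree n) : Set (QuiltedDisks n) :=
  {x | ∃ S : NodalQuiltedDisk n, QuiltedDisks.mk S = x ∧ ∃ σ, S.tree.IsIso T σ}

/-- The lower and the upper leaf of the `i`-th pair of adjacent leaves. -/
def lowerLeaf {n : ℕ} (i : Fin (n - 1)) : Fin n := ⟨i.1, by omega⟩

def upperLeaf {n : ℕ} (i : Fin (n - 1)) : Fin n := ⟨i.1 + 1, by omega⟩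

/-- The vertex `v_i` at which the paths from two adjacent leaves to the root meet. -/
noncomputable def ColoredTree.gapVertex {n : ℕ} (T : ColoredTree n) (i : Fin (n - 1)) : Fin T.m :=
  T.meet (lowerLeaf i) (upperLeaf i)

namespace NodalQuiltedDisk

variable {n : ℕ}

/-- The coordinate of a point `z` of the component of `v`, in the identification of the disk with
the upper half-plane that sends the special point `out v` to infinity. -/
noncomputable def halfPlane (S : NodalQuiltedDisk n) (v : Fin S.tree.m) (z : ℂ) : ℂ :=
  Complex.I * ((S.out v : ℂ) + z) / ((S.out v : ℂ) - z)

/-- The distance `x_i = z_{i+1} - z_i` on the component of `v`. -/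
noncomputable def gap (S : NodalQuiltedDisk n) (v : Fin S.tree.m) (i : Fin (n - 1)) : ℝ :=
  (S.halfPlane v (S.leafPoint v (upperLeaf i))).re -
    (S.halfPlane v (S.leafPoint v (lowerLeaf i))).re

/-- The height `y` of the horizontal line that is the seam of a quilted component. -/
noncomputable def height (S : NodalQuiltedDisk n) (v : {v // v ∈ S.tree.col}) : ℝ :=
  (S.halfPlane v.1 (((1 - 2 * S.radius v : ℝ) : ℂ) * (S.out v.1 : ℂ))).im

/-- For a maximal tree `T` and a nodal disk `S` whose type is a contraction of `T`, the
labelling `φ` of the edges of `T` is the one by the simple ratios of `S`. The label is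

* `x_i / x_j`, measured on the component where `z_j`, `z_{j+1}`, `z_0` are distinct, for an edge
  from `v_i` to its parent `v_j`;
* `x_i / y`, measured on the component where `z_i`, `z_{i+1}`, `z_0` are distinct, for an edge
  from `v_i` to a coloured parent (it is `x_i / ∞ = 0` if that component is not quilted);
* `y / x_i`, measured on the same component, for an edge from a coloured vertex to its
  parent `v_i` (it is `0 / x_i = 0` if that component is not quilted). -/
structure HasSimpleRatios (S : NodalQuiltedDisk n) (T : ColoredTree n) (φ : T.Edge → ℝ) :
    Prop where
  uncolored : ∀ (e : T.Edge) (i j : Fin (n - 1)), T.gapVertex i = e.1 →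
    T.gapVertex j = T.parent e.1 →
    φ e = S.gap (S.tree.gapVertex j) i / S.gap (S.tree.gapVertex j) j
  colored_above : ∀ (e : T.Edge) (i : Fin (n - 1)), T.gapVertex i = e.1 → T.parent e.1 ∈ T.col →
    φ e = if h : S.tree.gapVertex i ∈ S.tree.col then
      S.gap (S.tree.gapVertex i) i / S.height ⟨S.tree.gapVertex i, h⟩ else 0
  colored_below : ∀ (e : T.Edge) (i : Fin (n - 1)), e.1 ∈ T.col → T.gapVertex i = T.parent e.1 →
    φ e = if h : S.tree.gapVertex i ∈ S.tree.col then
      S.height ⟨S.tree.gapVertex i, h⟩ / S.gap (S.tree.gapVertex i) i else 0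

end NodalQuiltedDisk

open Classical in
/-- `exp (-l)` for a length `l ∈ [0, ∞]`, with `exp (-∞) = 0`. -/
noncomputable def expNeg (l : ENNReal) : ℝ := if l = ⊤ then 0 else Real.exp (-l.toReal)

/-- `Θ` is given by exponentiation of the edge labels: for every maximal tree `T` and lengths
`len` in its closed cell, `Θ (T, len)` is the nodal disk in the domain of the simple ratio chart
of `T` (its type is a contraction of `T`) with simple ratios `exp (-len e)`.  Every point of the
space of metric trees lies in the closed cell of a maximal tree. -/
def IsExponentiation {n : ℕ} (Θ : MetricTrees n → QuiltedDisks n) : Prop :=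
  ∀ T : ColoredTree n, T.IsMaximal → ∀ len : T.Cell,
    ∃ S : NodalQuiltedDisk n, QuiltedDisks.mk S = Θ (MetricTrees.mk T len) ∧
      (∃ f, T.IsMorphism S.tree f) ∧ S.HasSimpleRatios T (fun e => expNeg (len.1 e))

/-! Both spaces are compared inside one space of numbers, `Data n`. For two leaves `a < b`, look at
the component on which they part. Record the gaps between adjacent markings from `a` to `b`, each
divided by the largest of them, and record the ratio of the seam height to this largest gap together
with the inverse ratio, both truncated at 1. This is `diskData`. Its counterpart `metricData`
consists of exponentials of negative path lengths: from the vertex of a gap up to the vertex where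
`a` and `b` meet, and between that vertex and the coloured vertex above `a`, in either direction.

Each family is a complete invariant. For metric trees (`MetricTrees.mk_eq_iff`), contracting edges
of length zero does not change path lengths, and path lengths determine the representative without
such edges. For disks (`iso_iff_diskData_eq`), a disk automorphism matching the root-side points is
a real affine map of half-planes, so that exactly the ratios of sizes on each component are
invariant. In both arguments the tree itself has to be recovered from the data. Its shape is encoded
by three kinds of statements about meets of leaves and coloured vertices, and
`Degenerates.exists_isMorphism` turns the transfer of such statements into a contraction of trees.

The two invariants have the same image. Given lengths, contract the edges of finite length and give
every vertex the size `exp (-d)`, where `d` is its distance to the top of its contracted piece;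
balancing says that each quilted component gets a single seam height (`exists_diskData_eq`). Given a
disk, refine its tree to a maximal one in which sizes increase towards the root, and take logarithms
of ratios as lengths (`exists_refinement`, `exists_metricData_eq`). Thus equality of data defines a
bijection, `exponentiation`. On maximal trees equality of data is equivalent to the simple ratio
equations, and maximal cells cover the space of metric trees; this gives existence and uniqueness of
the map.

For the topology, the cross-ratios are continuous functions of the data (`rhoFour_eq`, `rhoTwo_eq`)
and conversely determine it (`diskData_eq_of_crossRatios_eq`). So the moduli space is Hausdorff and
the bijection is continuous, while the space of metric trees is compact, being a quotient of
finitely many compact cells. Finally, a point in the cell of `T` is sent to a disk of type `T`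
exactly when all lengths are infinite. -/

namespace ColoredTree

variable {n : ℕ}

/-! ### The order of the vertices along paths to the root -/

section Order

variable (T : ColoredTree n)

theorem Below.refl (v : Fin T.m) : T.Below v v := ⟨0, rfl⟩

variable {T}

theorem Below.trans {u v w : Fin T.m} (h : T.Below u v) (h' : T.Below v w) : T.Below u w := by
  obtain ⟨s, rfl⟩ := h
  obtain ⟨t, rfl⟩ := h'
  exact ⟨t + s, Function.iterate_add_apply _ _ _ _⟩

theorem below_parent (v : Fin T.m) : T.Below v (T.parent v) := ⟨1, rfl⟩

theorem below_root (v : Fin T.m) : T.Below v T.root := T.reaches_root v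

theorem iterate_parent_root (t : ℕ) : T.parent^[t] T.root = T.root :=
  Function.iterate_fixed T.parent_root t

theorem Below.total {u v w : Fin T.m} (h : T.Below u v) (h' : T.Below u w) :
    T.Below v w ∨ T.Below w v := by
  obtain ⟨s, rfl⟩ := h
  obtain ⟨t, rfl⟩ := h'
  rcases le_total s t with hst | hst
  · exact Or.inl ⟨t - s, by rw [← Function.iterate_add_apply, Nat.sub_add_cancel hst]⟩
  · exact Or.inr ⟨s - t, by rw [← Function.iterate_add_apply, Nat.sub_add_cancel hst]⟩

/-- Every orbit of `parent` runs into the fixed point `root`, so no other vertex can be periodic.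
Antisymmetry of `Below` rests on this absence of cycles. -/
theorem eq_root_of_iterate {v : Fin T.m} {k : ℕ} (hk : 0 < k) (h : T.parent^[k] v = v) :
    v = T.root := by
  obtain ⟨t, ht⟩ := T.reaches_root v
  have h1 : ∀ N, T.parent^[k * N] v = v := fun N => by
    rw [Function.iterate_mul]
    exact Function.iterate_fixed h N
  have h2 : t ≤ k * t := Nat.le_mul_of_pos_left t hk
  rw [← h1 t, ← Nat.sub_add_cancel h2, Function.iterate_add_apply, ht, iterate_parent_root]

theorem Below.antisymm {u v : Fin T.m} (h : T.Below u v) (h' : T.Below v u) : u = v := by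
  obtain ⟨s, rfl⟩ := h
  obtain ⟨t, ht⟩ := h'
  rcases Nat.eq_zero_or_pos s with rfl | hs
  · rfl
  · have : u = T.root := eq_root_of_iterate (k := t + s) (by omega)
      (by rw [Function.iterate_add_apply, ht])
    rw [this, iterate_parent_root]

theorem below_iff {u v : Fin T.m} : T.Below u v ↔ u = v ∨ T.Below (T.parent u) v := by
  constructor
  · rintro ⟨t, rfl⟩
    rcases t with _ | t
    · exact Or.inl rfl
    · exact Or.inr ⟨t, by rw [Function.iterate_succ_apply]⟩
  · rintro (rfl | h)
    · exact Below.refl T u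
    · exact (below_parent u).trans h

theorem Below.parent_of_ne {u v : Fin T.m} (h : T.Below u v) (hne : u ≠ v) :
    T.Below (T.parent u) v := (below_iff.1 h).resolve_left hne

theorem Below.ne_root_of_ne {u v : Fin T.m} (h : T.Below u v) (hne : u ≠ v) : u ≠ T.root := by
  rintro rfl
  exact hne (h.antisymm (below_root v))

theorem parent_ne {v : Fin T.m} (h : v ≠ T.root) : T.parent v ≠ v := fun hv =>
  h (eq_root_of_iterate one_pos hv)

theorem Below.exists_child {u v : Fin T.m} (h : T.Below u v) (hne : u ≠ v) :
    ∃ e, T.Below u e ∧ T.parent e = v ∧ e ≠ v := by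
  obtain ⟨t, rfl⟩ := h
  induction t with
  | zero => exact absurd rfl hne
  | succ t ih =>
    rw [Function.iterate_succ_apply'] at hne ⊢
    by_cases hp : T.parent (T.parent^[t] u) = T.parent^[t] u
    · rw [hp] at hne ⊢
      exact ih hne
    · exact ⟨_, ⟨t, rfl⟩, rfl, fun h => hp h.symm⟩

theorem exists_minimal (P : Fin T.m → Prop) (h : ∃ v, P v) :
    ∃ v, P v ∧ ∀ u, P u → T.Below u v → u = v := by
  let r : Fin T.m → Fin T.m → Prop := fun u v => T.Below u v ∧ u ≠ v
  have : IsTrans (Fin T.m) r := ⟨fun a b c hab hbc => ⟨hab.1.trans hbc.1, fun hac => by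
    subst hac
    exact hab.2 (hab.1.antisymm hbc.1)⟩⟩
  have : Std.Irrefl r := ⟨fun a h => h.2 rfl⟩
  have wf : WellFounded r := Finite.wellFounded_of_trans_of_irrefl r
  obtain ⟨v, hv, hmin⟩ := wf.has_min {v | P v} h
  exact ⟨v, hv, fun u hu huv => by
    by_contra hne
    exact hmin u hu ⟨huv, hne⟩⟩

theorem below_induction {P : Fin T.m → Prop} (root : P T.root)
    (step : ∀ v, v ≠ T.root → P (T.parent v) → P v) (v : Fin T.m) : P v := by
  obtain ⟨t, ht⟩ := T.reaches_root v
  induction t generalizing v with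
  | zero =>
    have hv : v = T.root := ht
    exact hv ▸ root
  | succ t ih =>
    by_cases hv : v = T.root
    · exact hv ▸ root
    · exact step v hv (ih _ (by rwa [Function.iterate_succ_apply] at ht))

/-- Induction along the path from a vertex up to `v`. -/
theorem Below.induction {v : Fin T.m} {P : Fin T.m → Prop} (base : P v)
    (step : ∀ u, u ≠ v → u ≠ T.root → T.Below (T.parent u) v → P (T.parent u) → P u)
    {u : Fin T.m} (h : T.Below u v) : P u := by
  obtain ⟨t, ht⟩ := h
  induction t generalizing u with
  | zero =>
    have hu : u = v := ht
    exact hu ▸ base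
  | succ t ih =>
    by_cases huv : u = v
    · exact huv ▸ base
    · rw [Function.iterate_succ_apply] at ht
      have hb : T.Below (T.parent u) v := ⟨t, ht⟩
      exact step u huv (((below_parent u).trans hb).ne_root_of_ne huv) hb (ih ht)

end Order

/-! ### Incoming edges and the vertices where two leaves meet -/

section InEdges

variable {T : ColoredTree n}

theorem Carries.below {a : T.InEdge} {i : Fin n} (h : T.Carries a i) :
    T.Below (T.leaf i) (T.target a) := by
  rcases a with e | j
  · exact Below.trans h (below_parent _)
  · cases h
    exact Below.refl T _

theorem exists_inEdge {v : Fin T.m} {i : Fin n} (h : T.Below (T.leaf i) v) :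
    ∃ a, T.target a = v ∧ T.Carries a i := by
  by_cases hv : T.leaf i = v
  · exact ⟨.inr i, hv, rfl⟩
  · obtain ⟨e, h1, h2, h3⟩ := h.exists_child hv
    exact ⟨.inl ⟨e, fun he => h3 (by rw [← h2, he, T.parent_root])⟩, h2, h1⟩

/-- Two edges on the path of one leaf are comparable; if they were different and had the same end,
one of them would start at or above that end, which creates a cycle. -/
theorem inEdge_unique {a b : T.InEdge} {i : Fin n} (hab : T.target a = T.target b)
    (ha : T.Carries a i) (hb : T.Carries b i) : a = b := by
  rcases a with e | j <;> rcases b with e' | k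
  · have key : ∀ e e' : T.Edge, T.parent e.1 = T.parent e'.1 → T.Below e.1 e'.1 → e = e' := by
      intro e e' h1 h2
      by_contra hne
      have h3 := h2.parent_of_ne (fun h => hne (Subtype.ext h))
      rw [h1] at h3
      exact parent_ne e'.2 (h3.antisymm (below_parent _))
    rcases Below.total ha hb with h | h
    · rw [key e e' hab h]
    · rw [key e' e hab.symm h]
  · cases hb
    have h1 : T.parent e.1 = T.leaf i := hab
    have h2 : T.Below (T.leaf i) e.1 := ha
    rw [← h1] at h2
    exact absurd (h2.antisymm (below_parent _)) (parent_ne e.2)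
  · cases ha
    have h1 : T.leaf i = T.parent e'.1 := hab
    have h2 : T.Below (T.leaf i) e'.1 := hb
    rw [h1] at h2
    exact absurd (h2.antisymm (below_parent _)) (parent_ne e'.2)
  · cases ha
    cases hb
    rfl

variable (T) in
/-- The edges attached to `v` on the side of the leaves. -/
def inEdgeEquiv (v : Fin T.m) : {a : T.InEdge // T.target a = v} ≃
    {c : Fin T.m // c ≠ T.root ∧ T.parent c = v} ⊕ {i : Fin n // T.leaf i = v} where
  toFun a := match a with
    | ⟨.inl e, h⟩ => .inl ⟨e.1, e.2, h⟩
    | ⟨.inr i, h⟩ => .inr ⟨i, h⟩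
  invFun b := match b with
    | .inl c => ⟨.inl ⟨c.1, c.2.1⟩, c.2.2⟩
    | .inr i => ⟨.inr i.1, i.2⟩
  left_inv := by rintro ⟨_ | _, h⟩ <;> rfl
  right_inv := by rintro (_ | _) <;> rfl

theorem card_inEdge (v : Fin T.m) : Nat.card {a : T.InEdge // T.target a = v} =
    Nat.card {c : Fin T.m // c ≠ T.root ∧ T.parent c = v} + Nat.card {i : Fin n // T.leaf i = v} := by
  rw [Nat.card_congr (T.inEdgeEquiv v), Nat.card_sum]

theorem exists_inEdge_target (v : Fin T.m) : ∃ a, T.target a = v := by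
  have h : 1 ≤ Nat.card {a : T.InEdge // T.target a = v} := by
    rw [card_inEdge]
    by_cases hv : v ∈ T.col
    · exact T.stable_colored v hv
    · exact le_trans (by norm_num) (T.stable_uncolored v hv)
  have : Nonempty {a : T.InEdge // T.target a = v} := (Nat.card_pos_iff.1 h).1
  exact ⟨_, (Classical.arbitrary {a : T.InEdge // T.target a = v}).2⟩

theorem exists_leaf_below (v : Fin T.m) : ∃ i, T.Below (T.leaf i) v := by
  obtain ⟨u, hu, hmin⟩ := T.exists_minimal (fun u => T.Below u v) ⟨v, Below.refl T v⟩
  obtain ⟨a, ha⟩ := exists_inEdge_target u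
  rcases a with e | i
  · have h1 : T.Below e.1 u := ha ▸ below_parent e.1
    have h2 := hmin e.1 (h1.trans hu) h1
    exact absurd ((show T.parent e.1 = u from ha).trans h2.symm) (parent_ne e.2)
  · exact ⟨i, (show T.leaf i = u from ha) ▸ hu⟩

theorem exists_carries (a : T.InEdge) : ∃ i, T.Carries a i := by
  rcases a with e | i
  · exact exists_leaf_below e.1
  · exact ⟨i, rfl⟩

theorem exists_inEdge_pair {v : Fin T.m} (hv : v ∉ T.col) :
    ∃ a b, a ≠ b ∧ T.target a = v ∧ T.target b = v := by
  have h : 2 ≤ Nat.card {a : T.InEdge // T.target a = v} := by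
    rw [card_inEdge]
    exact T.stable_uncolored v hv
  obtain ⟨a, b, hab⟩ := (Finite.one_lt_card_iff_nontrivial.1 h).exists_pair_ne
  exact ⟨a.1, b.1, fun h => hab (Subtype.ext h), a.2, b.2⟩

theorem Meets.below_left {v : Fin T.m} {i j : Fin n} (h : T.Meets v i j) :
    T.Below (T.leaf i) v := by
  obtain ⟨a, b, -, ha, -, hi, -⟩ := h
  exact ha ▸ hi.below

theorem Meets.symm {v : Fin T.m} {i j : Fin n} (h : T.Meets v i j) : T.Meets v j i := by
  obtain ⟨a, b, h1, h2, h3, h4, h5⟩ := h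
  exact ⟨b, a, h1.symm, h3, h2, h5, h4⟩

theorem Meets.below_right {v : Fin T.m} {i j : Fin n} (h : T.Meets v i j) :
    T.Below (T.leaf j) v := h.symm.below_left

theorem Meets.ne {v : Fin T.m} {i j : Fin n} (h : T.Meets v i j) : i ≠ j := by
  rintro rfl
  obtain ⟨a, b, hab, ha, hb, hi, hj⟩ := h
  exact hab (inEdge_unique (ha.trans hb.symm) hi hj)

/-- If `w` were strictly beyond `v`, the incoming edge of `v` towards `w` would carry both leaves
and hence agree with both of the distinct edges that witness the meeting. -/
theorem Meets.below_of_common {v w : Fin T.m} {i j : Fin n} (h : T.Meets v i j)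
    (hi : T.Below (T.leaf i) w) (hj : T.Below (T.leaf j) w) : T.Below v w := by
  rcases h.below_left.total hi with h1 | h1
  · exact h1
  by_cases hvw : w = v
  · exact hvw ▸ Below.refl T _
  obtain ⟨e, h2, h3, h4⟩ := h1.exists_child hvw
  obtain ⟨a, b, hab, ha, hb, hai, hbj⟩ := h
  have he : e ≠ T.root := fun he => h4 (by rw [← h3, he, T.parent_root])
  have ta : T.target (.inl ⟨e, he⟩) = v := h3
  have e1 := inEdge_unique (ha.trans ta.symm) hai (show T.Carries (.inl ⟨e, he⟩) i from hi.trans h2)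
  have e2 := inEdge_unique (hb.trans ta.symm) hbj (show T.Carries (.inl ⟨e, he⟩) j from hj.trans h2)
  exact absurd (e1.trans e2.symm) hab

theorem exists_meets {i j : Fin n} (hij : i ≠ j) : ∃ v, T.Meets v i j := by
  obtain ⟨v, ⟨h1, h2⟩, hmin⟩ := T.exists_minimal
    (fun v => T.Below (T.leaf i) v ∧ T.Below (T.leaf j) v) ⟨T.root, below_root _, below_root _⟩
  obtain ⟨a, ha, hai⟩ := exists_inEdge h1
  obtain ⟨b, hb, hbj⟩ := exists_inEdge h2
  refine ⟨v, a, b, ?_, ha, hb, hai, hbj⟩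
  rintro rfl
  rcases a with e | k
  · have h3 : T.Below e.1 v := ha ▸ below_parent e.1
    exact parent_ne e.2 ((show T.parent e.1 = v from ha).trans (hmin e.1 ⟨hai, hbj⟩ h3).symm)
  · exact hij ((show k = i from hai).symm.trans hbj)

theorem meets_meet {i j : Fin n} (hij : i ≠ j) : T.Meets (T.meet i j) i j :=
  Classical.epsilon_spec_aux _ _ (exists_meets hij)

theorem Meets.eq_meet {v : Fin T.m} {i j : Fin n} (h : T.Meets v i j) : T.meet i j = v := by
  have h' := meets_meet (T := T) h.ne
  exact (h'.below_of_common h.below_left h.below_right).antisymm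
    (h.below_of_common h'.below_left h'.below_right)

theorem leaf_below_meet_left {i j : Fin n} (hij : i ≠ j) : T.Below (T.leaf i) (T.meet i j) :=
  (meets_meet hij).below_left

theorem leaf_below_meet_right {i j : Fin n} (hij : i ≠ j) : T.Below (T.leaf j) (T.meet i j) :=
  (meets_meet hij).below_right

theorem meet_below {i j : Fin n} (hij : i ≠ j) {w : Fin T.m} (hi : T.Below (T.leaf i) w)
    (hj : T.Below (T.leaf j) w) : T.Below (T.meet i j) w :=
  (meets_meet hij).below_of_common hi hj

theorem meet_comm {i j : Fin n} (hij : i ≠ j) : T.meet i j = T.meet j i :=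
  (meets_meet hij).symm.eq_meet.symm

theorem meet_eq_of_forall {i j : Fin n} (hij : i ≠ j) {v : Fin T.m} (hi : T.Below (T.leaf i) v)
    (hj : T.Below (T.leaf j) v)
    (h : ∀ w, T.Below (T.leaf i) w → T.Below (T.leaf j) w → T.Below v w) : T.meet i j = v :=
  (meet_below hij hi hj).antisymm (h _ (leaf_below_meet_left hij) (leaf_below_meet_right hij))

/-- By stability an uncoloured vertex has an incoming edge other than the one carrying `i`; any leaf
on it will do. -/
theorem exists_meet_eq {v : Fin T.m} (hv : v ∉ T.col) {i : Fin n} (hi : T.Below (T.leaf i) v) :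
    ∃ j, i ≠ j ∧ T.meet i j = v := by
  obtain ⟨a, b, hab, ha, hb⟩ := exists_inEdge_pair hv
  obtain ⟨c, hc, hci⟩ := exists_inEdge hi
  have key : ∀ d, c ≠ d → T.target d = v → ∃ j, i ≠ j ∧ T.meet i j = v := by
    intro d hcd hd
    obtain ⟨j, hj⟩ := exists_carries d
    have hm : T.Meets v i j := ⟨c, d, hcd, hc, hd, hci, hj⟩
    exact ⟨j, hm.ne, hm.eq_meet⟩
  by_cases hca : c = a
  · exact key b (hca ▸ hab) hb
  · exact key a hca ha

end InEdges

/-! ### Gaps between adjacent leaves -/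

section Gaps

variable {T : ColoredTree n}

theorem lowerLeaf_lt_upperLeaf (i : Fin (n - 1)) : lowerLeaf i < upperLeaf i := Nat.lt_succ_self _

theorem ribbon' {v : Fin T.m} {i j k : Fin n} (hij : i ≤ j) (hjk : j ≤ k)
    (hi : T.Below (T.leaf i) v) (hk : T.Below (T.leaf k) v) : T.Below (T.leaf j) v := by
  rcases hij.eq_or_lt with rfl | hij
  · exact hi
  rcases hjk.eq_or_lt with rfl | hjk
  · exact hk
  exact T.ribbon v i j k hij hjk hi hk

/-- The gap `i` lies between the leaves `a` and `b`. -/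
def GapIn (a b : Fin n) (i : Fin (n - 1)) : Prop := a ≤ lowerLeaf i ∧ upperLeaf i ≤ b

theorem GapIn.lt {a b : Fin n} {i : Fin (n - 1)} (h : GapIn a b i) : a < b :=
  lt_of_le_of_lt h.1 (lt_of_lt_of_le (lowerLeaf_lt_upperLeaf i) h.2)

theorem gapIn_self (i : Fin (n - 1)) : GapIn (lowerLeaf i) (upperLeaf i) i := ⟨le_rfl, le_rfl⟩

theorem gapIn_iff {a b : Fin n} {i : Fin (n - 1)} : GapIn a b i ↔ a.1 ≤ i.1 ∧ i.1 < b.1 := by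
  simp only [GapIn, Fin.le_def, lowerLeaf, upperLeaf, Nat.succ_le_iff]

theorem lower_below_gapVertex (i : Fin (n - 1)) : T.Below (T.leaf (lowerLeaf i)) (T.gapVertex i) :=
  leaf_below_meet_left (lowerLeaf_lt_upperLeaf i).ne

theorem upper_below_gapVertex (i : Fin (n - 1)) : T.Below (T.leaf (upperLeaf i)) (T.gapVertex i) :=
  leaf_below_meet_right (lowerLeaf_lt_upperLeaf i).ne

theorem gapVertex_below {i : Fin (n - 1)} {w : Fin T.m} (hi : T.Below (T.leaf (lowerLeaf i)) w)
    (hj : T.Below (T.leaf (upperLeaf i)) w) : T.Below (T.gapVertex i) w :=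
  meet_below (lowerLeaf_lt_upperLeaf i).ne hi hj

theorem GapIn.gapVertex_below {a b : Fin n} {i : Fin (n - 1)} (h : GapIn a b i) {w : Fin T.m}
    (ha : T.Below (T.leaf a) w) (hb : T.Below (T.leaf b) w) : T.Below (T.gapVertex i) w :=
  ColoredTree.gapVertex_below (ribbon' h.1 ((lowerLeaf_lt_upperLeaf i).le.trans h.2) ha hb)
    (ribbon' (h.1.trans (lowerLeaf_lt_upperLeaf i).le) h.2 ha hb)

theorem GapIn.gapVertex_below_meet {a b : Fin n} {i : Fin (n - 1)} (h : GapIn a b i) :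
    T.Below (T.gapVertex i) (T.meet a b) :=
  h.gapVertex_below (leaf_below_meet_left h.lt.ne) (leaf_below_meet_right h.lt.ne)

/-- A discrete intermediate value argument: a property that changes between `a` and `b` changes
across some adjacent pair. -/
theorem exists_gap_step {a b : Fin n} (hab : a < b) (P : Fin n → Prop) (ha : P a) (hb : ¬ P b) :
    ∃ i, GapIn a b i ∧ P (lowerLeaf i) ∧ ¬ P (upperLeaf i) := by
  by_contra hcon
  push Not at hcon
  have key : ∀ k (hk : k < n), a.1 ≤ k → k ≤ b.1 → P ⟨k, hk⟩ := by
    intro k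
    induction k with
    | zero =>
      intro hk h1 _
      have : a = ⟨0, hk⟩ := Fin.ext (by simpa using h1)
      exact this ▸ ha
    | succ k ih =>
      intro hk h1 h2
      rcases Nat.lt_or_ge k a.1 with h3 | h3
      · have : a = ⟨k + 1, hk⟩ := Fin.ext (by simp; omega)
        exact this ▸ ha
      · exact hcon ⟨k, by omega⟩ (gapIn_iff.2 ⟨h3, h2⟩) (ih (by omega) h3 (by omega))
  exact hb (key b.1 b.2 hab.le le_rfl)

/-- Going from `x` to `y`, at some gap the leaf stops being carried by `a`. By the ribbon condition
the next leaf is still beyond the same vertex, so it enters through another edge and the adjacent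
pair meets exactly there. -/
theorem exists_gap_of_inEdges {a b : T.InEdge} {x y : Fin n} (hab : a ≠ b)
    (ht : T.target a = T.target b) (ha : T.Carries a x) (hb : T.Carries b y) (hxy : x < y) :
    ∃ i, GapIn x y i ∧ T.gapVertex i = T.target a ∧ T.Carries a (lowerLeaf i) := by
  obtain ⟨i, hi, h1, h2⟩ := exists_gap_step hxy (T.Carries a) ha
    (fun h => hab (inEdge_unique ht h hb))
  have hu : T.Below (T.leaf (upperLeaf i)) (T.target a) :=
    ribbon' (hi.1.trans (lowerLeaf_lt_upperLeaf i).le) hi.2 ha.below (ht ▸ hb.below)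
  obtain ⟨c, hc, hcu⟩ := exists_inEdge hu
  exact ⟨i, hi, Meets.eq_meet ⟨a, c, fun h => h2 (h ▸ hcu), rfl, hc, h1, hcu⟩, h1⟩

theorem exists_gapVertex_eq_meet {a b : Fin n} (hab : a < b) :
    ∃ i, GapIn a b i ∧ T.gapVertex i = T.meet a b := by
  obtain ⟨c, d, hcd, hc, hd, hca, hdb⟩ := meets_meet (T := T) hab.ne
  obtain ⟨i, hi, h1, -⟩ := exists_gap_of_inEdges hcd (hc.trans hd.symm) hca hdb hab
  exact ⟨i, hi, h1.trans hc⟩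

theorem exists_gapVertex_of_inEdge_pair {a b : T.InEdge} (hab : a ≠ b)
    (ht : T.target a = T.target b) : ∃ i, T.gapVertex i = T.target a := by
  obtain ⟨x, hx⟩ := exists_carries a
  obtain ⟨y, hy⟩ := exists_carries b
  rcases lt_trichotomy x y with h | h | h
  · obtain ⟨i, -, hi, -⟩ := exists_gap_of_inEdges hab ht hx hy h
    exact ⟨i, hi⟩
  · exact absurd (inEdge_unique ht hx (h ▸ hy)) hab
  · obtain ⟨i, -, hi, -⟩ := exists_gap_of_inEdges hab.symm ht.symm hy hx h
    exact ⟨i, hi.trans ht.symm⟩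

theorem exists_gapVertex {v : Fin T.m} (hv : v ∉ T.col) : ∃ i, T.gapVertex i = v := by
  obtain ⟨a, b, hab, ha, hb⟩ := exists_inEdge_pair hv
  obtain ⟨i, hi⟩ := exists_gapVertex_of_inEdge_pair hab (ha.trans hb.symm)
  exact ⟨i, hi.trans ha⟩

theorem meet_eq_gapVertex_of_below {a b : Fin n} {i : Fin (n - 1)} (h : GapIn a b i)
    (ha : T.Below (T.leaf a) (T.gapVertex i)) (hb : T.Below (T.leaf b) (T.gapVertex i)) :
    T.gapVertex i = T.meet a b :=
  h.gapVertex_below_meet.antisymm (meet_below h.lt.ne ha hb)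

end Gaps

/-! ### Coloured vertices -/

section Colors

variable (T : ColoredTree n)

/-- The coloured vertex on the path from the leaf `i` to the root. -/
noncomputable def cv (i : Fin n) : Fin T.m := (T.col_path i).choose

variable {T}

theorem cv_mem (i : Fin n) : T.cv i ∈ T.col := (T.col_path i).choose_spec.1.1

theorem leaf_below_cv (i : Fin n) : T.Below (T.leaf i) (T.cv i) := (T.col_path i).choose_spec.1.2

theorem eq_cv {i : Fin n} {v : Fin T.m} (hv : v ∈ T.col) (h : T.Below (T.leaf i) v) : v = T.cv i :=
  (T.col_path i).choose_spec.2 v ⟨hv, h⟩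

theorem exists_eq_cv {v : Fin T.m} (hv : v ∈ T.col) : ∃ i, v = T.cv i := by
  obtain ⟨i, hi⟩ := exists_leaf_below v
  exact ⟨i, eq_cv hv hi⟩

theorem eq_of_col_below {c c' : Fin T.m} (hc : c ∈ T.col) (hc' : c' ∈ T.col) (h : T.Below c c') :
    c = c' := by
  obtain ⟨i, hi⟩ := exists_leaf_below c
  rw [eq_cv hc hi, eq_cv hc' (hi.trans h)]

theorem cv_eq_of_below {i j : Fin n} (h : T.Below (T.leaf j) (T.cv i)) : T.cv j = T.cv i :=
  (eq_cv (cv_mem i) h).symm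

theorem meet_below_cv_iff {i j : Fin n} (hij : i ≠ j) :
    T.Below (T.meet i j) (T.cv i) ↔ T.cv i = T.cv j := by
  constructor
  · intro h
    exact (cv_eq_of_below ((leaf_below_meet_right hij).trans h)).symm
  · intro h
    exact meet_below hij (leaf_below_cv i) (h ▸ leaf_below_cv j)

theorem cv_below_or {i : Fin n} {v : Fin T.m} (h : T.Below (T.leaf i) v) :
    T.Below (T.cv i) v ∨ T.Below v (T.cv i) := (leaf_below_cv i).total h

/-- If the coloured vertex for `j` were on the root side of `v`, it would also lie on the path of
`i`, hence be the coloured vertex of `i`. So all colours seen from `v` are on the same side. -/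
theorem cv_below_of_cv_below {i j : Fin n} {v : Fin T.m} (hi : T.Below (T.leaf i) v)
    (hj : T.Below (T.leaf j) v) (h : T.Below (T.cv i) v) : T.Below (T.cv j) v := by
  rcases cv_below_or hj with h' | h'
  · exact h'
  · rwa [← cv_eq_of_below (hi.trans h')]

/-- This enumerates the vertices by leaves and gaps, data shared by all trees. It allows trees to be
compared and maps between them to be defined. -/
theorem mem_col_or_exists_gapVertex (v : Fin T.m) :
    (∃ i, v = T.cv i) ∨ (v ∉ T.col ∧ ∃ i, v = T.gapVertex i) := by
  by_cases hv : v ∈ T.col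
  · exact Or.inl (exists_eq_cv hv)
  · obtain ⟨i, hi⟩ := exists_gapVertex hv
    exact Or.inr ⟨hv, i, hi.symm⟩

end Colors

end ColoredTree


namespace ColoredTree

variable {n : ℕ}

/-! ### Constructing a tree from a finite tree-like order -/

section OfOrder

variable {P : Type*} [PartialOrder P] [Finite P]

/-- The elements above `x` form a chain, so a minimal element strictly above `x` is least; it serves
as the parent. -/
theorem exists_parent_map (chain : ∀ x y z : P, x ≤ y → x ≤ z → y ≤ z ∨ z ≤ y) (r : P)
    (top : ∀ x, x ≤ r) :
    ∃ par : P → P, par r = r ∧ (∀ x, x ≠ r → x < par x) ∧ ∀ x y, x < y → par x ≤ y := by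
  have key : ∀ x : P, ∃ p, (x = r → p = r) ∧ (x ≠ r → x < p) ∧ ∀ y, x < y → p ≤ y := by
    intro x
    by_cases hx : x = r
    · exact ⟨r, fun _ => rfl, fun h => absurd hx h,
        fun y hy => absurd (hy.trans_le (top y)) (hx ▸ lt_irrefl _)⟩
    · obtain ⟨p, hp, hmin⟩ := (Finite.to_wellFoundedLT (α := P)).wf.has_min {y | x < y}
        ⟨r, lt_of_le_of_ne (top x) hx⟩
      refine ⟨p, fun h => absurd h hx, fun _ => hp, fun y hy => ?_⟩
      rcases chain x p y (le_of_lt hp) hy.le with h | h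
      · exact h
      · rcases h.eq_or_lt with h | h
        · exact h.ge
        · exact absurd h (hmin y hy)
  choose par h1 h2 h3 using key
  exact ⟨par, h1 r rfl, h2, h3⟩

/-- A finite tree-like order with leaves and coloured elements defines a coloured tree. -/
theorem exists_of_order (chain : ∀ x y z : P, x ≤ y → x ≤ z → y ≤ z ∨ z ≤ y)
    (top : ∃ r : P, ∀ x, x ≤ r) (leafP : Fin n → P) (colP : Set P)
    (ribbonP : ∀ v i j k, i < j → j < k → leafP i ≤ v → leafP k ≤ v → leafP j ≤ v)
    (col_pathP : ∀ i, ∃! v, v ∈ colP ∧ leafP i ≤ v)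
    (uncolP : ∀ v, v ∉ colP → ∃ i j, i ≠ j ∧ leafP i ≤ v ∧ leafP j ≤ v ∧
      ∀ u, leafP i ≤ u → leafP j ≤ u → ¬ u < v)
    (coloredP : ∀ v, v ∈ colP → ∃ i, leafP i ≤ v) :
    ∃ (T : ColoredTree n) (e : Fin T.m ≃ P), (∀ u v, T.Below u v ↔ e u ≤ e v) ∧
      (∀ i, e (T.leaf i) = leafP i) ∧ ∀ v, v ∈ T.col ↔ e v ∈ colP := by
  classical
  obtain ⟨r, top⟩ := top
  obtain ⟨par, hpr, hlt, hle⟩ := exists_parent_map chain r top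
  obtain ⟨m, ⟨e'⟩⟩ := Finite.exists_equiv_fin P
  set e : Fin m ≃ P := e'.symm
  set p : Fin m → Fin m := fun v => e.symm (par (e v)) with hp
  have ep : ∀ v, e (p v) = par (e v) := fun v => by rw [hp]; exact e.apply_symm_apply _
  have le_par : ∀ x, x ≤ par x := fun x => by
    by_cases hx : x = r
    · rw [hx, hpr]
    · exact (hlt x hx).le
  have below : ∀ u v, (∃ t : ℕ, p^[t] u = v) ↔ e u ≤ e v := by
    intro u v
    constructor
    · rintro ⟨t, rfl⟩
      induction t with
      | zero => exact le_rfl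
      | succ t ih =>
        rw [Function.iterate_succ_apply', ep]
        exact ih.trans (le_par _)
    · intro h
      have key : ∀ x : P, ∀ u, e u = x → x ≤ e v → ∃ t : ℕ, p^[t] u = v := by
        intro x
        induction x using (Finite.to_wellFoundedGT (α := P)).wf.induction with
        | _ x ih =>
          intro u hu hx
          rcases hx.eq_or_lt with hx | hx
          · exact ⟨0, e.injective (hu.trans hx)⟩
          · have hxr : x ≠ r := fun h => absurd (hx.trans_le (top _)) (h ▸ lt_irrefl _)
            obtain ⟨t, ht⟩ := ih (par x) (hlt x hxr) (p u) (by rw [ep, hu]) (hle x _ hx)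
            exact ⟨t + 1, by rw [Function.iterate_succ_apply, ht]⟩
      exact key _ u rfl h
  -- The incoming edge of `v` through which leaf `i` arrives: the leaf itself, or the largest
  -- element strictly below `v` and above the leaf. Distinct branches are what the valence
  -- conditions count.
  have branch : ∀ (v : Fin m) (i : Fin n), leafP i ≤ e v →
      ∃ b : {c : Fin m // c ≠ e.symm r ∧ p c = v} ⊕ {i : Fin n // e.symm (leafP i) = v},
        (∀ c, b = .inl c → leafP i ≤ e c.1) ∧ ∀ j, b = .inr j → j.1 = i := by
    intro v i hi
    by_cases hv : leafP i = e v
    · exact ⟨.inr ⟨i, by rw [hv, e.symm_apply_apply]⟩, by simp, by rintro j hj; cases hj; rfl⟩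
    · have hi' := lt_of_le_of_ne hi hv
      obtain ⟨x, ⟨hx1, hx2⟩, hmax⟩ := (Finite.to_wellFoundedGT (α := P)).wf.has_min
        {x | leafP i ≤ x ∧ x < e v} ⟨_, le_rfl, hi'⟩
      have hxr : x ≠ r := fun h => absurd (hx2.trans_le (top _)) (h ▸ lt_irrefl _)
      have hpx : par x = e v := by
        rcases (hle x _ hx2).eq_or_lt with h | h
        · exact h
        · exact absurd (hlt x hxr) (hmax _ ⟨hx1.trans (le_par x), h⟩)
      refine ⟨.inl ⟨e.symm x, fun h => hxr (e.symm.injective h), ?_⟩, ?_, by simp⟩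
      · apply e.injective
        rw [ep, e.apply_symm_apply, hpx]
      · rintro c hc
        cases hc
        simpa using hx1
  let T : ColoredTree n :=
    { m := m
      root := e.symm r
      parent := p
      parent_root := by simp [hp, hpr]
      reaches_root := fun v => (below _ _).2 (by simpa using top _)
      leaf := fun i => e.symm (leafP i)
      ribbon := by
        intro v i j k hij hjk hi hk
        rw [below, e.apply_symm_apply] at hi hk ⊢
        exact ribbonP _ i j k hij hjk hi hk
      col := Finset.univ.filter fun v => e v ∈ colP
      col_path := by
        intro i
        obtain ⟨v, ⟨h1, h2⟩, h3⟩ := col_pathP i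
        refine ⟨e.symm v, ⟨by simpa using h1, (below _ _).2 (by simpa using h2)⟩, ?_⟩
        rintro w ⟨hw1, hw2⟩
        rw [below, e.apply_symm_apply] at hw2
        rw [← h3 (e w) ⟨by simpa using hw1, hw2⟩, e.symm_apply_apply]
      stable_uncolored := by
        intro v hv
        obtain ⟨i, j, hij, hi, hj, hmin⟩ := uncolP (e v) (by simpa using hv)
        obtain ⟨b, hb1, hb2⟩ := branch v i hi
        obtain ⟨c, hc1, hc2⟩ := branch v j hj
        rw [← Nat.card_sum]
        refine Finite.one_lt_card_iff_nontrivial.2 ⟨b, c, ?_⟩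
        rintro rfl
        rcases b with b | b
        · refine hmin _ (hb1 _ rfl) (hc1 _ rfl) ?_
          have hb : par (e b.1) = e v := by rw [← ep, b.2.2]
          exact lt_of_lt_of_eq (hlt _ fun h => b.2.1 ((e.eq_symm_apply).2 h)) hb
        · exact hij ((hb2 _ rfl).symm.trans (hc2 _ rfl))
      stable_colored := by
        intro v hv
        obtain ⟨i, hi⟩ := coloredP (e v) (by simpa using hv)
        obtain ⟨b, -⟩ := branch v i hi
        rw [← Nat.card_sum]
        have := Nonempty.intro b
        exact Nat.card_pos }
  exact ⟨T, e, below, fun i => e.apply_symm_apply _, fun v => by simp [T]⟩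

end OfOrder

/-! ### Contractions of trees and their characterization by meets -/

section Morphisms

variable {T T' : ColoredTree n} {f : Fin T.m → Fin T'.m}

namespace IsMorphism

variable (hf : T.IsMorphism T' f)
include hf

theorem below_map_parent (v : Fin T.m) : T'.Below (f v) (f (T.parent v)) := by
  rcases hf.parent v with h | h <;> rw [h]
  · exact Below.refl _ _
  · exact below_parent _

theorem mono {u v : Fin T.m} (h : T.Below u v) : T'.Below (f u) (f v) :=
  Below.induction (P := fun u => T'.Below (f u) (f v)) (Below.refl _ _)
    (fun u _ _ _ ih => (hf.below_map_parent u).trans ih) h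

theorem leaf_below_map {i : Fin n} {v : Fin T.m} (h : T.Below (T.leaf i) v) :
    T'.Below (T'.leaf i) (f v) := hf.leaf i ▸ hf.mono h

theorem map_cv (i : Fin n) : f (T.cv i) = T'.cv i :=
  eq_cv ((hf.col _).2 ⟨_, cv_mem i, rfl⟩) (hf.leaf_below_map (leaf_below_cv i))

/-- The image of a path is a path. -/
theorem exists_of_below_map {u : Fin T.m} {w : Fin T'.m} (h : T'.Below (f u) w) :
    ∃ v, T.Below u v ∧ f v = w ∧ (v = T.root ∨ f (T.parent v) ≠ f v) := by
  induction u using below_induction with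
  | root =>
    rw [hf.root] at h
    exact ⟨T.root, Below.refl _ _, hf.root.trans ((h.antisymm (below_root w)).symm ▸ rfl), Or.inl rfl⟩
  | step v hv ih =>
    by_cases h1 : T'.Below (f (T.parent v)) w
    · obtain ⟨x, hx1, hx2⟩ := ih h1
      exact ⟨x, (below_parent v).trans hx1, hx2⟩
    · have h2 : f (T.parent v) ≠ f v := fun h2 => h1 (h2 ▸ h)
      have h3 : f v = w := by
        by_contra h3
        apply h1
        rw [(hf.parent v).resolve_left h2]
        exact h.parent_of_ne h3
      exact ⟨v, Below.refl _ _, h3, Or.inr h2⟩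

/-- The path of leaf `i` maps onto its path in `T'`, so it leaves the fibre of `w` through a top
vertex, and a fibre has only one. -/
theorem below_of_fibre {w : Fin T'.m} {i : Fin n} (hi : T'.Below (T'.leaf i) w) {v : Fin T.m}
    (hv : f v = w ∧ (v = T.root ∨ f (T.parent v) ≠ f v)) : T.Below (T.leaf i) v := by
  rw [← hf.leaf i] at hi
  obtain ⟨x, hx1, hx2⟩ := hf.exists_of_below_map hi
  exact (hf.fibre w).unique hx2 hv ▸ hx1

/-- For the nontrivial inequality, both leaves lie beyond the top of the fibre over their meet in
`T'`; hence so does their meet in `T`. -/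
theorem map_meet {i j : Fin n} (hij : i ≠ j) : f (T.meet i j) = T'.meet i j := by
  apply Below.antisymm
  · obtain ⟨v, hv, -⟩ := hf.fibre (T'.meet i j)
    have := hf.mono (meet_below hij (hf.below_of_fibre (leaf_below_meet_left hij) hv)
      (hf.below_of_fibre (leaf_below_meet_right hij) hv))
    rwa [hv.1] at this
  · exact meet_below hij (hf.leaf_below_map (leaf_below_meet_left hij))
      (hf.leaf_below_map (leaf_below_meet_right hij))

theorem map_gapVertex (i : Fin (n - 1)) : f (T.gapVertex i) = T'.gapVertex i :=
  hf.map_meet (lowerLeaf_lt_upperLeaf i).ne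

theorem surjective : Function.Surjective f := fun w => by
  obtain ⟨v, hv, -⟩ := hf.fibre w
  exact ⟨v, hv.1⟩

theorem card_le : T'.m ≤ T.m := by
  simpa using Fintype.card_le_of_surjective f hf.surjective

theorem isIso_of_injective (hinj : Function.Injective f) :
    T.IsIso T' (Equiv.ofBijective f ⟨hinj, hf.surjective⟩) where
  root := hf.root
  leaf := hf.leaf
  parent v := by
    show f (T.parent v) = T'.parent (f v)
    by_cases hv : v = T.root
    · rw [hv, T.parent_root, hf.root, T'.parent_root]
    · exact (hf.parent v).resolve_left fun h => parent_ne hv (hinj h)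
  col v := by
    show f v ∈ T'.col ↔ _
    rw [hf.col]
    constructor
    · rintro ⟨u, hu, huv⟩
      exact hinj huv ▸ hu
    · exact fun h => ⟨v, h, rfl⟩

/-- Contractions are surjective, so without loss of vertices they are bijective. In particular
contractions in both directions between two trees give an isomorphism. -/
theorem exists_isIso (h : T.m ≤ T'.m) : ∃ σ, T.IsIso T' σ := by
  have hb : Function.Bijective f := (Fintype.bijective_iff_surjective_and_card f).2
    ⟨hf.surjective, by simpa using le_antisymm h hf.card_le⟩
  exact ⟨_, hf.isIso_of_injective hb.1⟩

end IsMorphism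

theorem IsIso.isMorphism {σ : Fin T.m ≃ Fin T'.m} (h : T.IsIso T' σ) : T.IsMorphism T' σ where
  root := h.root
  leaf := h.leaf
  parent v := Or.inr (h.parent v)
  col w := by
    constructor
    · intro hw
      exact ⟨σ.symm w, (h.col _).1 (by simpa using hw), by simp⟩
    · rintro ⟨v, hv, rfl⟩
      exact (h.col v).2 hv
  fibre w := by
    refine ⟨σ.symm w, ⟨by simp, ?_⟩, ?_⟩
    · by_cases hr : σ.symm w = T.root
      · exact Or.inl hr
      · exact Or.inr fun h' => parent_ne hr (σ.injective h')
    · rintro v ⟨rfl, -⟩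
      simp

theorem IsIso.symm {σ : Fin T.m ≃ Fin T'.m} (h : T.IsIso T' σ) : T'.IsIso T σ.symm where
  root := by rw [Equiv.symm_apply_eq, h.root]
  leaf i := by rw [Equiv.symm_apply_eq, h.leaf]
  parent v := by rw [Equiv.symm_apply_eq, h.parent, Equiv.apply_symm_apply]
  col v := by rw [← h.col, Equiv.apply_symm_apply]

/-- The combinatorial pattern of `T'` is a degeneration of the one of `T`. -/
structure Degenerates (T T' : ColoredTree n) : Prop where
  gap : ∀ a b i, GapIn a b i → T.gapVertex i = T.meet a b → T'.gapVertex i = T'.meet a b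
  above : ∀ a b, a < b → T.Below (T.cv a) (T.meet a b) → T'.Below (T'.cv a) (T'.meet a b)
  below : ∀ a b, a < b → T.Below (T.meet a b) (T.cv a) → T'.Below (T'.meet a b) (T'.cv a)

namespace Degenerates

variable (h : Degenerates T T')
include h

theorem above' {a b : Fin n} (hab : a ≠ b) (hc : T.Below (T.cv a) (T.meet a b)) :
    T'.Below (T'.cv a) (T'.meet a b) := by
  rcases hab.lt_or_gt with hlt | hlt
  · exact h.above a b hlt hc
  · rw [meet_comm hab] at hc ⊢
    exact cv_below_of_cv_below (leaf_below_meet_left hab.symm) (leaf_below_meet_right hab.symm)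
      (h.above b a hlt (cv_below_of_cv_below (leaf_below_meet_right hab.symm)
        (leaf_below_meet_left hab.symm) hc))

theorem cv_eq {a b : Fin n} (hc : T.cv a = T.cv b) : T'.cv a = T'.cv b := by
  rcases lt_trichotomy a b with hlt | rfl | hlt
  · exact (meet_below_cv_iff hlt.ne).1 (h.below a b hlt ((meet_below_cv_iff hlt.ne).2 hc))
  · rfl
  · exact ((meet_below_cv_iff hlt.ne).1 (h.below b a hlt ((meet_below_cv_iff hlt.ne).2 hc.symm))).symm

theorem gapVertex_eq {i j : Fin (n - 1)} (hij : T.gapVertex i = T.gapVertex j) :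
    T'.gapVertex i = T'.gapVertex j := by
  wlog hle : i ≤ j generalizing i j
  · exact (this hij.symm (le_of_not_ge hle)).symm
  have h1 : GapIn (lowerLeaf i) (upperLeaf j) i := gapIn_iff.2 ⟨le_rfl, Nat.lt_succ_of_le hle⟩
  have h2 : GapIn (lowerLeaf i) (upperLeaf j) j := gapIn_iff.2 ⟨hle, Nat.lt_succ_self _⟩
  rw [h.gap _ _ _ h1 (meet_eq_gapVertex_of_below h1 (lower_below_gapVertex i)
    (hij ▸ upper_below_gapVertex j)), h.gap _ _ _ h2 (meet_eq_gapVertex_of_below h2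
    (hij ▸ lower_below_gapVertex i) (upper_below_gapVertex j))]

theorem leaf_below_gapVertex {x : Fin n} {i : Fin (n - 1)} (hx : T.Below (T.leaf x) (T.gapVertex i)) :
    T'.Below (T'.leaf x) (T'.gapVertex i) := by
  rcases le_or_gt x (lowerLeaf i) with hle | hlt
  · have hg : GapIn x (upperLeaf i) i := ⟨hle, le_rfl⟩
    rw [h.gap _ _ _ hg (meet_eq_gapVertex_of_below hg hx (upper_below_gapVertex i))]
    exact leaf_below_meet_left hg.lt.ne
  · have hg : GapIn (lowerLeaf i) x i := ⟨le_rfl, Nat.succ_le_of_lt hlt⟩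
    rw [h.gap _ _ _ hg (meet_eq_gapVertex_of_below hg (lower_below_gapVertex i) hx)]
    exact leaf_below_meet_right hg.lt.ne

theorem gapVertex_eq_cv {i : Fin (n - 1)} {x : Fin n} (hi : T.gapVertex i = T.cv x) :
    T'.gapVertex i = T'.cv x := by
  have e1 : T.cv (lowerLeaf i) = T.cv x := cv_eq_of_below (hi ▸ lower_below_gapVertex i)
  have e2 : T'.cv (lowerLeaf i) = T'.cv x := h.cv_eq e1
  have hlt := lowerLeaf_lt_upperLeaf i
  rw [← e2]
  refine (h.below _ _ hlt ?_).antisymm (h.above _ _ hlt ?_)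
  · rw [show T.meet (lowerLeaf i) (upperLeaf i) = T.cv x from hi, e1]
    exact Below.refl _ _
  · rw [show T.meet (lowerLeaf i) (upperLeaf i) = T.cv x from hi, e1]
    exact Below.refl _ _

/-- A vertex may arise from several leaves or gaps; the conditions of `Degenerates` say precisely
that the corresponding vertices of `T'` then coincide as well. -/
theorem exists_map : ∃ f : Fin T.m → Fin T'.m, (∀ x, f (T.cv x) = T'.cv x) ∧
    ∀ i, f (T.gapVertex i) = T'.gapVertex i := by
  have key : ∀ v, ∃ w, (∀ x, v = T.cv x → w = T'.cv x) ∧ ∀ i, v = T.gapVertex i →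
      w = T'.gapVertex i := by
    intro v
    rcases mem_col_or_exists_gapVertex v with ⟨x, rfl⟩ | ⟨hv, i, rfl⟩
    · exact ⟨T'.cv x, fun y hy => h.cv_eq hy, fun i hi => (h.gapVertex_eq_cv hi.symm).symm⟩
    · exact ⟨T'.gapVertex i, fun y hy => absurd (hy ▸ cv_mem y) hv, fun j hj => h.gapVertex_eq hj⟩
  choose f h1 h2 using key
  exact ⟨f, fun x => h1 _ x rfl, fun i => h2 _ i rfl⟩

/-- The map prescribed on coloured and gap vertices commutes with meets of leaves. Since every
vertex is coloured or a meet, this makes it monotone and surjective along each path from a leaf, and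
the remaining axioms follow from these two facts. -/
theorem exists_isMorphism : ∃ f, T.IsMorphism T' f := by
  obtain ⟨f, fcv, fgap⟩ := h.exists_map
  have fmeet : ∀ a b, a ≠ b → f (T.meet a b) = T'.meet a b := by
    have : ∀ a b, a < b → f (T.meet a b) = T'.meet a b := by
      intro a b hab
      obtain ⟨i, hi, h1⟩ := exists_gapVertex_eq_meet (T := T) hab
      rw [← h1, fgap, h.gap a b i hi h1]
    intro a b hab
    rcases hab.lt_or_gt with hlt | hlt
    · exact this a b hlt
    · rw [meet_comm hab, this b a hlt, meet_comm hab]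
  have fleaf : ∀ x v, T.Below (T.leaf x) v → T'.Below (T'.leaf x) (f v) := by
    intro x v hx
    rcases mem_col_or_exists_gapVertex v with ⟨y, rfl⟩ | ⟨hv, i, rfl⟩
    · rw [fcv, ← h.cv_eq (cv_eq_of_below hx)]
      exact leaf_below_cv x
    · rw [fgap]
      exact h.leaf_below_gapVertex hx
  have fmono : ∀ u v, T.Below u v → T'.Below (f u) (f v) := by
    intro u v huv
    rcases mem_col_or_exists_gapVertex u with ⟨x, rfl⟩ | ⟨hu, i, rfl⟩
    · by_cases hv : v ∈ T.col
      · rw [eq_of_col_below (cv_mem x) hv huv]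
        exact Below.refl _ _
      · obtain ⟨j, hj, rfl⟩ := exists_meet_eq hv ((leaf_below_cv x).trans huv)
        rw [fcv, fmeet _ _ hj]
        exact h.above' hj huv
    · rw [fgap]
      exact gapVertex_below (fleaf _ _ ((lower_below_gapVertex i).trans huv))
        (fleaf _ _ ((upper_below_gapVertex i).trans huv))
  have fsurj : ∀ w x, T'.Below (T'.leaf x) w → ∃ v, T.Below (T.leaf x) v ∧ f v = w := by
    intro w x hx
    by_cases hw : w ∈ T'.col
    · exact ⟨T.cv x, leaf_below_cv x, (fcv x).trans (eq_cv hw hx).symm⟩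
    · obtain ⟨j, hj, rfl⟩ := exists_meet_eq hw hx
      exact ⟨T.meet x j, leaf_below_meet_left hj, fmeet _ _ hj⟩
  have fbelow : ∀ v w, T'.Below (f v) w → f v ≠ w → T'.Below (f (T.parent v)) w := by
    intro v w hvw hne
    obtain ⟨x, hx⟩ := exists_leaf_below v
    obtain ⟨u, hu, rfl⟩ := fsurj w x ((fleaf x v hx).trans hvw)
    rcases hx.total hu with h1 | h1
    · by_cases h2 : v = u
      · exact absurd (h2 ▸ rfl) hne
      · exact fmono _ _ (h1.parent_of_ne h2)
    · exact absurd (hvw.antisymm (fmono _ _ h1)) hne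
  refine ⟨f, ?_, ?_, ?_, ?_, ?_⟩
  · obtain ⟨x, hx⟩ := exists_leaf_below T.root
    obtain ⟨v, -, hv⟩ := fsurj T'.root x (below_root _)
    exact (below_root _).antisymm (hv ▸ fmono _ _ (below_root v))
  · intro x
    obtain ⟨v, hv, hv'⟩ := fsurj (T'.leaf x) x (Below.refl _ _)
    exact (hv' ▸ fmono _ _ hv : T'.Below (f (T.leaf x)) (T'.leaf x)).antisymm
      (fleaf _ _ (Below.refl _ _))
  · intro v
    by_cases hv : f (T.parent v) = f v
    · exact Or.inl hv
    · right
      have h1 : T'.Below (f v) (f (T.parent v)) := fmono _ _ (below_parent v)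
      refine Below.antisymm ?_ (h1.parent_of_ne (Ne.symm hv))
      refine fbelow v _ (below_parent _) fun h2 => ?_
      have : f v = T'.root := by
        by_contra hr
        exact parent_ne hr h2.symm
      rw [this] at h1 hv
      exact hv ((below_root _).antisymm h1)
  · intro w
    constructor
    · intro hw
      obtain ⟨x, rfl⟩ := exists_eq_cv hw
      exact ⟨_, cv_mem x, fcv x⟩
    · rintro ⟨v, hv, rfl⟩
      obtain ⟨x, rfl⟩ := exists_eq_cv hv
      exact fcv x ▸ cv_mem x
  · intro w
    obtain ⟨x, hx⟩ := exists_leaf_below w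
    obtain ⟨u, -, hu⟩ := fsurj w x hx
    have top : ∃ v, f v = w ∧ (v = T.root ∨ f (T.parent v) ≠ f v) := by
      induction u using below_induction with
      | root => exact ⟨_, hu, Or.inl rfl⟩
      | step v hv ih =>
        by_cases hp : f (T.parent v) = f v
        · exact ih (hp.trans hu)
        · exact ⟨v, hu, Or.inr hp⟩
    -- On a chain of vertices in the fibre of `w`, only the uppermost can satisfy the condition for
    -- a top, since by monotonicity everything in between maps to `w`.
    have contra : ∀ u v, T.Below u v → u ≠ v → f u = w → f v = w →
        ¬ (u = T.root ∨ f (T.parent u) ≠ f u) := by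
      rintro u v huv hne hu hv (h1 | h1)
      · exact huv.ne_root_of_ne hne h1
      · apply h1
        apply Below.antisymm
        · rw [hu, ← hv]
          exact fmono _ _ (huv.parent_of_ne hne)
        · exact fmono _ _ (below_parent u)
    obtain ⟨v, hv⟩ := top
    refine ⟨v, hv, ?_⟩
    intro v' hv'
    by_contra hne
    obtain ⟨a, ha⟩ := exists_leaf_below v
    obtain ⟨b, hb⟩ := exists_leaf_below v'
    by_cases hcomp : T.Below (T.leaf b) v
    · rcases hcomp.total hb with h1 | h1
      · exact contra v v' h1 (Ne.symm hne) hv.1 hv'.1 hv.2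
      · exact contra v' v h1 hne hv'.1 hv.1 hv'.2
    -- If the two tops are incomparable, the meet of leaves beyond them also maps to `w`, and it
    -- lies strictly above the first top.
    · have hab : a ≠ b := fun h => hcomp (h ▸ ha)
      have hvm : T.Below v (T.meet a b) := by
        rcases ha.total (leaf_below_meet_left hab) with h1 | h1
        · exact h1
        · exact absurd ((leaf_below_meet_right hab).trans h1) hcomp
      refine contra v (T.meet a b) hvm ?_ hv.1 ?_ hv.2
      · rintro h1
        exact hcomp (h1 ▸ leaf_below_meet_right hab)
      · rw [fmeet _ _ hab]
        refine (meet_below hab ?_ ?_).antisymm ?_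
        · exact hv.1 ▸ fleaf _ _ ha
        · exact hv'.1 ▸ fleaf _ _ hb
        · rw [← fmeet _ _ hab, ← hv.1]
          exact fmono _ _ hvm

end Degenerates

end Morphisms

end ColoredTree


/-! ### The exponential as a continuous injection of `[0, ∞]` into the reals -/

section ExpNeg

theorem expNeg_top : expNeg ⊤ = 0 := if_pos rfl

theorem expNeg_of_ne_top {l : ENNReal} (h : l ≠ ⊤) : expNeg l = Real.exp (-l.toReal) := if_neg h

theorem expNeg_zero : expNeg 0 = 1 := by simp [expNeg]

theorem expNeg_add (a b : ENNReal) : expNeg (a + b) = expNeg a * expNeg b := by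
  by_cases ha : a = ⊤
  · simp [ha, expNeg_top]
  by_cases hb : b = ⊤
  · simp [hb, expNeg_top]
  rw [expNeg_of_ne_top ha, expNeg_of_ne_top hb, expNeg_of_ne_top (ENNReal.add_ne_top.2 ⟨ha, hb⟩),
    ENNReal.toReal_add ha hb, neg_add, Real.exp_add]

theorem expNeg_eq_zero {l : ENNReal} : expNeg l = 0 ↔ l = ⊤ := by
  by_cases h : l = ⊤
  · simp [h, expNeg_top]
  · simp [expNeg_of_ne_top h, h, Real.exp_ne_zero]

theorem expNeg_injective : Function.Injective expNeg := by
  intro a b h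
  by_cases ha : a = ⊤
  · rw [ha, expNeg_top] at h
    rw [ha, expNeg_eq_zero.1 h.symm]
  by_cases hb : b = ⊤
  · rw [hb, expNeg_top] at h
    rw [hb, expNeg_eq_zero.1 h]
  rw [expNeg_of_ne_top ha, expNeg_of_ne_top hb, Real.exp_eq_exp, neg_inj] at h
  exact (ENNReal.toReal_eq_toReal_iff' ha hb).1 h

theorem expNeg_eq_one {l : ENNReal} : expNeg l = 1 ↔ l = 0 := by
  rw [← expNeg_zero]
  exact expNeg_injective.eq_iff

theorem expNeg_nonneg (l : ENNReal) : 0 ≤ expNeg l := by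
  rw [expNeg]
  split_ifs
  · exact le_rfl
  · exact (Real.exp_pos _).le

theorem expNeg_le_one (l : ENNReal) : expNeg l ≤ 1 := by
  rw [expNeg]
  split_ifs
  · exact zero_le_one
  · rw [Real.exp_le_one_iff]
    exact neg_nonpos.2 ENNReal.toReal_nonneg

theorem expNeg_ofReal {x : ℝ} (hx : 0 ≤ x) : expNeg (ENNReal.ofReal x) = Real.exp (-x) := by
  rw [expNeg_of_ne_top ENNReal.ofReal_ne_top, ENNReal.toReal_ofReal hx]

theorem continuous_expNeg : Continuous expNeg := by
  rw [continuous_iff_continuousAt]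
  intro l
  by_cases h : l = ⊤
  · subst h
    rw [ContinuousAt, expNeg_top]
    refine tendsto_order.2 ⟨fun a ha => Filter.Eventually.of_forall fun l =>
      lt_of_lt_of_le ha (expNeg_nonneg l), fun a ha => ?_⟩
    filter_upwards [lt_mem_nhds (ENNReal.ofReal_lt_top (r := |Real.log a|))] with l hl
    by_cases hl' : l = ⊤
    · rwa [hl', expNeg_top]
    · rw [expNeg_of_ne_top hl', ← Real.lt_log_iff_exp_lt ha]
      have h1 := (ENNReal.ofReal_lt_iff_lt_toReal (abs_nonneg _) hl').1 hl
      have h2 := neg_abs_le (Real.log a)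
      linarith
  · have h1 : ContinuousAt (fun l : ENNReal => Real.exp (-l.toReal)) l :=
      Real.continuous_exp.continuousAt.comp (ENNReal.tendsto_toReal h).neg
    refine h1.congr ?_
    filter_upwards [isOpen_ne.mem_nhds h] with x hx
    exact (expNeg_of_ne_top hx).symm

end ExpNeg

namespace ColoredTree

variable {n : ℕ}

/-! ### Path lengths -/

section PathLength

variable {T : ColoredTree n} {len : T.Edge → ENNReal}

/-- In the wrong direction the sum is empty. This convention makes one of the two colour entries of
`metricData` equal to 1, matching the truncation at 1 in `diskData`. -/
theorem pathLength_eq_zero_of_below {u v : Fin T.m} (h : T.Below v u) :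
    T.pathLength len u v = 0 := by
  classical
  refine Finset.sum_eq_zero fun e _ => if_neg ?_
  rintro ⟨h1, h2, h3⟩
  exact h3 (h2.antisymm (h.trans h1))

theorem pathLength_self (v : Fin T.m) : T.pathLength len v v = 0 :=
  pathLength_eq_zero_of_below (Below.refl T v)

theorem pathLength_step {u v : Fin T.m} (h : T.Below u v) (hne : u ≠ v) (hr : u ≠ T.root) :
    T.pathLength len u v = len ⟨u, hr⟩ + T.pathLength len (T.parent u) v := by
  classical
  have h1 : ∀ e : T.Edge, (if T.Below u e.1 ∧ T.Below e.1 v ∧ e.1 ≠ v then len e else 0) =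
      (if e = ⟨u, hr⟩ then len ⟨u, hr⟩ else 0) +
        if T.Below (T.parent u) e.1 ∧ T.Below e.1 v ∧ e.1 ≠ v then len e else 0 := by
    intro e
    by_cases he : e = ⟨u, hr⟩
    · subst he
      have h2 : ¬ T.Below (T.parent u) u := fun h' =>
        parent_ne hr (h'.antisymm (below_parent u))
      simp [h2, h, hne, Below.refl]
    · have h2 : T.Below u e.1 ↔ T.Below (T.parent u) e.1 := by
        rw [below_iff]
        exact or_iff_right fun h => he (Subtype.ext h.symm)
      simp [h2, he]
  simp only [pathLength]
  rw [Finset.sum_congr rfl fun e _ => h1 e, Finset.sum_add_distrib]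
  congr 1
  simp

theorem pathLength_edge (e : T.Edge) : T.pathLength len e.1 (T.parent e.1) = len e := by
  rw [pathLength_step (below_parent _) (parent_ne e.2).symm e.2, pathLength_self, add_zero]

theorem pathLength_eq_zero_iff {u v : Fin T.m} : T.pathLength len u v = 0 ↔
    ∀ e : T.Edge, T.Below u e.1 → T.Below e.1 v → e.1 ≠ v → len e = 0 := by
  classical
  rw [pathLength, Finset.sum_eq_zero_iff]
  constructor
  · intro h e h1 h2 h3
    have := h e (Finset.mem_univ _)
    rwa [if_pos ⟨h1, h2, h3⟩] at this
  · intro h e _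
    by_cases he : T.Below u e.1 ∧ T.Below e.1 v ∧ e.1 ≠ v
    · rw [if_pos he]
      exact h e he.1 he.2.1 he.2.2
    · exact if_neg he

theorem eq_of_pathLength_eq_zero (hlen : ∀ e, len e ≠ 0) {u v : Fin T.m} (h : T.Below u v)
    (h0 : T.pathLength len u v = 0) : u = v := by
  by_contra hne
  have hr := h.ne_root_of_ne hne
  exact hlen ⟨u, hr⟩ (pathLength_eq_zero_iff.1 h0 ⟨u, hr⟩ (Below.refl T u) h hne)

theorem continuous_pathLength (u v : Fin T.m) :
    Continuous fun len : T.Edge → ENNReal => T.pathLength len u v := by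
  classical
  unfold pathLength
  refine continuous_finsetSum _ fun e _ => ?_
  by_cases h : T.Below u e.1 ∧ T.Below e.1 v ∧ e.1 ≠ v
  · simpa only [if_pos h] using continuous_apply e
  · simpa only [if_neg h] using continuous_const

variable (T) in
/-- The balancing relations between the edge lengths. -/
def Balanced (len : T.Edge → ENNReal) : Prop :=
  ∀ v, ∀ c ∈ T.col, ∀ c' ∈ T.col, T.Below c v → T.Below c' v →
    T.pathLength len c v = T.pathLength len c' v

end PathLength

/-- Sizes of the gaps, and of the seam heights, relative to the largest gap of an interval of
leaves. -/
abbrev Data (n : ℕ) : Type :=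
  (Fin n → Fin n → Fin (n - 1) → ℝ) × (Fin n → Fin n → ℝ) × (Fin n → Fin n → ℝ)

open Classical in
/-- The relative sizes defined by the edge lengths. -/
noncomputable def metricData (T : ColoredTree n) (len : T.Edge → ENNReal) : Data n :=
  (fun a b i => if GapIn a b i then expNeg (T.pathLength len (T.gapVertex i) (T.meet a b)) else 0,
    fun a b => if a < b then expNeg (T.pathLength len (T.cv a) (T.meet a b)) else 0,
    fun a b => if a < b then expNeg (T.pathLength len (T.meet a b) (T.cv a)) else 0)

/-! ### The invariant of metric trees and its behaviour under contraction -/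

section MetricData

variable {T T' : ColoredTree n} {len : T.Edge → ENNReal} {len' : T'.Edge → ENNReal}

theorem continuous_metricData (T : ColoredTree n) : Continuous T.metricData := by
  classical
  refine Continuous.prodMk ?_ (Continuous.prodMk ?_ ?_)
  · refine continuous_pi fun a => continuous_pi fun b => continuous_pi fun i => ?_
    split_ifs
    · exact continuous_expNeg.comp (continuous_pathLength _ _)
    · exact continuous_const
  · refine continuous_pi fun a => continuous_pi fun b => ?_
    split_ifs
    · exact continuous_expNeg.comp (continuous_pathLength _ _)
    · exact continuous_const
  · refine continuous_pi fun a => continuous_pi fun b => ?_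
    split_ifs
    · exact continuous_expNeg.comp (continuous_pathLength _ _)
    · exact continuous_const

theorem metricData_gap {a b : Fin n} {i : Fin (n - 1)} (h : GapIn a b i) :
    (T.metricData len).1 a b i = expNeg (T.pathLength len (T.gapVertex i) (T.meet a b)) := by
  classical
  exact if_pos h

theorem metricData_below {a b : Fin n} (h : a < b) :
    (T.metricData len).2.1 a b = expNeg (T.pathLength len (T.cv a) (T.meet a b)) := by
  classical
  exact if_pos h

theorem metricData_above {a b : Fin n} (h : a < b) :
    (T.metricData len).2.2 a b = expNeg (T.pathLength len (T.meet a b) (T.cv a)) := by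
  classical
  exact if_pos h

/-- The lengths on `T` are those of its contraction `T'`. -/
structure Pulls (f : Fin T.m → Fin T'.m) (len : T.Edge → ENNReal) (len' : T'.Edge → ENNReal) :
    Prop where
  contracted : ∀ e : T.Edge, f (T.parent e.1) = f e.1 → len e = 0
  kept : ∀ (e : T.Edge) (e' : T'.Edge), f e.1 = e'.1 → f (T.parent e.1) ≠ f e.1 → len' e' = len e

namespace IsMorphism

variable {f : Fin T.m → Fin T'.m} (hf : T.IsMorphism T' f)
include hf

theorem pathLength_of_below (hl : Pulls f len len') {u v : Fin T.m} (h : T.Below u v) :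
    T.pathLength len u v = T'.pathLength len' (f u) (f v) := by
  refine Below.induction (P := fun u => T.pathLength len u v = T'.pathLength len' (f u) (f v))
    ?_ ?_ h
  · rw [pathLength_self, pathLength_self]
  · intro u hne hr hp ih
    have huv := (below_parent u).trans hp
    rw [pathLength_step huv hne hr, ih]
    by_cases hc : f (T.parent u) = f u
    · rw [hl.contracted ⟨u, hr⟩ hc, zero_add, hc]
    · have hp' := (hf.parent u).resolve_left hc
      have hne' : f u ≠ f v := fun h => hc (Below.antisymm (h ▸ hf.mono hp) (hf.mono (below_parent u)))
      have hr' := (hf.mono huv).ne_root_of_ne hne'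
      rw [pathLength_step (hf.mono huv) hne' hr', hl.kept ⟨u, hr⟩ ⟨f u, hr'⟩ rfl hc, hp']

theorem pathLength_of_comparable (hl : Pulls f len len') {u v : Fin T.m}
    (h : T.Below u v ∨ T.Below v u) : T.pathLength len u v = T'.pathLength len' (f u) (f v) := by
  rcases h with h | h
  · exact hf.pathLength_of_below hl h
  · rw [pathLength_eq_zero_of_below h, pathLength_eq_zero_of_below (hf.mono h)]

/-- All entries are path lengths between meets and coloured vertices, which a contraction respects.
Hence the data descends to the glued space. -/
theorem metricData_eq (hl : Pulls f len len') : T.metricData len = T'.metricData len' := by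
  classical
  refine Prod.ext ?_ (Prod.ext ?_ ?_)
  · funext a b i
    by_cases h : GapIn a b i
    · rw [metricData_gap h, metricData_gap h, hf.pathLength_of_below hl h.gapVertex_below_meet,
        hf.map_gapVertex, hf.map_meet h.lt.ne]
    · simp [metricData, h]
  · funext a b
    by_cases h : a < b
    · rw [metricData_below h, metricData_below h, hf.pathLength_of_comparable hl
        (cv_below_or (leaf_below_meet_left h.ne)), hf.map_cv, hf.map_meet h.ne]
    · simp [metricData, h]
  · funext a b
    by_cases h : a < b
    · rw [metricData_above h, metricData_above h, hf.pathLength_of_comparable hl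
        (cv_below_or (leaf_below_meet_left h.ne)).symm, hf.map_cv, hf.map_meet h.ne]
    · simp [metricData, h]

theorem balanced_map (hl : Pulls f len len') (h : T.Balanced len) : T'.Balanced len' := by
  intro w c hc c' hc' h1 h2
  obtain ⟨d, hd, rfl⟩ := (hf.col _).1 hc
  obtain ⟨d', hd', rfl⟩ := (hf.col _).1 hc'
  obtain ⟨x, hx1, hx2⟩ := hf.exists_of_below_map h1
  obtain ⟨y, hy1, hy2⟩ := hf.exists_of_below_map h2
  have hxy : y = x := (hf.fibre w).unique hy2 hx2
  subst hxy
  rw [← hx2.1, ← hf.pathLength_of_below hl hx1, ← hf.pathLength_of_below hl hy1]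
  exact h _ _ hd _ hd' hx1 hy1

/-- The relative sizes determine the path lengths. -/
theorem pathLength_eq_of_metricData_eq (hb : T.Balanced len) (hb' : T'.Balanced len')
    (h : T.metricData len = T'.metricData len') {u v : Fin T.m} (huv : T.Below u v) :
    T.pathLength len u v = T'.pathLength len' (f u) (f v) := by
  rcases mem_col_or_exists_gapVertex v with ⟨y, rfl⟩ | ⟨hv, j, rfl⟩ <;>
    rcases mem_col_or_exists_gapVertex u with ⟨x, rfl⟩ | ⟨hu, i, rfl⟩
  · rw [eq_of_col_below (cv_mem x) (cv_mem y) huv, pathLength_self, pathLength_self]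
  · have hlt := lowerLeaf_lt_upperLeaf i
    have h1 := congrFun (congrFun (congrArg (fun d : Data n => d.2.2) h) (lowerLeaf i)) (upperLeaf i)
    simp only [metricData_above hlt] at h1
    have e1 : T.cv y = T.cv (lowerLeaf i) :=
      (cv_eq_of_below ((lower_below_gapVertex i).trans huv)).symm
    rw [e1, hf.map_gapVertex, hf.map_cv]
    exact expNeg_injective h1
  · have hlt := lowerLeaf_lt_upperLeaf j
    have h1 := congrFun (congrFun (congrArg (fun d : Data n => d.2.1) h) (lowerLeaf j)) (upperLeaf j)
    simp only [metricData_below hlt] at h1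
    -- The data records only the coloured vertex of the lower leaf of the gap; balancing, used in
    -- both trees, exchanges it for `T.cv x`.
    have hc : T.Below (T.cv (lowerLeaf j)) (T.gapVertex j) :=
      cv_below_of_cv_below ((leaf_below_cv x).trans huv) (lower_below_gapVertex j) huv
    rw [hb _ _ (cv_mem x) _ (cv_mem (lowerLeaf j)) huv hc,
      hb' _ _ ((hf.col _).2 ⟨_, cv_mem x, rfl⟩) _ ((hf.col _).2 ⟨_, cv_mem (lowerLeaf j), rfl⟩)
        (hf.mono huv) (hf.mono hc), hf.map_gapVertex, hf.map_cv]
    exact expNeg_injective h1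
  -- The outermost of the four leaves of the two gaps meet at the upper gap vertex, so the length
  -- appears in the data of this interval.
  · have hi : GapIn (min (lowerLeaf i) (lowerLeaf j)) (max (upperLeaf i) (upperLeaf j)) i :=
      ⟨min_le_left _ _, le_max_left _ _⟩
    have hj : GapIn (min (lowerLeaf i) (lowerLeaf j)) (max (upperLeaf i) (upperLeaf j)) j :=
      ⟨min_le_right _ _, le_max_right _ _⟩
    have hm : T.gapVertex j = T.meet (min (lowerLeaf i) (lowerLeaf j))
        (max (upperLeaf i) (upperLeaf j)) := by
      refine meet_eq_gapVertex_of_below hj ?_ ?_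
      · rcases min_choice (lowerLeaf i) (lowerLeaf j) with h | h <;> rw [h]
        · exact (lower_below_gapVertex i).trans huv
        · exact lower_below_gapVertex j
      · rcases max_choice (upperLeaf i) (upperLeaf j) with h | h <;> rw [h]
        · exact (upper_below_gapVertex i).trans huv
        · exact upper_below_gapVertex j
    have h1 := congrFun (congrFun (congrFun (congrArg Prod.fst h) (min (lowerLeaf i) (lowerLeaf j)))
      (max (upperLeaf i) (upperLeaf j))) i
    rw [metricData_gap hi, metricData_gap hi] at h1
    rw [hm, hf.map_gapVertex, hf.map_meet hi.lt.ne]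
    exact expNeg_injective h1

end IsMorphism

/-- A coincidence of vertices in `T` shows as an entry 1 of the common data, that is, a path of
length zero in `T'`; without edges of length zero such a path is trivial. -/
theorem degenerates_of_metricData_eq (hr : ∀ e, len' e ≠ 0)
    (h : T.metricData len = T'.metricData len') : T.Degenerates T' where
  gap a b i hi h1 := by
    have h2 := congrFun (congrFun (congrFun (congrArg Prod.fst h) a) b) i
    rw [metricData_gap hi, metricData_gap hi, h1, pathLength_self, expNeg_zero, eq_comm,
      expNeg_eq_one] at h2
    exact eq_of_pathLength_eq_zero hr hi.gapVertex_below_meet h2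
  above a b hab h1 := by
    have h2 := congrFun (congrFun (congrArg (fun d : Data n => d.2.2) h) a) b
    simp only [metricData_above hab] at h2
    rw [pathLength_eq_zero_of_below h1, expNeg_zero, eq_comm, expNeg_eq_one] at h2
    rcases cv_below_or (T := T') (leaf_below_meet_left hab.ne) with h3 | h3
    · exact h3
    · rw [eq_of_pathLength_eq_zero hr h3 h2]
      exact Below.refl _ _
  below a b hab h1 := by
    have h2 := congrFun (congrFun (congrArg (fun d : Data n => d.2.1) h) a) b
    simp only [metricData_below hab] at h2
    rw [pathLength_eq_zero_of_below h1, expNeg_zero, eq_comm, expNeg_eq_one] at h2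
    rcases cv_below_or (T := T') (leaf_below_meet_left hab.ne) with h3 | h3
    · rw [← eq_of_pathLength_eq_zero hr h3 h2]
      exact Below.refl _ _
    · exact h3

/-- The degeneration supplies the contraction, and the length of an edge is the path length between
its ends, which is read off from the data in both trees. -/
theorem collapse_of_metricData_eq (l : T.Cell) (l' : T'.Cell) (hr : ∀ e, l'.1 e ≠ 0)
    (h : T.metricData l.1 = T'.metricData l'.1) : Collapse ⟨T, l⟩ ⟨T', l'⟩ := by
  obtain ⟨f, hf⟩ := (degenerates_of_metricData_eq hr h).exists_isMorphism
  have key : ∀ e : T.Edge, l.1 e = T'.pathLength l'.1 (f e.1) (f (T.parent e.1)) := fun e => by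
    rw [← pathLength_edge (len := l.1) e]
    exact hf.pathLength_eq_of_metricData_eq l.2 l'.2 h (below_parent e.1)
  refine ⟨f, hf, fun e => ⟨fun he => ?_, fun he => ?_⟩, fun e e' he hne => ?_⟩
  · show l.1 e = 0
    rw [key, he, pathLength_self]
  · exact (eq_of_pathLength_eq_zero hr (hf.below_map_parent e.1)
      ((key e).symm.trans he)).symm
  · show l'.1 e' = l.1 e
    rw [key, (hf.parent e.1).resolve_left hne, he, pathLength_edge]

end MetricData

/-! ### Contracting a set of edges -/

section Contraction

variable {T : ColoredTree n}

/-- The upper ends of the components that are left when the edges satisfying `A` are contracted. -/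
@[ext]
structure Tops (T : ColoredTree n) (A : Fin T.m → Prop) where
  val : Fin T.m
  top : val = T.root ∨ ¬ A val

instance (T : ColoredTree n) (A : Fin T.m → Prop) : PartialOrder (T.Tops A) where
  le u v := T.Below u.1 v.1
  le_refl u := Below.refl T u.1
  le_trans _ _ _ h h' := h.trans h'
  le_antisymm _ _ h h' := Tops.ext (h.antisymm h')

instance (T : ColoredTree n) (A : Fin T.m → Prop) : Finite (T.Tops A) :=
  Finite.of_injective (fun v : T.Tops A => v.1) fun _ _ h => Tops.ext h

/-- The new vertices are the components of the contracted edges, represented by their top vertices.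
Contraction may merge a coloured vertex with its ancestors; `hA` makes this happen simultaneously
for all coloured vertices beyond a given one, so that each path still has exactly one colour. Both
for edges of length zero and for edges of finite length, `hA` is a consequence of balancing. -/
theorem exists_contraction (A : Fin T.m → Prop)
    (hA : ∀ v, ∀ c ∈ T.col, ∀ c' ∈ T.col, T.Below c v → T.Below c' v →
      (∀ u, T.Below c u → T.Below u v → u ≠ v → A u) →
      ∀ u, T.Below c' u → T.Below u v → u ≠ v → A u) :
    ∃ (T' : ColoredTree n) (f : Fin T.m → Fin T'.m), T.IsMorphism T' f ∧
      ∀ e : T.Edge, f (T.parent e.1) = f e.1 ↔ A e.1 := by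
  -- The top of the component of `v` is the first vertex on the way to the root whose own edge is
  -- not contracted.
  have exTop : ∀ v, ∃ t, T.Below v t ∧ (t = T.root ∨ ¬ A t) ∧
      ∀ u, T.Below v u → (u = T.root ∨ ¬ A u) → T.Below t u := by
    intro v
    obtain ⟨t, ⟨h1, h2⟩, hmin⟩ := T.exists_minimal
      (fun t => T.Below v t ∧ (t = T.root ∨ ¬ A t)) ⟨T.root, below_root v, Or.inl rfl⟩
    refine ⟨t, h1, h2, fun u hu hu' => ?_⟩
    rcases h1.total hu with h | h
    · exact h
    · exact hmin u ⟨hu, hu'⟩ h ▸ Below.refl T _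
  choose top ht1 ht2 ht3 using exTop
  have top_le : ∀ {v u}, (u = T.root ∨ ¬ A u) → (T.Below (top v) u ↔ T.Below v u) :=
    fun hu => ⟨fun h => (ht1 _).trans h, fun h => ht3 _ _ h hu⟩
  have top_self : ∀ {v}, (v = T.root ∨ ¬ A v) → top v = v := fun hv =>
    (ht3 _ _ (Below.refl T _) hv).antisymm (ht1 _)
  have top_parent : ∀ {v}, v ≠ T.root → A v → top (T.parent v) = top v := by
    intro v hv hAv
    apply Below.antisymm
    · refine ht3 _ _ ((ht1 v).parent_of_ne fun h => ?_) (ht2 v)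
      exact (ht2 v).elim (fun h' => hv (h.trans h')) (fun h' => h' (h ▸ hAv))
    · exact ht3 _ _ ((below_parent v).trans (ht1 _)) (ht2 _)
  have path : ∀ {c t}, T.Below c t → (t = T.root ∨ ¬ A t) →
      (top c = t ↔ ∀ u, T.Below c u → T.Below u t → u ≠ t → A u) := by
    intro c t hct htop
    constructor
    · rintro rfl u h1 h2 h3
      by_contra h4
      exact h3 (h2.antisymm (ht3 _ _ h1 (Or.inr h4)))
    · intro h
      by_contra hne
      have h1 : T.Below (top c) t := ht3 _ _ hct htop
      exact (ht2 c).elim (fun h' => h1.ne_root_of_ne hne h') (fun h' => h' (h _ (ht1 c) h1 hne))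
  have le_def : ∀ u v : T.Tops A, u ≤ v ↔ T.Below u.1 v.1 := fun _ _ => Iff.rfl
  obtain ⟨T', e, he, hel, hec⟩ := exists_of_order (n := n) (P := T.Tops A)
    (fun x y z h h' => Below.total (T := T) h h') ⟨⟨T.root, Or.inl rfl⟩, fun x => below_root x.1⟩
    (fun i => ⟨top (T.leaf i), ht2 _⟩) {t | ∃ c ∈ T.col, top c = t.1}
    (by
      intro v i j k hij hjk hi hk
      simp only [le_def, top_le v.2] at hi hk ⊢
      exact T.ribbon v.1 i j k hij hjk hi hk)
    (by
      intro i
      refine ⟨⟨top (T.cv i), ht2 _⟩, ⟨⟨_, cv_mem i, rfl⟩, ?_⟩, ?_⟩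
      · rw [le_def, top_le (ht2 _)]
        exact (leaf_below_cv i).trans (ht1 _)
      · rintro ⟨t, ht⟩ ⟨⟨c, hc, hct⟩, hi⟩
        rw [le_def, top_le ht] at hi
        refine Tops.ext ?_
        show t = top (T.cv i)
        have hct : top c = t := hct
        have hct' : T.Below c t := hct ▸ ht1 c
        have hcv : T.Below (T.cv i) t := by
          rcases cv_below_or hi with h | h
          · exact h
          · rw [← eq_of_col_below hc (cv_mem i) (hct'.trans h)]
            exact hct'
        -- The path from `c` to `t` is contracted, so by `hA` the path from the coloured vertex of
        -- the leaf is too, and both have top `t`.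
        exact ((path hcv ht).2 (hA t c hc _ (cv_mem i) hct' hcv ((path hct' ht).1 hct))).symm)
    (by
      intro v hv
      have hvc : v.1 ∉ T.col := fun h => hv ⟨v.1, h, top_self v.2⟩
      obtain ⟨i, hi⟩ := exists_gapVertex hvc
      refine ⟨lowerLeaf i, upperLeaf i, (lowerLeaf_lt_upperLeaf i).ne, ?_, ?_, ?_⟩
      · rw [le_def, top_le v.2, ← hi]
        exact lower_below_gapVertex i
      · rw [le_def, top_le v.2, ← hi]
        exact upper_below_gapVertex i
      · intro u h1 h2 h3
        rw [le_def, top_le u.2] at h1 h2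
        have : v ≤ u := by
          rw [le_def, ← hi]
          exact gapVertex_below h1 h2
        exact absurd (h3.trans_le this) (lt_irrefl _))
    (by
      intro v _
      obtain ⟨i, hi⟩ := exists_leaf_below v.1
      exact ⟨i, by rw [le_def, top_le v.2]; exact hi⟩)
  have tops : ∀ {u v}, e.symm ⟨top u, ht2 u⟩ = e.symm ⟨top v, ht2 v⟩ ↔ top u = top v := by
    intro u v
    rw [e.symm.injective.eq_iff, Tops.mk.injEq]
  have contr : ∀ v, v ≠ T.root → (top (T.parent v) = top v ↔ A v) := by
    intro v hv
    constructor
    · intro h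
      by_contra h'
      rw [top_self (Or.inr h')] at h
      have h1 := ht1 (T.parent v)
      rw [h] at h1
      exact parent_ne hv (h1.antisymm (below_parent v))
    · exact top_parent hv
  refine ⟨T', fun v => e.symm ⟨top v, ht2 v⟩, ⟨?_, ?_, ?_, ?_, ?_⟩, fun a => ?_⟩
  · refine (below_root _).antisymm ((he _ _).2 ?_)
    rw [e.apply_symm_apply, le_def]
    simp only
    rw [top_self (Or.inl rfl)]
    exact below_root _
  · intro i
    rw [Equiv.symm_apply_eq, hel]
  · intro v
    by_cases hv : v = T.root
    · left
      rw [hv, T.parent_root]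
    by_cases hAv : A v
    · left
      rw [tops]
      exact top_parent hv hAv
    · right
      have hne : e.symm ⟨top v, ht2 v⟩ ≠ e.symm ⟨top (T.parent v), ht2 _⟩ := fun h =>
        hAv ((contr v hv).1 (tops.1 h).symm)
      have hle : T'.Below (e.symm ⟨top v, ht2 v⟩) (e.symm ⟨top (T.parent v), ht2 _⟩) := by
        rw [he, e.apply_symm_apply, e.apply_symm_apply]
        exact ht3 _ _ ((below_parent v).trans (ht1 _)) (ht2 _)
      -- The parent of `x` is represented by a top strictly above `v`, hence at or above `T.parent
      -- v`, and therefore at or above the top of `T.parent v`.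
      refine Below.antisymm ?_ (hle.parent_of_ne hne)
      set x := e.symm ⟨top v, ht2 v⟩ with hx
      have h1 : v ≤ v := le_rfl
      have h2 : T.Below v (e (T'.parent x)).1 := by
        have := (he _ _).1 (below_parent x)
        rw [hx, e.apply_symm_apply, le_def] at this
        exact (ht1 v).trans this
      have h3 : v ≠ (e (T'.parent x)).1 := by
        intro h3
        refine parent_ne (hle.ne_root_of_ne hne) (e.injective (Tops.ext ?_))
        rw [← h3, hx, e.apply_symm_apply]
        exact (top_self (Or.inr hAv)).symm
      rw [he, e.apply_symm_apply, le_def]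
      exact ht3 _ _ (h2.parent_of_ne h3) (e (T'.parent x)).2
  · intro w
    rw [hec]
    constructor
    · rintro ⟨c, hc, hcw⟩
      exact ⟨c, hc, by rw [Equiv.symm_apply_eq]; exact Tops.ext hcw⟩
    · rintro ⟨c, hc, hcw⟩
      rw [Equiv.symm_apply_eq] at hcw
      exact ⟨c, hc, congrArg Tops.val hcw⟩
  · intro w
    refine ⟨(e w).1, ⟨?_, ?_⟩, ?_⟩
    · rw [Equiv.symm_apply_eq]
      exact Tops.ext (top_self (e w).2)
    · by_cases hr : (e w).1 = T.root
      · exact Or.inl hr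
      · right
        rw [Ne, tops, contr _ hr]
        exact (e w).2.resolve_left hr
    · rintro v ⟨h1, h2⟩
      rw [Equiv.symm_apply_eq] at h1
      have htv : v = T.root ∨ ¬ A v := by
        by_cases hr : v = T.root
        · exact Or.inl hr
        · right
          have := h2.resolve_left hr
          rwa [Ne, tops, contr _ hr] at this
      rw [← h1]
      exact (top_self htv).symm
  · rw [tops, contr _ a.2]

/-- Every balanced metric tree is a contraction of one without edges of length zero. -/
theorem exists_reduced (l : T.Cell) : ∃ (T' : ColoredTree n) (l' : T'.Cell),
    (∀ e, l'.1 e ≠ 0) ∧ T.metricData l.1 = T'.metricData l'.1 := by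
  obtain ⟨T', f, hf, hA⟩ := exists_contraction (T := T) (fun v => ∀ h : v ≠ T.root, l.1 ⟨v, h⟩ = 0)
    (by
      intro v c hc c' hc' h1 h2 h u hu1 hu2 hu3 hr
      have h0 : T.pathLength l.1 c v = 0 :=
        pathLength_eq_zero_iff.2 fun e he1 he2 he3 => h e.1 he1 he2 he3 e.2
      rw [l.2 v c hc c' hc' h1 h2, pathLength_eq_zero_iff] at h0
      exact h0 ⟨u, hr⟩ hu1 hu2 hu3)
  have ex : ∀ e' : T'.Edge, ∃ e : T.Edge, f e.1 = e'.1 ∧ f (T.parent e.1) ≠ f e.1 := by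
    intro e'
    obtain ⟨v, ⟨h1, h2⟩, -⟩ := hf.fibre e'.1
    have hv : v ≠ T.root := fun h => e'.2 (by rw [← h1, h, hf.root])
    exact ⟨⟨v, hv⟩, h1, h2.resolve_left hv⟩
  choose g hg1 hg2 using ex
  have hl : Pulls f l.1 fun e' => l.1 (g e') := by
    refine ⟨fun e he => (hA e).1 he e.2, fun e e' h1 h2 => ?_⟩
    refine congrArg l.1 ?_
    exact Subtype.ext ((hf.fibre e'.1).unique ⟨hg1 e', Or.inr (hg2 e')⟩ ⟨h1, Or.inr h2⟩)
  exact ⟨T', ⟨_, hf.balanced_map hl l.2⟩, fun e' h => hg2 e' ((hA _).2 fun _ => h),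
    hf.metricData_eq hl⟩

end Contraction

end ColoredTree

open ColoredTree in
-- Two trees with the same data both collapse onto one reduced representative, so no chain of
-- intermediate identifications has to be analysed.
theorem MetricTrees.mk_eq_iff {n : ℕ} {T T' : ColoredTree n} (l : T.Cell) (l' : T'.Cell) :
    MetricTrees.mk T l = MetricTrees.mk T' l' ↔ T.metricData l.1 = T'.metricData l'.1 := by
  constructor
  · intro h
    have key : ∀ p q : Σ T : ColoredTree n, T.Cell, Collapse p q →
        p.1.metricData p.2.1 = q.1.metricData q.2.1 := by
      rintro p q ⟨f, hf, h1, h2⟩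
      exact hf.metricData_eq ⟨fun e he => (h1 e).1 he, h2⟩
    exact congrArg (Quot.lift (fun p : Σ T : ColoredTree n, T.Cell => p.1.metricData p.2.1) key) h
  · intro h
    obtain ⟨T₀, l₀, h0, h1⟩ := exists_reduced l
    exact (Quot.sound (collapse_of_metricData_eq l l₀ h0 h1)).trans
      (Quot.sound (collapse_of_metricData_eq l' l₀ h0 (h.symm.trans h1))).symm


namespace ColoredTree

variable {n : ℕ}

/-! ### Trees from level functions on the gaps -/

section Clusters

variable {L : Type*} [LinearOrder L] (h : Fin (n - 1) → L)

/-- All gaps between the two leaves have level at most `t`. -/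
def Linked (t : L) (a b : Fin n) : Prop := ∀ i, GapIn a b i ∨ GapIn b a i → h i ≤ t

variable {h}

theorem Linked.refl (t : L) (a : Fin n) : Linked h t a a := by
  rintro i (hi | hi) <;> exact absurd hi.lt (lt_irrefl _)

theorem Linked.symm {t : L} {a b : Fin n} (hab : Linked h t a b) : Linked h t b a :=
  fun i hi => hab i hi.symm

theorem Linked.trans {t : L} {a b c : Fin n} (hab : Linked h t a b) (hbc : Linked h t b c) :
    Linked h t a c := by
  intro i hi
  simp only [gapIn_iff] at hi
  by_cases hi' : GapIn a b i ∨ GapIn b a i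
  · exact hab i hi'
  · refine hbc i ?_
    simp only [gapIn_iff] at hi' ⊢
    omega

theorem Linked.mono {s t : L} (hst : s ≤ t) {a b : Fin n} (hab : Linked h s a b) :
    Linked h t a b := fun i hi => (hab i hi).trans hst

theorem Linked.between {t : L} {a b c : Fin n} (hab : a < b) (hbc : b < c) (hac : Linked h t a c) :
    Linked h t a b := by
  intro i hi
  refine hac i ?_
  simp only [gapIn_iff] at hi ⊢
  have h1 : a.1 < b.1 := hab
  have h2 : b.1 < c.1 := hbc
  omega

variable (h) in
/-- A maximal set of leaves linked at level `t`, where `t` is either the level `y` of the colours,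
or attained by a gap in the set. -/
@[ext]
structure Cluster (y : L) where
  carrier : Set (Fin n)
  level : L
  nonempty : carrier.Nonempty
  mem_iff : ∀ a ∈ carrier, ∀ b, b ∈ carrier ↔ Linked h level a b
  level_eq : level = y ∨ ∃ i, h i = level ∧ lowerLeaf i ∈ carrier ∧ upperLeaf i ∈ carrier

namespace Cluster

variable {y : L}

/-- The carrier alone does not suffice: a bivalent coloured vertex may have the same leaves beyond
it as the vertex next to it, and only the level tells them apart. -/
instance : PartialOrder (Cluster h y) where
  le p q := p.carrier ⊆ q.carrier ∧ p.level ≤ q.level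
  le_refl p := ⟨subset_rfl, le_rfl⟩
  le_trans p q r h h' := ⟨h.1.trans h'.1, h.2.trans h'.2⟩
  le_antisymm p q h h' := Cluster.ext (h.1.antisymm h'.1) (h.2.antisymm h'.2)

instance : Finite (Cluster h y) := by
  have : Finite {t : L // t ∈ insert y (Set.range h)} := ((Set.finite_range h).insert y).to_subtype
  refine Finite.of_injective (β := Set (Fin n) × {t : L // t ∈ insert y (Set.range h)})
    (fun p => (p.carrier, ⟨p.level, ?_⟩)) ?_
  · exact p.level_eq.imp id fun ⟨i, hi, _⟩ => ⟨i, hi⟩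
  · intro p q hpq
    exact Cluster.ext (congrArg Prod.fst hpq) (congrArg (fun z => z.2.1) hpq)

/-- Clusters behave like balls of an ultrametric, with the highest gap between two leaves as
distance: two that share a leaf are nested according to their levels. -/
theorem le_of_level_le {p q : Cluster h y} {a : Fin n} (hp : a ∈ p.carrier) (hq : a ∈ q.carrier)
    (hl : p.level ≤ q.level) : p ≤ q :=
  ⟨fun b hb => (q.mem_iff a hq b).2 (((p.mem_iff a hp b).1 hb).mono hl), hl⟩

theorem le_or_le {p q : Cluster h y} {a : Fin n} (hp : a ∈ p.carrier) (hq : a ∈ q.carrier) :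
    p ≤ q ∨ q ≤ p :=
  (le_total p.level q.level).imp (le_of_level_le hp hq) (le_of_level_le hq hp)

theorem mem_iff_linked (t : L) (a : Fin n) : ∀ b ∈ {b | Linked h t a b}, ∀ c,
    c ∈ {b | Linked h t a b} ↔ Linked h t b c :=
  fun _ hb _ => ⟨fun hc => hb.symm.trans hc, fun hc => hb.trans hc⟩

variable (h y) in
/-- The coloured cluster of a leaf. -/
def ofLeaf (a : Fin n) : Cluster h y where
  carrier := {b | Linked h y a b}
  level := y
  nonempty := ⟨a, Linked.refl y a⟩
  mem_iff := mem_iff_linked y a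
  level_eq := Or.inl rfl

theorem linked_of_gap (i : Fin (n - 1)) : Linked h (h i) (lowerLeaf i) (upperLeaf i) := by
  intro j hj
  have : j = i := by
    simp only [gapIn_iff, lowerLeaf, upperLeaf] at hj
    exact Fin.ext (by omega)
  rw [this]

variable (h y) in
/-- The cluster of a gap. -/
def ofGap (i : Fin (n - 1)) : Cluster h y where
  carrier := {b | Linked h (h i) (lowerLeaf i) b}
  level := h i
  nonempty := ⟨lowerLeaf i, Linked.refl _ _⟩
  mem_iff := mem_iff_linked _ _
  level_eq := Or.inr ⟨i, rfl, Linked.refl _ _, linked_of_gap i⟩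

theorem exists_upper_bound (p q : Cluster h y) : ∃ u, p ≤ u ∧ q ≤ u := by
  classical
  obtain ⟨a, ha⟩ := p.nonempty
  obtain ⟨b, hb⟩ := q.nonempty
  by_cases hpb : b ∈ p.carrier
  · rcases le_or_le hpb hb with h1 | h1
    · exact ⟨q, h1, le_rfl⟩
    · exact ⟨p, le_rfl, h1⟩
  rw [p.mem_iff a ha, Linked] at hpb
  push Not at hpb
  obtain ⟨j, hj, hlt⟩ := hpb
  -- The cluster of the highest gap between `a` and `b` contains both leaves.
  obtain ⟨i, hi, hmax⟩ := Finset.exists_max_image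
    (Finset.univ.filter fun i => GapIn a b i ∨ GapIn b a i) h ⟨j, by simpa using hj⟩
  simp only [Finset.mem_filter, Finset.mem_univ, true_and] at hi hmax
  have hmem : ∀ c, c = a ∨ c = b → c ∈ (ofGap h y i).carrier := by
    intro c hc k hk
    by_cases hki : k = i
    · rw [hki]
    · refine hmax k ?_
      rw [← Ne, Ne, Fin.ext_iff] at hki
      simp only [gapIn_iff, lowerLeaf] at hi hk ⊢
      rcases hc with rfl | rfl <;> omega
  have hpu : p ≤ ofGap h y i :=
    le_of_level_le ha (hmem a (Or.inl rfl)) (hlt.le.trans (hmax j hj))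
  rcases le_or_le hb (hmem b (Or.inr rfl)) with h1 | h1
  · exact ⟨_, hpu, h1⟩
  · exact ⟨q, hpu.trans h1, le_rfl⟩

end Cluster

/-- The coloured tree of a level function on the gaps. -/
theorem exists_of_levels (a₀ : Fin n) (h : Fin (n - 1) → L) (y : L) :
    ∃ (T : ColoredTree n) (lev : Fin T.m → L), (∀ u v, T.Below u v → lev u ≤ lev v) ∧
      (∀ i, lev (T.gapVertex i) = h i) ∧ ∀ v ∈ T.col, lev v = y := by
  -- The clusters containing a leaf form a nonempty chain, and the leaf is attached to the smallest
  -- one.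
  have exLeaf : ∀ a : Fin n, ∃ p : Cluster h y, ∀ q, p ≤ q ↔ a ∈ q.carrier := by
    intro a
    obtain ⟨p, hp, hmin⟩ := (Finite.to_wellFoundedLT (α := Cluster h y)).wf.has_min
      {p | a ∈ p.carrier} ⟨Cluster.ofLeaf h y a, Linked.refl y a⟩
    refine ⟨p, fun q => ⟨fun hpq => hpq.1 hp, fun hq => ?_⟩⟩
    rcases Cluster.le_or_le hp hq with h1 | h1
    · exact h1
    · rcases h1.eq_or_lt with h1 | h1
      · exact h1.ge
      · exact absurd h1 (hmin q hq)
  choose leafP hleaf using exLeaf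
  obtain ⟨T, e, he, hel, hec⟩ := exists_of_order (n := n) (P := Cluster h y)
    (by
      intro p q r hpq hpr
      obtain ⟨a, ha⟩ := p.nonempty
      exact Cluster.le_or_le (hpq.1 ha) (hpr.1 ha))
    (by
      obtain ⟨r, -, hmax⟩ := (Finite.to_wellFoundedGT (α := Cluster h y)).wf.has_min
        Set.univ ⟨Cluster.ofLeaf h y a₀, trivial⟩
      refine ⟨r, fun x => ?_⟩
      obtain ⟨u, h1, h2⟩ := Cluster.exists_upper_bound r x
      rcases h1.eq_or_lt with h3 | h3
      · exact h3 ▸ h2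
      · exact absurd h3 (hmax u trivial))
    leafP {p | p.level = y}
    (by
      intro v i j k hij hjk hi hk
      rw [hleaf] at hi hk ⊢
      exact (v.mem_iff i hi j).2 (Linked.between hij hjk ((v.mem_iff i hi k).1 hk)))
    (by
      intro i
      refine ⟨Cluster.ofLeaf h y i, ⟨rfl, (hleaf _ _).2 (Linked.refl y i)⟩, ?_⟩
      rintro p ⟨hp, hi⟩
      rw [hleaf] at hi
      have hp' : p.level = (Cluster.ofLeaf h y i).level := hp
      have hi' : i ∈ (Cluster.ofLeaf h y i).carrier := Linked.refl y i
      exact (Cluster.le_of_level_le hi hi' hp'.le).antisymm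
        (Cluster.le_of_level_le hi' hi hp'.ge))
    (by
      intro p hp
      obtain ⟨i, hi, h1, h2⟩ := p.level_eq.resolve_left hp
      refine ⟨lowerLeaf i, upperLeaf i, (lowerLeaf_lt_upperLeaf i).ne, (hleaf _ _).2 h1,
        (hleaf _ _).2 h2, fun u h3 h4 h5 => ?_⟩
      rw [hleaf] at h3 h4
      have h6 : p.level ≤ u.level := hi ▸ (u.mem_iff _ h3 _).1 h4 i (Or.inl (gapIn_self i))
      exact absurd (h5.trans_le (Cluster.le_of_level_le h1 h3 h6)) (lt_irrefl _))
    (by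
      intro p _
      obtain ⟨a, ha⟩ := p.nonempty
      exact ⟨a, (hleaf _ _).2 ha⟩)
  have below_leaf : ∀ a v, T.Below (T.leaf a) v ↔ a ∈ (e v).carrier := fun a v => by
    rw [he, hel, hleaf]
  refine ⟨T, fun v => (e v).level, fun u v huv => ((he u v).1 huv).2, fun i => ?_,
    fun v hv => (hec v).1 hv⟩
  -- A cluster containing both leaves of the gap has level at least `h i`, so the cluster of the gap
  -- is the smallest.
  have : T.gapVertex i = e.symm (Cluster.ofGap h y i) := by
    refine meet_eq_of_forall (lowerLeaf_lt_upperLeaf i).ne ?_ ?_ fun w h1 h2 => ?_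
    · rw [below_leaf, e.apply_symm_apply]
      exact Linked.refl _ _
    · rw [below_leaf, e.apply_symm_apply]
      exact Cluster.linked_of_gap i
    · rw [below_leaf] at h1 h2
      rw [he, e.apply_symm_apply]
      exact Cluster.le_of_level_le (Linked.refl _ _) h1
        (((e w).mem_iff _ h1 _).1 h2 i (Or.inl (gapIn_self i)))
  show (e (T.gapVertex i)).level = h i
  rw [this, e.apply_symm_apply]
  rfl

end Clusters

/-! ### Maximal trees and maximal refinements -/

section Refinement

/-- A tree is maximal if its gaps have different vertices, none of which is coloured. -/
theorem isMaximal_of_injective {T : ColoredTree n} (hinj : Function.Injective T.gapVertex)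
    (hcol : ∀ i, T.gapVertex i ∉ T.col) : T.IsMaximal := by
  intro v
  split_ifs with hv
  · apply le_antisymm
    · by_contra hlt
      obtain ⟨a, b, hab⟩ := (Finite.one_lt_card_iff_nontrivial.1 (not_le.1 hlt)).exists_pair_ne
      obtain ⟨i, hi⟩ := exists_gapVertex_of_inEdge_pair (fun h => hab (Subtype.ext h))
        (a.2.trans b.2.symm)
      exact hcol i (by rwa [hi, a.2])
    · rw [card_inEdge]
      exact T.stable_colored v hv
  · apply le_antisymm
    · by_contra hlt
      obtain ⟨a, b, c, hab, hac, hbc⟩ : ∃ a b c : {a : T.InEdge // T.target a = v},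
          a ≠ b ∧ a ≠ c ∧ b ≠ c := by
        rw [Nat.card_eq_fintype_card, not_le] at hlt
        exact Fintype.two_lt_card_iff.1 hlt
      choose x hx using fun a : {a : T.InEdge // T.target a = v} => exists_carries a.1
      have xinj : ∀ a b, a ≠ b → x a ≠ x b := fun a b hab h => hab (Subtype.ext
        (inEdge_unique (a.2.trans b.2.symm) (hx a) (h ▸ hx b)))
      -- Three incoming edges, ordered by leaves on them, would produce two gaps in disjoint
      -- intervals with the same vertex.
      have key : ∀ a b c : {a : T.InEdge // T.target a = v}, x a < x b → x b < x c → False := by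
        intro a b c h1 h2
        obtain ⟨i, hi, hi', -⟩ := exists_gap_of_inEdges (fun h => h1.ne (congrArg x (Subtype.ext h)))
          (a.2.trans b.2.symm) (hx a) (hx b) h1
        obtain ⟨j, hj, hj', -⟩ := exists_gap_of_inEdges (fun h => h2.ne (congrArg x (Subtype.ext h)))
          (b.2.trans c.2.symm) (hx b) (hx c) h2
        have hij : i = j := hinj (by rw [hi', hj', a.2, b.2])
        subst hij
        have := gapIn_iff.1 hi
        have := gapIn_iff.1 hj
        omega
      have h1 := xinj a b hab
      have h2 := xinj a c hac
      have h3 := xinj b c hbc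
      rcases h1.lt_or_gt with h1 | h1 <;> rcases h2.lt_or_gt with h2 | h2 <;>
        rcases h3.lt_or_gt with h3 | h3
      · exact key a b c h1 h3
      · exact key a c b h2 h3
      · exact key a b c h1 h3
      · exact key c a b h2 h1
      · exact key b a c h1 h2
      · exact key b a c h1 h2
      · exact key b c a h3 h2
      · exact key c b a h3 h1
    · rw [card_inEdge]
      exact T.stable_uncolored v hv

theorem IsMaximal.gapVertex_notMem_col {T : ColoredTree n} (hT : T.IsMaximal) (i : Fin (n - 1)) :
    T.gapVertex i ∉ T.col := by
  intro hi
  obtain ⟨a, b, hab, ha, hb, -⟩ := meets_meet (T := T) (lowerLeaf_lt_upperLeaf i).ne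
  have h1 := hT (T.gapVertex i)
  rw [if_pos hi] at h1
  have := (Nat.card_eq_one_iff_unique.1 h1).1
  exact hab (congrArg Subtype.val (Subsingleton.elim
    (⟨a, ha⟩ : {a : T.InEdge // T.target a = T.gapVertex i}) ⟨b, hb⟩))

/-- In a maximal tree different gaps have different vertices. -/
theorem IsMaximal.gapVertex_injective {T : ColoredTree n} (hT : T.IsMaximal) :
    Function.Injective T.gapVertex := by
  intro i j hij
  by_contra hne
  wlog hlt : i < j generalizing i j
  · exact this hij.symm (Ne.symm hne) (lt_of_le_of_ne (not_lt.1 hlt) (Ne.symm hne))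
  obtain ⟨a, b, hab, ha, hb, hai, hbi⟩ := meets_meet (T := T) (lowerLeaf_lt_upperLeaf i).ne
  obtain ⟨c, d, hcd, hc, hd, hcj, hdj⟩ := meets_meet (T := T) (lowerLeaf_lt_upperLeaf j).ne
  have h1 := hT (T.gapVertex i)
  rw [if_neg (hT.gapVertex_notMem_col i)] at h1
  have hbt : T.target b = T.target d := hb.trans (Eq.trans hij hd.symm)
  have key : ∀ x y : T.InEdge, T.target x = T.target y → ∀ p q r : Fin n, p ≤ q → q ≤ r →
      T.Carries x p → T.Carries x r → T.Carries y q → x = y := by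
    intro x y hxy p q r hpq hqr hp hr hq
    rcases x with e | k
    · exact inEdge_unique hxy (show T.Carries (.inl e) q from ribbon' hpq hqr hp hr) hq
    · have h1 : k = p := hp
      have h2 : k = r := hr
      have h3 : q = k := le_antisymm (h2 ▸ hqr) (h1 ▸ hpq)
      exact inEdge_unique hxy (show T.Carries (.inr k) q from h3.symm) hq
  have hle : upperLeaf i ≤ lowerLeaf j := Nat.succ_le_of_lt hlt
  -- An edge carrying two leaves carries those between them. Hence the edges of the first lower,
  -- first upper and second upper leaf are pairwise different, too many for a trivalent vertex.
  have hac : a ≠ d := fun h => hab (key a b (ha.trans hb.symm) (lowerLeaf i) (upperLeaf i)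
    (upperLeaf j) (lowerLeaf_lt_upperLeaf i).le (hle.trans (lowerLeaf_lt_upperLeaf j).le) hai
    (h ▸ hdj) hbi)
  have hbd : b ≠ d := fun h => hcd ((key b c (hbt.trans (hd.trans hc.symm)) (upperLeaf i)
    (lowerLeaf j) (upperLeaf j) hle (lowerLeaf_lt_upperLeaf j).le hbi (h ▸ hdj) hcj).symm.trans h)
  have hlt2 : 2 < Nat.card {a : T.InEdge // T.target a = T.gapVertex i} := by
    rw [Nat.card_eq_fintype_card, Fintype.two_lt_card_iff]
    exact ⟨⟨a, ha⟩, ⟨b, hb⟩, ⟨d, hbt ▸ hb⟩, fun h => hab (congrArg Subtype.val h),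
      fun h => hac (congrArg Subtype.val h), fun h => hbd (congrArg Subtype.val h)⟩
  omega

open Classical in
/-- A strictly increasing function on the vertices of a stable tree that vanishes on the coloured
vertices. -/
theorem exists_depth (T : ColoredTree n) : ∃ d : Fin T.m → ℤ, (∀ v ∈ T.col, d v = 0) ∧
    ∀ u v, T.Below u v → u ≠ v → d u < d v := by
  -- The number of leaves beyond a vertex grows strictly on reaching an uncoloured vertex, but may
  -- be constant at a bivalent coloured one.
  let N : Fin T.m → ℤ := fun v => ((Finset.univ.filter fun i => T.Below (T.leaf i) v).card : ℤ)
  have hN : ∀ u v, T.Below u v → u ≠ v → v ∉ T.col → N u < N v := by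
    intro u v huv hne hv
    obtain ⟨i, hi⟩ := exists_leaf_below u
    obtain ⟨j, hij, rfl⟩ := exists_meet_eq hv (hi.trans huv)
    refine Int.ofNat_lt.2 (Finset.card_lt_card ⟨fun k hk => ?_, fun hsub => ?_⟩)
    · simp only [Finset.mem_filter, Finset.mem_univ, true_and] at hk ⊢
      exact hk.trans huv
    · have hj := @hsub j (by simpa using leaf_below_meet_right hij)
      simp only [Finset.mem_filter, Finset.mem_univ, true_and] at hj
      exact hne (huv.antisymm (meet_below hij hi hj))
  have hpos : ∀ v, 0 < N v := by
    intro v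
    obtain ⟨i, hi⟩ := exists_leaf_below v
    exact Int.natCast_pos.2 (Finset.card_pos.2 ⟨i, by simpa using hi⟩)
  have hle : ∀ v, N v ≤ n := fun v => by
    have := Finset.card_le_univ (Finset.univ.filter fun i => T.Below (T.leaf i) v)
    rw [Fintype.card_fin] at this
    exact Int.ofNat_le.2 this
  -- Since `N` takes values from 1 to `n`, subtracting `n + 1` beyond the colours makes the values
  -- negative there and positive on the root side.
  let d : Fin T.m → ℤ := fun v =>
    if v ∈ T.col then 0 else if ∃ c ∈ T.col, T.Below v c then N v - (n + 1) else N v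
  have d0 : ∀ v ∈ T.col, d v = 0 := fun v hv => if_pos hv
  have d1 : ∀ v, v ∉ T.col → (∃ c ∈ T.col, T.Below v c) → d v = N v - (n + 1) := fun v hv h => by
    simp only [d, if_neg hv, if_pos h]
  have d2 : ∀ v, v ∉ T.col → (¬ ∃ c ∈ T.col, T.Below v c) → d v = N v := fun v hv h => by
    simp only [d, if_neg hv, if_neg h]
  refine ⟨d, d0, fun u v huv hne => ?_⟩
  have hu0 := hpos u
  have hv0 := hpos v
  have hun := hle u
  by_cases hu : u ∈ T.col
  · have hv : v ∉ T.col := fun hv => hne (eq_of_col_below hu hv huv)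
    rw [d0 u hu, d2 v hv]
    · exact hv0
    · rintro ⟨c, hc, hvc⟩
      have := eq_of_col_below hu hc (huv.trans hvc)
      exact hne (huv.antisymm (this ▸ hvc))
  by_cases hv : v ∈ T.col
  · rw [d0 v hv, d1 u hu ⟨v, hv, huv⟩]
    omega
  have hlt := hN u v huv hne hv
  by_cases hvc : ∃ c ∈ T.col, T.Below v c
  · obtain ⟨c, hc, hvc⟩ := hvc
    rw [d1 u hu ⟨c, hc, huv.trans hvc⟩, d1 v hv ⟨c, hc, hvc⟩]
    omega
  · rw [d2 v hv hvc]
    by_cases huc : ∃ c ∈ T.col, T.Below u c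
    · rw [d1 u hu huc]
      omega
    · rwa [d2 u hu huc]

/-- Every tree has a maximal refinement adapted to given sizes of the gaps. -/
theorem exists_refinement (T' : ColoredTree n) (x : Fin (n - 1) → ℝ) :
    ∃ (T : ColoredTree n) (f : Fin T.m → Fin T'.m), T.IsMaximal ∧ T.IsMorphism T' f ∧
      (∀ i j, T.Below (T.gapVertex i) (T.gapVertex j) → T'.gapVertex i = T'.gapVertex j →
        x i ≤ x j) ∧
      (∀ i a, T.Below (T.cv a) (T.gapVertex i) → T'.gapVertex i ∈ T'.col → 1 ≤ x i) ∧
      ∀ i a, T.Below (T.gapVertex i) (T.cv a) → T'.gapVertex i ∈ T'.col → x i ≤ 1 := by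
  obtain ⟨d, d0, dlt⟩ := exists_depth T'
  obtain ⟨a₀, -⟩ := exists_leaf_below T'.root
  -- Levels are compared lexicographically: depth in `T'` first, so that the new tree refines `T'`;
  -- then size; then position, to break ties. The shift by 1 in the position keeps every gap off the
  -- level `y` of the colours.
  let h : Fin (n - 1) → ℤ ×ₗ (ℝ ×ₗ ℕ) := fun i =>
    toLex (d (T'.gapVertex i), toLex (x i, i.1 + 1))
  let y : ℤ ×ₗ (ℝ ×ₗ ℕ) := toLex (0, toLex (1, 0))
  have hle : ∀ i j, h i ≤ h j → d (T'.gapVertex i) < d (T'.gapVertex j) ∨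
      d (T'.gapVertex i) = d (T'.gapVertex j) ∧ x i ≤ x j := by
    intro i j hij
    simp only [h, Prod.Lex.toLex_le_toLex] at hij
    rcases hij with hij | ⟨hij, hij' | hij'⟩
    · exact Or.inl hij
    · exact Or.inr ⟨hij, hij'.le⟩
    · exact Or.inr ⟨hij, hij'.1.le⟩
  have hley : ∀ i, h i ≤ y → d (T'.gapVertex i) < 0 ∨ d (T'.gapVertex i) = 0 ∧ x i ≤ 1 := by
    intro i hi
    simp only [h, y, Prod.Lex.toLex_le_toLex] at hi
    rcases hi with hi | ⟨hi, hi' | hi'⟩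
    · exact Or.inl hi
    · exact Or.inr ⟨hi, hi'.le⟩
    · exact Or.inr ⟨hi, hi'.1.le⟩
  have hyle : ∀ i, y ≤ h i → 0 < d (T'.gapVertex i) ∨ d (T'.gapVertex i) = 0 ∧ 1 ≤ x i := by
    intro i hi
    simp only [h, y, Prod.Lex.toLex_le_toLex] at hi
    rcases hi with hi | ⟨hi, hi' | hi'⟩
    · exact Or.inl hi
    · exact Or.inr ⟨hi.symm, hi'.le⟩
    · exact Or.inr ⟨hi.symm, hi'.1.le⟩
  obtain ⟨T, lev, hlev, hgap, hcol⟩ := exists_of_levels a₀ h y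
  have hcv : ∀ a, lev (T.cv a) = y := fun a => hcol _ (cv_mem a)
  have dle : ∀ u v, T'.Below u v → d u ≤ d v := by
    intro u v huv
    by_cases hne : u = v
    · rw [hne]
    · exact (dlt u v huv hne).le
  have hmax : T.IsMaximal := by
    refine isMaximal_of_injective (fun i j hij => ?_) fun i hi => ?_
    · have := congrArg lev hij
      rw [hgap, hgap] at this
      simp only [h, EmbeddingLike.apply_eq_iff_eq, Prod.mk.injEq] at this
      exact Fin.ext (by omega)
    · have := hcol _ hi
      rw [hgap] at this
      simp [h, y] at this
  -- A violation of any of the three conditions would be a strict inequality of depths in `T'`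
  -- contrary to the order of the levels in `T`, whose first component is the depth.
  have hdeg : T.Degenerates T' := by
    refine ⟨fun a b i hi h1 => ?_, fun a b hab h1 => ?_, fun a b hab h1 => ?_⟩
    · obtain ⟨j, hj, hj'⟩ := exists_gapVertex_eq_meet (T := T') hi.lt
      have h2 := hlev _ _ (hj.gapVertex_below_meet (T := T))
      rw [← h1, hgap, hgap] at h2
      by_contra hne
      have h3 := dlt _ _ hi.gapVertex_below_meet hne
      rw [← hj'] at h3
      rcases hle _ _ h2 with h4 | h4
      · omega
      · omega
    · rcases cv_below_or (T := T') (leaf_below_meet_left hab.ne) with h2 | h2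
      · exact h2
      by_cases hne : T'.meet a b = T'.cv a
      · rw [hne]
        exact Below.refl _ _
      exfalso
      obtain ⟨i, hi, hi'⟩ := exists_gapVertex_eq_meet (T := T) hab
      have h3 := hlev _ _ h1
      rw [← hi', hgap, hcv] at h3
      have h4 := dlt _ _ h2 hne
      rw [d0 _ (cv_mem a)] at h4
      have h5 := dle _ _ (hi.gapVertex_below_meet (T := T'))
      rcases hyle _ h3 with h6 | h6
      · omega
      · omega
    · rcases cv_below_or (T := T') (leaf_below_meet_left hab.ne) with h2 | h2
      swap
      · exact h2
      by_cases hne : T'.cv a = T'.meet a b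
      · rw [hne]
        exact Below.refl _ _
      exfalso
      obtain ⟨i, hi, hi'⟩ := exists_gapVertex_eq_meet (T := T') hab
      have h3 := hlev _ _ ((hi.gapVertex_below_meet (T := T)).trans h1)
      rw [hgap, hcv] at h3
      have h4 := dlt _ _ h2 hne
      rw [d0 _ (cv_mem a), ← hi'] at h4
      rcases hley _ h3 with h6 | h6
      · omega
      · omega
  obtain ⟨f, hf⟩ := hdeg.exists_isMorphism
  refine ⟨T, f, hmax, hf, fun i j hij hij' => ?_, fun i a hi hi' => ?_, fun i a hi hi' => ?_⟩
  · have h1 := hlev _ _ hij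
    rw [hgap, hgap] at h1
    rcases hle _ _ h1 with h2 | h2
    · rw [hij'] at h2
      exact absurd h2 (lt_irrefl _)
    · exact h2.2
  · have h1 := hlev _ _ hi
    rw [hgap, hcv] at h1
    rcases hyle _ h1 with h2 | h2
    · rw [d0 _ hi'] at h2
      exact absurd h2 (lt_irrefl _)
    · exact h2.2
  · have h1 := hlev _ _ hi
    rw [hgap, hcv] at h1
    rcases hley _ h1 with h2 | h2
    · rw [d0 _ hi'] at h2
      exact absurd h2 (lt_irrefl _)
    · exact h2.2

end Refinement

end ColoredTree


/-! ### Half-plane coordinates on the disk -/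

section HalfPlane

/-- The coordinate that identifies the unit disk with the upper half-plane and sends the boundary
point `u` to infinity. -/
noncomputable def toHalfPlane (u z : ℂ) : ℂ := Complex.I * (u + z) / (u - z)

/-- The inverse of `toHalfPlane u`. -/
noncomputable def ofHalfPlane (u w : ℂ) : ℂ := u * (w - Complex.I) / (w + Complex.I)

theorem add_I_ne_zero {w : ℂ} (hw : 0 ≤ w.im) : w + Complex.I ≠ 0 := fun h => by
  have := congrArg Complex.im h
  simp at this
  linarith

theorem toHalfPlane_ofHalfPlane {u w : ℂ} (hu : u ≠ 0) (hw : w + Complex.I ≠ 0) :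
    toHalfPlane u (ofHalfPlane u w) = w := by
  have h1 : u + u * (w - Complex.I) / (w + Complex.I) = u * (2 * w) / (w + Complex.I) := by
    field_simp
    ring
  have h2 : u - u * (w - Complex.I) / (w + Complex.I) = u * (2 * Complex.I) / (w + Complex.I) := by
    field_simp
    ring
  rw [toHalfPlane, ofHalfPlane, h1, h2]
  field_simp

theorem ofHalfPlane_toHalfPlane {u z : ℂ} (hu : u ≠ 0) (hz : z ≠ u) :
    ofHalfPlane u (toHalfPlane u z) = z := by
  have hd : u - z ≠ 0 := sub_ne_zero.2 hz.symm
  have h1 : Complex.I * (u + z) / (u - z) - Complex.I = Complex.I * (2 * z) / (u - z) := by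
    field_simp
    ring
  have h2 : Complex.I * (u + z) / (u - z) + Complex.I = Complex.I * (2 * u) / (u - z) := by
    field_simp
    ring
  rw [toHalfPlane, ofHalfPlane, h1, h2]
  field_simp

theorem ofHalfPlane_ne {u w : ℂ} (hu : u ≠ 0) (hw : w + Complex.I ≠ 0) : ofHalfPlane u w ≠ u := by
  intro h
  rw [ofHalfPlane, div_eq_iff hw] at h
  have h1 := mul_left_cancel₀ hu h
  have h2 := congrArg Complex.im h1
  simp at h2
  linarith

/-- From this formula one reads off that the disk goes to the upper half-plane, the circle to the
real line, and the seams to horizontal lines. -/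
theorem im_toHalfPlane (u : Circle) (z : ℂ) :
    (toHalfPlane u z).im = (1 - Complex.normSq z) / Complex.normSq (u - z) := by
  have hu : (u : ℂ).re * (u : ℂ).re + (u : ℂ).im * (u : ℂ).im = 1 := by
    rw [← Complex.normSq_apply, Complex.normSq_eq_norm_sq, Circle.norm_coe, one_pow]
  rw [toHalfPlane, Complex.div_im]
  simp only [Complex.mul_im, Complex.mul_re, Complex.I_re, Complex.I_im, Complex.add_re,
    Complex.add_im, Complex.sub_re, Complex.sub_im, zero_mul, one_mul, zero_sub, zero_add]
  rw [← sub_div]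
  congr 1
  rw [Complex.normSq_apply]
  linear_combination hu

theorem normSq_sub_pos {u z : ℂ} (hz : z ≠ u) : 0 < Complex.normSq (u - z) :=
  Complex.normSq_pos.2 (sub_ne_zero.2 hz.symm)

theorem im_toHalfPlane_nonneg (u : Circle) {z : ℂ} (hz : z ∈ Metric.closedBall (0 : ℂ) 1) :
    0 ≤ (toHalfPlane u z).im := by
  rw [im_toHalfPlane]
  rw [mem_closedBall_zero_iff] at hz
  have : Complex.normSq z ≤ 1 := by
    rw [Complex.normSq_eq_norm_sq]
    nlinarith [norm_nonneg z]
  exact div_nonneg (by linarith) (Complex.normSq_nonneg _)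

theorem im_toHalfPlane_pos (u : Circle) {z : ℂ} (hz : z ∈ Metric.ball (0 : ℂ) 1) :
    0 < (toHalfPlane u z).im := by
  rw [im_toHalfPlane]
  rw [mem_ball_zero_iff] at hz
  have h1 : Complex.normSq z < 1 := by
    rw [Complex.normSq_eq_norm_sq]
    nlinarith [norm_nonneg z]
  have h2 : z ≠ u := fun h => by
    rw [h, Circle.norm_coe] at hz
    exact lt_irrefl _ hz
  exact div_pos (by linarith) (normSq_sub_pos h2)

theorem toHalfPlane_circle (u p : Circle) : (((toHalfPlane u p).re : ℝ) : ℂ) = toHalfPlane u p := by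
  refine Complex.ext (by simp) ?_
  rw [im_toHalfPlane, Complex.normSq_eq_norm_sq, Circle.norm_coe]
  simp

theorem normSq_ofHalfPlane (u : Circle) {w : ℂ} (hw : 0 ≤ w.im) :
    Complex.normSq (ofHalfPlane u w) = 1 - 4 * w.im / Complex.normSq (w + Complex.I) := by
  have h0 : Complex.normSq (w + Complex.I) ≠ 0 := (Complex.normSq_pos.2 (add_I_ne_zero hw)).ne'
  rw [ofHalfPlane, Complex.normSq_div, Complex.normSq_mul, Complex.normSq_eq_norm_sq (u : ℂ),
    Circle.norm_coe, one_pow, one_mul, eq_sub_iff_add_eq, ← add_div, div_eq_one_iff_eq h0]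
  simp only [Complex.normSq_apply, Complex.sub_re, Complex.sub_im, Complex.add_re, Complex.add_im,
    Complex.I_re, Complex.I_im]
  ring

theorem ofHalfPlane_mem_closedBall (u : Circle) {w : ℂ} (hw : 0 ≤ w.im) :
    ofHalfPlane u w ∈ Metric.closedBall (0 : ℂ) 1 := by
  rw [mem_closedBall_zero_iff, ← sq_le_one_iff₀ (norm_nonneg _), ← Complex.normSq_eq_norm_sq,
    normSq_ofHalfPlane u hw]
  have : 0 ≤ 4 * w.im / Complex.normSq (w + Complex.I) :=
    div_nonneg (by linarith) (Complex.normSq_nonneg _)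
  linarith

theorem ofHalfPlane_mem_ball (u : Circle) {w : ℂ} (hw : 0 < w.im) :
    ofHalfPlane u w ∈ Metric.ball (0 : ℂ) 1 := by
  rw [mem_ball_zero_iff, ← sq_lt_one_iff₀ (norm_nonneg _), ← Complex.normSq_eq_norm_sq,
    normSq_ofHalfPlane u hw.le]
  have : 0 < 4 * w.im / Complex.normSq (w + Complex.I) :=
    div_pos (by linarith) (Complex.normSq_pos.2 (add_I_ne_zero hw.le))
  linarith

theorem norm_ofHalfPlane_real (u : Circle) (t : ℝ) : ‖ofHalfPlane u t‖ = 1 := by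
  have h : Complex.normSq (ofHalfPlane u t) = 1 := by
    rw [normSq_ofHalfPlane u (by simp)]
    simp
  rwa [Complex.normSq_eq_norm_sq, pow_eq_one_iff_of_nonneg (norm_nonneg _) two_ne_zero] at h

/-- The boundary point with real coordinate `t`. -/
noncomputable def boundaryPoint (u : Circle) (t : ℝ) : Circle :=
  ⟨ofHalfPlane u t, mem_sphere_zero_iff_norm.2 (norm_ofHalfPlane_real u t)⟩

theorem coe_boundaryPoint (u : Circle) (t : ℝ) : (boundaryPoint u t : ℂ) = ofHalfPlane u t := rfl

theorem toHalfPlane_boundaryPoint (u : Circle) (t : ℝ) : toHalfPlane u (boundaryPoint u t) = t :=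
  toHalfPlane_ofHalfPlane (Circle.coe_ne_zero u) (add_I_ne_zero (by simp))

theorem boundaryPoint_ne (u : Circle) (t : ℝ) : boundaryPoint u t ≠ u := fun h =>
  ofHalfPlane_ne (Circle.coe_ne_zero u) (add_I_ne_zero (w := (t : ℂ)) (by simp))
    (congrArg (fun p : Circle => (p : ℂ)) h)

theorem boundaryPoint_toHalfPlane {u p : Circle} (h : p ≠ u) :
    boundaryPoint u (toHalfPlane u p).re = p := by
  apply Circle.ext
  rw [coe_boundaryPoint, toHalfPlane_circle]
  exact ofHalfPlane_toHalfPlane (Circle.coe_ne_zero u) fun h' => h (Circle.ext h')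

/-- After cancelling `u`, the product defining the orientation becomes `4 / ((s - i) (t + i))`,
whose imaginary part has the sign of `t - s`. -/
theorem counterclockwise_boundaryPoint (u : Circle) (s t : ℝ) :
    Counterclockwise u (boundaryPoint u s) (boundaryPoint u t) ↔ s < t := by
  have hs : (s : ℂ) + Complex.I ≠ 0 := add_I_ne_zero (by simp)
  have hs' : (s : ℂ) - Complex.I ≠ 0 := fun h => by
    have := congrArg Complex.im h
    simp at this
  have ht : (t : ℂ) + Complex.I ≠ 0 := add_I_ne_zero (by simp)
  have h1 : ∀ r : ℝ, (r : ℂ) + Complex.I ≠ 0 →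
      ofHalfPlane u r - u = u * (-2 * Complex.I) / (r + Complex.I) := by
    intro r hr
    rw [ofHalfPlane]
    field_simp
    ring
  have hu : (starRingEnd ℂ) (u : ℂ) * u = 1 := by
    rw [← Complex.normSq_eq_conj_mul_self, Complex.normSq_eq_norm_sq, Circle.norm_coe]
    simp
  have h2 : (starRingEnd ℂ) (u * (-2 * Complex.I) / (s + Complex.I)) *
      (u * (-2 * Complex.I) / (t + Complex.I)) = 4 / ((s - Complex.I) * (t + Complex.I)) := by
    simp only [map_div₀, map_mul, map_neg, map_add, Complex.conj_I, Complex.conj_ofReal, map_ofNat]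
    rw [← sub_eq_add_neg, div_mul_div_comm]
    congr 1
    linear_combination (4 * (-Complex.I * Complex.I)) * hu - 4 * Complex.I_mul_I
  rw [Counterclockwise, coe_boundaryPoint, coe_boundaryPoint, h1 s hs, h1 t ht, h2, Complex.div_im]
  have hpos : 0 < Complex.normSq ((s - Complex.I) * (t + Complex.I)) :=
    Complex.normSq_pos.2 (mul_ne_zero hs' ht)
  simp only [Complex.im_ofNat, zero_mul, zero_div, Complex.re_ofNat, zero_sub]
  rw [neg_pos, div_neg_iff, or_iff_right fun h => not_lt_of_gt hpos h.2, and_iff_left hpos]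
  simp
  constructor <;> intro h <;> linarith

theorem counterclockwise_iff {u p q : Circle} (hp : p ≠ u) (hq : q ≠ u) :
    Counterclockwise u p q ↔ (toHalfPlane u p).re < (toHalfPlane u q).re := by
  rw [← counterclockwise_boundaryPoint u, boundaryPoint_toHalfPlane hp, boundaryPoint_toHalfPlane hq]

end HalfPlane

/-! ### Disk automorphisms are affine maps of half-planes -/

section Affine

open Complex in
/-- The map from the disk to itself that sends `u` to `u'` and is affine in the half-plane
coordinates. -/
noncomputable def affineDisk (u u' : Circle) (α β : ℝ) (z : ℂ) : ℂ :=
  u' * (α * I * (u + z) + (β - I) * (u - z)) / (α * I * (u + z) + (β + I) * (u - z))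

variable {u u' : Circle} {α β : ℝ}

theorem affine_im_nonneg (hα : 0 < α) {w : ℂ} (hw : 0 ≤ w.im) : 0 ≤ (α * w + β : ℂ).im := by
  simpa using mul_nonneg hα.le hw

theorem affine_im_pos (hα : 0 < α) {w : ℂ} (hw : 0 < w.im) : 0 < (α * w + β : ℂ).im := by
  simpa using mul_pos hα hw

theorem affineDisk_self (hα : 0 < α) : affineDisk u u' α β u = u' := by
  have h : (α : ℂ) ≠ 0 := by exact_mod_cast hα.ne'
  have hu := Circle.coe_ne_zero u
  rw [affineDisk, sub_self, mul_zero, mul_zero, add_zero, mul_div_assoc, div_self, mul_one]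
  exact mul_ne_zero (mul_ne_zero h Complex.I_ne_zero) (by
    rw [← two_mul]
    simp)

/-- Clearing the denominator `u - z` in the composite formula gives `affineDisk`, which therefore
also has the right value at the point at infinity `u`. -/
theorem affineDisk_of_ne {z : ℂ} (hz : z ≠ u) :
    affineDisk u u' α β z = ofHalfPlane u' (α * toHalfPlane u z + β) := by
  have hd : (u : ℂ) - z ≠ 0 := sub_ne_zero.2 hz.symm
  have h1 : α * (Complex.I * (u + z) / (u - z)) + β - Complex.I =
      (α * Complex.I * (u + z) + (β - Complex.I) * (u - z)) / (u - z) := by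
    field_simp
    ring
  have h2 : α * (Complex.I * (u + z) / (u - z)) + β + Complex.I =
      (α * Complex.I * (u + z) + (β + Complex.I) * (u - z)) / (u - z) := by
    field_simp
    ring
  rw [ofHalfPlane, toHalfPlane, h1, h2, affineDisk, mul_div_assoc, mul_div_assoc,
    div_div_div_cancel_right₀ hd]

theorem affineDisk_denom_ne_zero (hα : 0 < α) {z : ℂ} (hz : z ∈ Metric.closedBall (0 : ℂ) 1) :
    α * Complex.I * (u + z) + (β + Complex.I) * (u - z) ≠ 0 := by
  by_cases h : z = u
  · have h' : (α : ℂ) ≠ 0 := by exact_mod_cast hα.ne'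
    have hu := Circle.coe_ne_zero u
    rw [h, sub_self, mul_zero, add_zero, ← two_mul]
    simp [h']
  · have hd : (u : ℂ) - z ≠ 0 := sub_ne_zero.2 (Ne.symm h)
    have h1 : α * Complex.I * (u + z) + (β + Complex.I) * (u - z) =
        (u - z) * (α * toHalfPlane u z + β + Complex.I) := by
      rw [toHalfPlane]
      field_simp
      ring
    rw [h1]
    exact mul_ne_zero hd (add_I_ne_zero (affine_im_nonneg hα (im_toHalfPlane_nonneg u hz)))

theorem toHalfPlane_affineDisk (hα : 0 < α) {z : ℂ} (hz : z ∈ Metric.closedBall (0 : ℂ) 1)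
    (hne : z ≠ u) : toHalfPlane u' (affineDisk u u' α β z) = α * toHalfPlane u z + β := by
  rw [affineDisk_of_ne hne, toHalfPlane_ofHalfPlane (Circle.coe_ne_zero u')]
  exact add_I_ne_zero (affine_im_nonneg hα (im_toHalfPlane_nonneg u hz))

theorem affineDisk_ne (hα : 0 < α) {z : ℂ} (hz : z ∈ Metric.closedBall (0 : ℂ) 1)
    (hne : z ≠ u) : affineDisk u u' α β z ≠ u' := by
  rw [affineDisk_of_ne hne]
  exact ofHalfPlane_ne (Circle.coe_ne_zero u')
    (add_I_ne_zero (affine_im_nonneg hα (im_toHalfPlane_nonneg u hz)))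

theorem affineDisk_mapsTo (hα : 0 < α) : DiffContOnCl ℂ (affineDisk u u' α β) (Metric.ball 0 1) ∧
    Set.MapsTo (affineDisk u u' α β) (Metric.ball 0 1) (Metric.ball 0 1) ∧
    Set.MapsTo (affineDisk u u' α β) (Metric.closedBall 0 1) (Metric.closedBall 0 1) := by
  refine ⟨DifferentiableOn.diffContOnCl ?_, fun z hz => ?_, fun z hz => ?_⟩
  · rw [closure_ball _ one_ne_zero]
    intro z hz
    unfold affineDisk
    refine DifferentiableAt.differentiableWithinAt ?_
    exact DifferentiableAt.div (by fun_prop) (by fun_prop) (affineDisk_denom_ne_zero hα hz)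
  · have hne : z ≠ u := fun h => by
      rw [mem_ball_zero_iff, h, Circle.norm_coe] at hz
      exact lt_irrefl _ hz
    rw [affineDisk_of_ne hne]
    exact ofHalfPlane_mem_ball u' (affine_im_pos hα (im_toHalfPlane_pos u hz))
  · by_cases hne : z = u
    · rw [hne, affineDisk_self hα]
      exact Circle.coe_mem_closedBall u'
    · rw [affineDisk_of_ne hne]
      exact ofHalfPlane_mem_closedBall u' (affine_im_nonneg hα (im_toHalfPlane_nonneg u hz))

theorem affineDisk_leftInvOn (hα : 0 < α) :
    Set.LeftInvOn (affineDisk u' u α⁻¹ (-(α⁻¹ * β))) (affineDisk u u' α β)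
      (Metric.closedBall 0 1) := by
  intro z hz
  by_cases hne : z = u
  · rw [hne, affineDisk_self hα, affineDisk_self (inv_pos.2 hα)]
  · rw [affineDisk_of_ne (affineDisk_ne hα hz hne), toHalfPlane_affineDisk hα hz hne]
    have h' : (α : ℂ) ≠ 0 := by exact_mod_cast hα.ne'
    have h1 : ((α⁻¹ : ℝ) : ℂ) * (α * toHalfPlane u z + β) + ((-(α⁻¹ * β) : ℝ) : ℂ) =
        toHalfPlane u z := by
      push_cast
      field_simp
      ring
    rw [h1, ofHalfPlane_toHalfPlane (Circle.coe_ne_zero u) hne]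

theorem isDiskIso_affineDisk (hα : 0 < α) : IsDiskIso (affineDisk u u' α β) := by
  refine ⟨affineDisk u' u α⁻¹ (-(α⁻¹ * β)), affineDisk_mapsTo hα, affineDisk_mapsTo (inv_pos.2 hα),
    affineDisk_leftInvOn hα, ?_⟩
  have h := affineDisk_leftInvOn (u := u') (u' := u) (β := -(α⁻¹ * β)) (inv_pos.2 hα)
  have h1 : -(α⁻¹⁻¹ * -(α⁻¹ * β)) = β := by
    field_simp
  rwa [inv_inv, mul_neg, neg_neg, ← mul_assoc, mul_inv_cancel₀ hα.ne', one_mul] at h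

theorem IsDiskIso.injOn {φ : ℂ → ℂ} (h : IsDiskIso φ) : Set.InjOn φ (Metric.closedBall 0 1) := by
  obtain ⟨ψ, -, -, h1, -⟩ := h
  exact h1.injOn

theorem IsDiskIso.mapsTo {φ : ℂ → ℂ} (h : IsDiskIso φ) :
    Set.MapsTo φ (Metric.closedBall 0 1) (Metric.closedBall 0 1) := by
  obtain ⟨ψ, h1, -⟩ := h
  exact h1.2.2

/-- A holomorphic automorphism of the disk fixing the centre is a rotation. -/
theorem IsDiskIso.eq_rotation {φ : ℂ → ℂ} (h : IsDiskIso φ) (h0 : φ 0 = 0) :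
    ∃ c : ℂ, ‖c‖ = 1 ∧ ∀ z ∈ Metric.closedBall (0 : ℂ) 1, φ z = c * z := by
  obtain ⟨ψ, ⟨a1, a2, a3⟩, ⟨b1, b2, b3⟩, c, d⟩ := h
  have hψ0 : ψ 0 = 0 := by
    have := c (show (0 : ℂ) ∈ Metric.closedBall (0 : ℂ) 1 by simp)
    rwa [h0] at this
  have key : ∀ f g : ℂ → ℂ, DiffContOnCl ℂ f (Metric.ball 0 1) →
      Set.MapsTo f (Metric.ball 0 1) (Metric.ball 0 1) → f 0 = 0 → ∀ z, ‖z‖ < 1 → ‖f z‖ ≤ ‖z‖ :=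
    fun f g hf hm hf0 z hz => Complex.norm_le_norm_of_mapsTo_ball hf.differentiableOn
      (fun w hw => Metric.ball_subset_closedBall (hm hw)) hf0 hz
  -- The Schwarz lemma for the map and for its inverse forces equality at one nonzero point, the
  -- rigid case of the lemma.
  have hnorm : ‖φ (1 / 2)‖ = ‖(1 / 2 : ℂ)‖ := by
    have hz : ‖(1 / 2 : ℂ)‖ < 1 := by norm_num
    refine le_antisymm (key φ ψ a1 a2 h0 _ hz) ?_
    have h1 := key ψ φ b1 b2 hψ0 (φ (1 / 2))
      (mem_ball_zero_iff.1 (a2 (mem_ball_zero_iff.2 hz)))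
    rwa [c (mem_closedBall_zero_iff.2 hz.le)] at h1
  obtain ⟨e, he1, he2⟩ := Complex.affine_of_mapsTo_ball_of_exists_norm_dslope_eq_div'
    (R₁ := 1) (R₂ := 1) (c := (0 : ℂ)) a1.differentiableOn
    (by
      rw [h0]
      exact fun w hw => Metric.ball_subset_closedBall (a2 hw))
    ⟨1 / 2, by
      rw [mem_ball_zero_iff]
      norm_num, by
      rw [dslope_of_ne _ (by norm_num), slope_def_module, h0, sub_zero, sub_zero, norm_smul, hnorm]
      norm_num⟩
  have heq : Set.EqOn φ (fun z => e * z) (Metric.ball 0 1) := by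
    intro z hz
    have := he2 hz
    simp only [h0, sub_zero, zero_add, smul_eq_mul] at this
    rw [this, mul_comm]
  refine ⟨e, by simpa using he1, ?_⟩
  have h1 := a1.continuousOn
  rw [closure_ball _ one_ne_zero] at h1
  refine Set.EqOn.of_subset_closure heq h1 (by fun_prop) Metric.ball_subset_closedBall ?_
  rw [closure_ball _ one_ne_zero]

/-- A holomorphic automorphism of the disk is affine in half-plane coordinates. -/
theorem IsDiskIso.exists_affine {φ : ℂ → ℂ} (h : IsDiskIso φ) (hu : φ u = u') :
    ∃ α β : ℝ, 0 < α ∧ ∀ z ∈ Metric.closedBall (0 : ℂ) 1, z ≠ u →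
      φ z ≠ u' ∧ toHalfPlane u' (φ z) = α * toHalfPlane u z + β := by
  have h0 : φ 0 ∈ Metric.ball (0 : ℂ) 1 := by
    obtain ⟨ψ, h1, -⟩ := h
    exact h1.2.1 (by simp)
  have hne : ∀ z ∈ Metric.closedBall (0 : ℂ) 1, z ≠ u → φ z ≠ u' := fun z hz hzu h' =>
    hzu (h.injOn hz (Circle.coe_mem_closedBall u) (h'.trans hu.symm))
  have h0' : φ 0 ≠ u' := hne 0 (by simp) (Circle.coe_ne_zero u).symm
  set w := toHalfPlane u' (φ 0) with hw
  have hy : 0 < w.im := im_toHalfPlane_pos u' h0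
  have hα := inv_pos.2 hy
  -- Composing with the affine map that takes `φ 0` to the centre gives a rotation carrying `u` to
  -- `u'`, which does not change half-plane coordinates; the affine map is then undone.
  obtain ⟨c, hc1, hc2⟩ := (h.comp (isDiskIso_affineDisk (u := u') (u' := u')
      (β := -(w.im⁻¹ * w.re)) hα)).eq_rotation (by
    rw [affineDisk_of_ne h0', ← hw]
    have : ((w.im⁻¹ : ℝ) : ℂ) * w + ((-(w.im⁻¹ * w.re) : ℝ) : ℂ) = Complex.I := by
      apply Complex.ext
      · simp
      · simp [hy.ne']
    rw [this, ofHalfPlane, sub_self, mul_zero, zero_div])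
  have hcu : c * u = u' := by
    rw [← hc2 u (Circle.coe_mem_closedBall u)]
    rw [hu, affineDisk_self hα]
  refine ⟨w.im, w.re, hy, fun z hz hzu => ⟨hne z hz hzu, ?_⟩⟩
  have h1 := toHalfPlane_affineDisk (u' := u') (β := -(w.im⁻¹ * w.re)) hα (h.mapsTo hz) (hne z hz hzu)
  have hc0 : c ≠ 0 := fun h => by simp [h] at hc1
  have h2 : toHalfPlane u' (c * z) = toHalfPlane u z := by
    rw [← hcu, toHalfPlane, toHalfPlane, ← mul_add, ← mul_sub, mul_left_comm,
      mul_div_mul_left _ _ hc0]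
  rw [hc2 z hz, h2] at h1
  have hy' : (w.im : ℂ) ≠ 0 := by exact_mod_cast hy.ne'
  rw [h1]
  push_cast
  field_simp
  ring

end Affine


open ColoredTree

namespace NodalQuiltedDisk

variable {n : ℕ}

/-! ### Positions of markings and heights of seams -/

section Points

variable (S : NodalQuiltedDisk n)

theorem leafPoint_eq {v : Fin S.tree.m} {a : S.tree.InEdge} {i : Fin n} (ha : S.tree.target a = v)
    (hi : S.tree.Carries a i) : S.leafPoint v i = S.inc a := by
  have h : ∃ a, S.tree.target a = v ∧ S.tree.Carries a i := ⟨a, ha, hi⟩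
  rw [leafPoint, dif_pos h, inEdge_unique (h.choose_spec.1.trans ha.symm) h.choose_spec.2 hi]

theorem leafPoint_of_not_below {v : Fin S.tree.m} {i : Fin n}
    (h : ¬ S.tree.Below (S.tree.leaf i) v) : S.leafPoint v i = S.out v := by
  rw [leafPoint, dif_neg]
  rintro ⟨a, rfl, hi⟩
  exact h hi.below

theorem leafPoint_ne_out {v : Fin S.tree.m} {i : Fin n} (h : S.tree.Below (S.tree.leaf i) v) :
    S.leafPoint v i ≠ S.out v := by
  obtain ⟨a, rfl, ha⟩ := exists_inEdge h
  rw [S.leafPoint_eq rfl ha]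
  exact S.inc_ne_out a

/-- Leaves beyond `v` that do not meet at `v` reach it through the same incoming edge. -/
theorem leafPoint_eq_of_meet_ne {v : Fin S.tree.m} {i j : Fin n}
    (hi : S.tree.Below (S.tree.leaf i) v) (hj : S.tree.Below (S.tree.leaf j) v)
    (h : S.tree.meet i j ≠ v) : S.leafPoint v i = S.leafPoint v j := by
  obtain ⟨a, ha, hai⟩ := exists_inEdge hi
  obtain ⟨b, hb, hbj⟩ := exists_inEdge hj
  have hab : a = b := by
    by_contra hab
    exact h (Meets.eq_meet ⟨a, b, hab, ha, hb, hai, hbj⟩)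
  rw [S.leafPoint_eq ha hai, S.leafPoint_eq hb hbj, hab]

/-- The half-plane coordinate of a marking. -/
noncomputable def pos (v : Fin S.tree.m) (i : Fin n) : ℝ := (S.halfPlane v (S.leafPoint v i)).re

theorem gap_eq (v : Fin S.tree.m) (i : Fin (n - 1)) :
    S.gap v i = S.pos v (upperLeaf i) - S.pos v (lowerLeaf i) := rfl

theorem pos_lt {v : Fin S.tree.m} {i j : Fin n} (hij : i < j) (h : S.tree.meet i j = v) :
    S.pos v i < S.pos v j := by
  obtain ⟨a, b, hab, ha, hb, hai, hbj⟩ := meets_meet (T := S.tree) hij.ne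
  rw [h] at ha hb
  subst ha
  have h1 := S.ordered a b i j hab hb.symm hai hbj hij
  rw [counterclockwise_iff (S.inc_ne_out a) (hb ▸ S.inc_ne_out b)] at h1
  rw [pos, pos, S.leafPoint_eq rfl hai, S.leafPoint_eq hb hbj]
  exact h1

theorem boundaryPoint_pos {v : Fin S.tree.m} {i : Fin n} (h : S.tree.Below (S.tree.leaf i) v) :
    boundaryPoint (S.out v) (S.pos v i) = S.leafPoint v i :=
  boundaryPoint_toHalfPlane (S.leafPoint_ne_out h)

theorem toHalfPlane_leafPoint (v : Fin S.tree.m) (i : Fin n) :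
    toHalfPlane (S.out v) (S.leafPoint v i) = S.pos v i :=
  (toHalfPlane_circle _ _).symm

theorem gap_pos {v : Fin S.tree.m} {i : Fin (n - 1)} (h : S.tree.gapVertex i = v) :
    0 < S.gap v i := sub_pos.2 (S.pos_lt (lowerLeaf_lt_upperLeaf i) h)

theorem gap_eq_zero {v : Fin S.tree.m} {i : Fin (n - 1)} (h : S.tree.Below (S.tree.gapVertex i) v)
    (hne : S.tree.gapVertex i ≠ v) : S.gap v i = 0 := by
  rw [gap_eq, sub_eq_zero, pos, pos, S.leafPoint_eq_of_meet_ne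
    ((lower_below_gapVertex i).trans h) ((upper_below_gapVertex i).trans h) hne]

theorem gap_nonneg {v : Fin S.tree.m} {i : Fin (n - 1)} (h : S.tree.Below (S.tree.gapVertex i) v) :
    0 ≤ S.gap v i := by
  by_cases hv : S.tree.gapVertex i = v
  · exact (S.gap_pos hv).le
  · exact (S.gap_eq_zero h hv).ge

theorem gap_pos_iff {v : Fin S.tree.m} {i : Fin (n - 1)}
    (h : S.tree.Below (S.tree.gapVertex i) v) : 0 < S.gap v i ↔ S.tree.gapVertex i = v := by
  refine ⟨fun h1 => ?_, S.gap_pos⟩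
  by_contra h2
  exact h1.ne' (S.gap_eq_zero h h2)

/-- The point of the seam opposite to the special point on the root side. -/
noncomputable def seamPoint (c : {v // v ∈ S.tree.col}) : ℂ :=
  ((1 - 2 * S.radius c : ℝ) : ℂ) * (S.out c.1 : ℂ)

theorem toHalfPlane_seamPoint (c : {v // v ∈ S.tree.col}) :
    toHalfPlane (S.out c.1) (S.seamPoint c) = ((1 - S.radius c) / S.radius c : ℝ) * Complex.I := by
  have hr : ((S.radius c : ℝ) : ℂ) ≠ 0 := by exact_mod_cast (S.radius_mem c).1.ne'
  have hu := Circle.coe_ne_zero (S.out c.1)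
  rw [toHalfPlane, seamPoint]
  push_cast
  have h1 : (S.out c.1 : ℂ) - (1 - 2 * (S.radius c : ℂ)) * S.out c.1 =
      2 * (S.radius c : ℂ) * S.out c.1 := by ring
  rw [h1]
  field_simp
  ring

theorem height_eq (c : {v // v ∈ S.tree.col}) : S.height c = (1 - S.radius c) / S.radius c := by
  show (toHalfPlane (S.out c.1) (S.seamPoint c)).im = _
  rw [toHalfPlane_seamPoint, Complex.im_ofReal_mul, Complex.I_im, mul_one]

theorem toHalfPlane_seamPoint' (c : {v // v ∈ S.tree.col}) :
    toHalfPlane (S.out c.1) (S.seamPoint c) = (S.height c : ℝ) * Complex.I := by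
  rw [toHalfPlane_seamPoint, height_eq]

theorem height_pos (c : {v // v ∈ S.tree.col}) : 0 < S.height c := by
  rw [height_eq]
  exact div_pos (sub_pos.2 (S.radius_mem c).2) (S.radius_mem c).1

/-- A circle tangent at the point that is sent to infinity becomes a horizontal line; radius `r`
corresponds to height `(1 - r) / r`. -/
theorem mem_seam_iff (c : {v // v ∈ S.tree.col}) {z : ℂ} (hz : z ≠ S.out c.1) :
    z ∈ S.seam c ↔ (toHalfPlane (S.out c.1) z).im = S.height c := by
  have hr := (S.radius_mem c).1
  have hu : ((S.out c.1 : Circle) : ℂ).re * ((S.out c.1 : Circle) : ℂ).re +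
      ((S.out c.1 : Circle) : ℂ).im * ((S.out c.1 : Circle) : ℂ).im = 1 := by
    rw [← Complex.normSq_apply, Complex.normSq_eq_norm_sq, Circle.norm_coe, one_pow]
  have hd := normSq_sub_pos hz
  rw [height_eq, im_toHalfPlane, div_eq_div_iff hd.ne' hr.ne', seam, mem_sphere_iff_norm,
    ← sq_eq_sq₀ (norm_nonneg _) hr.le, ← Complex.normSq_eq_norm_sq]
  simp only [Complex.normSq_apply, Complex.sub_re, Complex.sub_im, Complex.mul_re, Complex.mul_im,
    Complex.ofReal_re, Complex.ofReal_im, zero_mul, sub_zero, add_zero]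
  constructor
  · intro h
    linear_combination (-1 : ℝ) * h + ((1 - S.radius c) ^ 2 - (1 - S.radius c)) * hu
  · intro h
    linear_combination (-1 : ℝ) * h + ((1 - S.radius c) ^ 2 - (1 - S.radius c)) * hu

theorem out_mem_seam (c : {v // v ∈ S.tree.col}) : (S.out c.1 : ℂ) ∈ S.seam c := by
  rw [seam, mem_sphere_iff_norm]
  have : (S.out c.1 : ℂ) - ((1 - S.radius c : ℝ) : ℂ) * S.out c.1 =
      (S.radius c : ℂ) * S.out c.1 := by
    push_cast
    ring
  rw [this, norm_mul, Circle.norm_coe, mul_one, Complex.norm_real, Real.norm_eq_abs,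
    abs_of_pos (S.radius_mem c).1]

theorem seamPoint_ne (c : {v // v ∈ S.tree.col}) : S.seamPoint c ≠ S.out c.1 := by
  intro h
  have hr : ((S.radius c : ℝ) : ℂ) ≠ 0 := by exact_mod_cast (S.radius_mem c).1.ne'
  rw [seamPoint, mul_eq_right₀ (Circle.coe_ne_zero _)] at h
  push_cast at h
  apply hr
  linear_combination (-1 / 2 : ℂ) * h

theorem seamPoint_mem_seam (c : {v // v ∈ S.tree.col}) : S.seamPoint c ∈ S.seam c := by
  rw [mem_seam_iff S c (S.seamPoint_ne c), toHalfPlane_seamPoint']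
  simp

end Points

/-! ### The invariant of quilted disks -/

section Scale

variable (S : NodalQuiltedDisk n)

open Classical in
/-- The largest gap between two leaves, on the component where they meet. -/
noncomputable def scale (a b : Fin n) : ℝ :=
  (((Finset.univ.filter fun i => GapIn a b i).sup
    fun i => (S.gap (S.tree.meet a b) i).toNNReal : NNReal) : ℝ)

theorem gap_le_scale {a b : Fin n} {i : Fin (n - 1)} (h : GapIn a b i) :
    S.gap (S.tree.meet a b) i ≤ S.scale a b := by
  classical
  have : (S.gap (S.tree.meet a b) i).toNNReal ≤ _ :=
    Finset.le_sup (f := fun i => (S.gap (S.tree.meet a b) i).toNNReal)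
      (show i ∈ Finset.univ.filter fun i => GapIn a b i by simpa using h)
  exact (Real.le_coe_toNNReal _).trans this

theorem scale_eq {a b : Fin n} {i : Fin (n - 1)} (h : GapIn a b i)
    (hmax : ∀ j, GapIn a b j → S.gap (S.tree.meet a b) j ≤ S.gap (S.tree.meet a b) i) :
    S.scale a b = S.gap (S.tree.meet a b) i := by
  classical
  refine le_antisymm ?_ (S.gap_le_scale h)
  rw [scale, ← Real.coe_toNNReal _ (S.gap_nonneg h.gapVertex_below_meet), NNReal.coe_le_coe]
  refine Finset.sup_le fun j hj => Real.toNNReal_le_toNNReal (hmax j (by simpa using hj))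

theorem exists_gap_eq_scale {a b : Fin n} (h : a < b) :
    ∃ i, GapIn a b i ∧ S.gap (S.tree.meet a b) i = S.scale a b := by
  classical
  obtain ⟨i₀, h0, -⟩ := exists_gapVertex_eq_meet (T := S.tree) h
  obtain ⟨i, hi, hmax⟩ := Finset.exists_max_image (Finset.univ.filter fun i => GapIn a b i)
    (fun i => S.gap (S.tree.meet a b) i) ⟨i₀, by simpa using h0⟩
  simp only [Finset.mem_filter, Finset.mem_univ, true_and] at hi hmax
  exact ⟨i, hi, (S.scale_eq hi hmax).symm⟩

theorem scale_pos {a b : Fin n} (h : a < b) : 0 < S.scale a b := by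
  obtain ⟨i, hi, h1⟩ := exists_gapVertex_eq_meet (T := S.tree) h
  exact (S.gap_pos h1).trans_le (S.gap_le_scale hi)

open Classical in
/-- The relative sizes of the gaps and of the seam heights of a nodal quilted disk. -/
noncomputable def diskData : Data n :=
  (fun a b i => if GapIn a b i then S.gap (S.tree.meet a b) i / S.scale a b else 0,
    fun a b => if a < b then
      if h : S.tree.meet a b ∈ S.tree.col then min 1 (S.height ⟨_, h⟩ / S.scale a b)
      else if S.tree.Below (S.tree.meet a b) (S.tree.cv a) then 1 else 0
      else 0,
    fun a b => if a < b then
      if h : S.tree.meet a b ∈ S.tree.col then min 1 (S.scale a b / S.height ⟨_, h⟩)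
      else if S.tree.Below (S.tree.meet a b) (S.tree.cv a) then 0 else 1
      else 0)

variable {S} {a b : Fin n}

theorem diskData_gap {i : Fin (n - 1)} (h : GapIn a b i) :
    S.diskData.1 a b i = S.gap (S.tree.meet a b) i / S.scale a b := by
  classical
  exact if_pos h

theorem diskData_low_of_col (hab : a < b) (h : S.tree.meet a b ∈ S.tree.col) :
    S.diskData.2.1 a b = min 1 (S.height ⟨_, h⟩ / S.scale a b) := by
  classical
  exact (if_pos hab).trans (dif_pos h)

theorem diskData_high_of_col (hab : a < b) (h : S.tree.meet a b ∈ S.tree.col) :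
    S.diskData.2.2 a b = min 1 (S.scale a b / S.height ⟨_, h⟩) := by
  classical
  exact (if_pos hab).trans (dif_pos h)

theorem diskData_low_of_below (hab : a < b) (h : S.tree.meet a b ∉ S.tree.col)
    (h' : S.tree.Below (S.tree.meet a b) (S.tree.cv a)) : S.diskData.2.1 a b = 1 := by
  classical
  exact (if_pos hab).trans ((dif_neg h).trans (if_pos h'))

theorem diskData_high_of_below (hab : a < b) (h : S.tree.meet a b ∉ S.tree.col)
    (h' : S.tree.Below (S.tree.meet a b) (S.tree.cv a)) : S.diskData.2.2 a b = 0 := by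
  classical
  exact (if_pos hab).trans ((dif_neg h).trans (if_pos h'))

theorem diskData_low_of_not_below (hab : a < b)
    (h' : ¬ S.tree.Below (S.tree.meet a b) (S.tree.cv a)) : S.diskData.2.1 a b = 0 := by
  classical
  refine (if_pos hab).trans ((dif_neg fun h => h' ?_).trans (if_neg h'))
  rw [eq_cv h (leaf_below_meet_left hab.ne)]
  exact Below.refl _ _

theorem diskData_high_of_not_below (hab : a < b)
    (h' : ¬ S.tree.Below (S.tree.meet a b) (S.tree.cv a)) : S.diskData.2.2 a b = 1 := by
  classical
  refine (if_pos hab).trans ((dif_neg fun h => h' ?_).trans (if_neg h'))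
  rw [eq_cv h (leaf_below_meet_left hab.ne)]
  exact Below.refl _ _

/-- With the two analogous statements for the colour entries, the positive entries of the data
determine the combinatorial type. -/
theorem diskData_gap_pos_iff {i : Fin (n - 1)} (h : GapIn a b i) :
    0 < S.diskData.1 a b i ↔ S.tree.gapVertex i = S.tree.meet a b := by
  rw [diskData_gap h, div_pos_iff_of_pos_right (S.scale_pos h.lt),
    S.gap_pos_iff h.gapVertex_below_meet]

theorem diskData_low_pos_iff (hab : a < b) :
    0 < S.diskData.2.1 a b ↔ S.tree.Below (S.tree.meet a b) (S.tree.cv a) := by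
  by_cases h : S.tree.Below (S.tree.meet a b) (S.tree.cv a)
  · refine iff_of_true ?_ h
    by_cases hc : S.tree.meet a b ∈ S.tree.col
    · rw [diskData_low_of_col hab hc]
      exact lt_min one_pos (div_pos (S.height_pos _) (S.scale_pos hab))
    · rw [diskData_low_of_below hab hc h]
      exact one_pos
  · rw [diskData_low_of_not_below hab h]
    exact iff_of_false (lt_irrefl _) h

theorem diskData_high_pos_iff (hab : a < b) :
    0 < S.diskData.2.2 a b ↔ S.tree.Below (S.tree.cv a) (S.tree.meet a b) := by
  by_cases hc : S.tree.meet a b ∈ S.tree.col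
  · rw [diskData_high_of_col hab hc]
    refine iff_of_true (lt_min one_pos (div_pos (S.scale_pos hab) (S.height_pos _))) ?_
    rw [eq_cv hc (leaf_below_meet_left hab.ne)]
    exact Below.refl _ _
  by_cases h : S.tree.Below (S.tree.meet a b) (S.tree.cv a)
  · rw [diskData_high_of_below hab hc h]
    refine iff_of_false (lt_irrefl _) fun h' => hc ?_
    rw [h.antisymm h']
    exact cv_mem a
  · rw [diskData_high_of_not_below hab h]
    exact iff_of_true one_pos ((cv_below_or (leaf_below_meet_left hab.ne)).resolve_right h)

end Scale

/-! ### Isomorphism is equality of relative sizes -/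

section Isomorphisms

variable {S S' : NodalQuiltedDisk n}

/-- The components of two nodal quilted disks agree up to real affine maps. -/
def Scaled (S S' : NodalQuiltedDisk n) : Prop :=
  ∃ σ, S.tree.IsIso S'.tree σ ∧ ∀ v, ∃ α : ℝ, 0 < α ∧
    (∀ i, S.tree.Below (S.tree.gapVertex i) v → S'.gap (σ v) i = α * S.gap v i) ∧
    ∀ (h : v ∈ S.tree.col) (h' : σ v ∈ S'.tree.col), S'.height ⟨σ v, h'⟩ = α * S.height ⟨v, h⟩

/-- Every entry is a ratio of sizes on one component, so the factor of that component cancels. -/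
theorem Scaled.diskData_eq (h : Scaled S S') : S.diskData = S'.diskData := by
  classical
  obtain ⟨σ, hσ, hs⟩ := h
  have hm := hσ.isMorphism
  have key : ∀ a b, a < b → ∃ α : ℝ, 0 < α ∧ S'.scale a b = α * S.scale a b ∧
      (∀ i, GapIn a b i → S'.gap (S'.tree.meet a b) i = α * S.gap (S.tree.meet a b) i) ∧
      ∀ (h : S.tree.meet a b ∈ S.tree.col) (h' : S'.tree.meet a b ∈ S'.tree.col),
        S'.height ⟨_, h'⟩ = α * S.height ⟨_, h⟩ := by
    intro a b hab
    obtain ⟨α, hα, h1, h2⟩ := hs (S.tree.meet a b)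
    rw [hm.map_meet hab.ne] at h1
    have h3 : ∀ i, GapIn a b i → S'.gap (S'.tree.meet a b) i = α * S.gap (S.tree.meet a b) i :=
      fun i hi => h1 i hi.gapVertex_below_meet
    refine ⟨α, hα, ?_, h3, ?_⟩
    · obtain ⟨i, hi, hi'⟩ := S.exists_gap_eq_scale hab
      rw [← hi', ← h3 i hi]
      refine S'.scale_eq hi fun j hj => ?_
      rw [h3 i hi, h3 j hj, hi']
      exact mul_le_mul_of_nonneg_left (S.gap_le_scale hj) hα.le
    · intro h h'
      have h4 := h2 h ((hσ.col _).2 h)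
      have h5 : (⟨σ (S.tree.meet a b), (hσ.col _).2 h⟩ : {v // v ∈ S'.tree.col}) =
        ⟨S'.tree.meet a b, h'⟩ := Subtype.ext (hm.map_meet hab.ne)
      rwa [h5] at h4
  have hcol : ∀ a b, a < b → (S.tree.meet a b ∈ S.tree.col ↔ S'.tree.meet a b ∈ S'.tree.col) := by
    intro a b hab
    rw [← hm.map_meet hab.ne, hσ.col]
  have hbel : ∀ a b, a < b → (S.tree.Below (S.tree.meet a b) (S.tree.cv a) ↔
      S'.tree.Below (S'.tree.meet a b) (S'.tree.cv a)) := by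
    intro a b hab
    rw [← hm.map_meet hab.ne, ← hm.map_cv]
    refine ⟨hm.mono, fun h => ?_⟩
    have := hσ.symm.isMorphism.mono h
    rwa [σ.symm_apply_apply, σ.symm_apply_apply] at this
  refine Prod.ext ?_ (Prod.ext ?_ ?_)
  · funext a b i
    by_cases hi : GapIn a b i
    · obtain ⟨α, hα, h1, h2, -⟩ := key a b hi.lt
      rw [diskData_gap hi, diskData_gap hi, h1, h2 i hi, mul_div_mul_left _ _ hα.ne']
    · simp [diskData, hi]
  · funext a b
    by_cases hab : a < b
    · obtain ⟨α, hα, h1, -, h3⟩ := key a b hab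
      by_cases hc : S.tree.meet a b ∈ S.tree.col
      · rw [diskData_low_of_col hab hc, diskData_low_of_col hab ((hcol a b hab).1 hc), h1, h3 hc,
          mul_div_mul_left _ _ hα.ne']
      · simp only [diskData, hab, if_true, dif_neg hc, dif_neg (mt (hcol a b hab).2 hc),
          hbel a b hab]
    · simp [diskData, hab]
  · funext a b
    by_cases hab : a < b
    · obtain ⟨α, hα, h1, -, h3⟩ := key a b hab
      by_cases hc : S.tree.meet a b ∈ S.tree.col
      · rw [diskData_high_of_col hab hc, diskData_high_of_col hab ((hcol a b hab).1 hc), h1, h3 hc,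
          mul_div_mul_left _ _ hα.ne']
      · simp only [diskData, hab, if_true, dif_neg hc, dif_neg (mt (hcol a b hab).2 hc),
          hbel a b hab]
    · simp [diskData, hab]

theorem exists_extreme_leaves (T : ColoredTree n) (v : Fin T.m) : ∃ a b, T.Below (T.leaf a) v ∧
    T.Below (T.leaf b) v ∧ ∀ c, T.Below (T.leaf c) v → a ≤ c ∧ c ≤ b := by
  classical
  obtain ⟨x, hx⟩ := exists_leaf_below v
  obtain ⟨a, ha, ha'⟩ := Finset.exists_min_image (Finset.univ.filter fun i => T.Below (T.leaf i) v)
    id ⟨x, by simpa using hx⟩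
  obtain ⟨b, hb, hb'⟩ := Finset.exists_max_image (Finset.univ.filter fun i => T.Below (T.leaf i) v)
    id ⟨x, by simpa using hx⟩
  simp only [Finset.mem_filter, Finset.mem_univ, true_and, id] at ha ha' hb hb'
  exact ⟨a, b, ha, hb, fun c hc => ⟨ha' c hc, hb' c hc⟩⟩

/-- Truncating both a ratio and its inverse at 1 loses nothing, as at least one of them is at most
1. -/
theorem eq_of_min_eq {x y : ℝ} (h1 : min 1 x = min 1 y)
    (h2 : min 1 x⁻¹ = min 1 y⁻¹) : x = y := by
  rcases le_total x 1 with hx1 | hx1 <;> rcases le_total y 1 with hy1 | hy1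
  · rwa [min_eq_right hx1, min_eq_right hy1] at h1
  · rw [min_eq_right hx1, min_eq_left hy1] at h1
    rw [h1, min_eq_right (inv_le_one_of_one_le₀ hy1), inv_one, min_self] at h2
    rw [h1, ← inv_inv y, ← h2, inv_one]
  · rw [min_eq_left hx1, min_eq_right hy1] at h1
    rw [← h1, min_eq_right (inv_le_one_of_one_le₀ hx1), inv_one, min_self] at h2
    rw [← h1, ← inv_inv x, h2, inv_one]
  · rw [min_eq_right (inv_le_one_of_one_le₀ hx1), min_eq_right (inv_le_one_of_one_le₀ hy1)] at h2
    exact inv_injective h2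

theorem degenerates_of_diskData_eq (h : S.diskData = S'.diskData) :
    S.tree.Degenerates S'.tree where
  gap a b i hi h1 := by
    rwa [← diskData_gap_pos_iff hi, h, diskData_gap_pos_iff hi] at h1
  above a b hab h1 := by
    rwa [← diskData_high_pos_iff hab, h, diskData_high_pos_iff hab] at h1
  below a b hab h1 := by
    rwa [← diskData_low_pos_iff hab, h, diskData_low_pos_iff hab] at h1

/-- Equal data give degenerations in both directions and hence an isomorphism of trees. The scaling
factor of a component is the ratio of the largest gaps between its extreme leaves. -/
theorem scaled_of_diskData_eq (h : S.diskData = S'.diskData) : Scaled S S' := by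
  obtain ⟨f, hf⟩ := (degenerates_of_diskData_eq h).exists_isMorphism
  obtain ⟨g, hg⟩ := (degenerates_of_diskData_eq h.symm).exists_isMorphism
  obtain ⟨σ, hσ⟩ := hf.exists_isIso hg.card_le
  have hm := hσ.isMorphism
  refine ⟨σ, hσ, fun v => ?_⟩
  by_cases hv : ∃ i, S.tree.gapVertex i = v
  · obtain ⟨i₀, hi₀⟩ := hv
    obtain ⟨a, b, ha, hb, hext⟩ := exists_extreme_leaves S.tree v
    have hin : ∀ i, S.tree.Below (S.tree.gapVertex i) v → GapIn a b i := fun i hi =>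
      ⟨(hext _ ((lower_below_gapVertex i).trans hi)).1,
        (hext _ ((upper_below_gapVertex i).trans hi)).2⟩
    have h0 : GapIn a b i₀ := hin i₀ (hi₀ ▸ Below.refl _ _)
    have hab := h0.lt
    have hmeet : S.tree.meet a b = v := by
      rw [← hi₀] at ha hb ⊢
      exact (meet_eq_gapVertex_of_below h0 ha hb).symm
    have hs := S.scale_pos hab
    have hs' := S'.scale_pos hab
    refine ⟨S'.scale a b / S.scale a b, div_pos hs' hs, fun i hi => ?_, fun hc hc' => ?_⟩
    · have h1 := congrFun (congrFun (congrFun (congrArg Prod.fst h) a) b) i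
      rw [diskData_gap (hin i hi), diskData_gap (hin i hi), ← hm.map_meet hab.ne, hmeet,
        div_eq_div_iff hs.ne' hs'.ne'] at h1
      rw [div_mul_eq_mul_div, eq_div_iff hs.ne', ← h1, mul_comm]
    · subst hmeet
      have e1 : (⟨σ (S.tree.meet a b), hc'⟩ : {v // v ∈ S'.tree.col}) =
        ⟨S'.tree.meet a b, hm.map_meet hab.ne ▸ hc'⟩ := Subtype.ext (hm.map_meet hab.ne)
      rw [e1]
      have h1 : S.diskData.2.1 a b = S'.diskData.2.1 a b := by rw [h]
      have h2 : S.diskData.2.2 a b = S'.diskData.2.2 a b := by rw [h]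
      rw [diskData_low_of_col hab hc, diskData_low_of_col hab (hm.map_meet hab.ne ▸ hc')] at h1
      rw [diskData_high_of_col hab hc, diskData_high_of_col hab (hm.map_meet hab.ne ▸ hc'),
        ← inv_div, ← inv_div (S'.height _)] at h2
      have h3 := eq_of_min_eq h1 h2
      rw [div_eq_div_iff hs.ne' hs'.ne'] at h3
      rw [div_mul_eq_mul_div, eq_div_iff hs.ne', ← h3, mul_comm]
  -- A component without a gap of its own carries a seam: all gaps vanish on it and the factor is
  -- the ratio of the seam heights.
  · have hc : v ∈ S.tree.col := by
      by_contra hc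
      exact hv (exists_gapVertex hc)
    refine ⟨S'.height ⟨σ v, (hσ.col v).2 hc⟩ / S.height ⟨v, hc⟩,
      div_pos (S'.height_pos _) (S.height_pos _), fun i hi => ?_, fun _ _ => ?_⟩
    · have hne : S.tree.gapVertex i ≠ v := fun h => hv ⟨i, h⟩
      have hm' := hm.mono hi
      have hne' : S'.tree.gapVertex i ≠ σ v := by
        rw [← hm.map_gapVertex]
        exact fun h => hne (σ.injective h)
      rw [hm.map_gapVertex] at hm'
      rw [S.gap_eq_zero hi hne, S'.gap_eq_zero hm' hne', mul_zero]
    · rw [div_mul_cancel₀ _ (S.height_pos _).ne']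

theorem leafPoint_map {σ : Fin S.tree.m ≃ Fin S'.tree.m} (hσ : S.tree.IsIso S'.tree σ)
    {φ : Fin S.tree.m → ℂ → ℂ}
    (h3 : ∀ i, φ (S.tree.leaf i) (S.inc (.inr i)) = S'.inc (.inr i))
    (h4 : ∀ (e : S.tree.Edge) (e' : S'.tree.Edge), σ e.1 = e'.1 →
      φ (S.tree.parent e.1) (S.inc (.inl e)) = S'.inc (.inl e'))
    {v : Fin S.tree.m} {i : Fin n} (hi : S.tree.Below (S.tree.leaf i) v) :
    φ v (S.leafPoint v i) = S'.leafPoint (σ v) i := by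
  have hm := hσ.isMorphism
  obtain ⟨a, rfl, ha⟩ := exists_inEdge hi
  rw [S.leafPoint_eq rfl ha]
  rcases a with e | j
  · have hne : σ e.1 ≠ S'.tree.root := by
      rw [← hσ.root]
      exact fun h => e.2 (σ.injective h)
    show φ (S.tree.parent e.1) _ = ((S'.leafPoint (σ (S.tree.parent e.1)) i : Circle) : ℂ)
    rw [S'.leafPoint_eq (a := .inl ⟨σ e.1, hne⟩) (hσ.parent e.1).symm (hm.leaf_below_map ha)]
    exact h4 e _ rfl
  · have hj : j = i := ha
    subst hj
    show φ (S.tree.leaf j) _ = ((S'.leafPoint (σ (S.tree.leaf j)) j : Circle) : ℂ)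
    rw [S'.leafPoint_eq (a := .inr j) (hσ.leaf j).symm rfl]
    exact h3 j

/-- A component isomorphism is affine in half-plane coordinates; its translation part drops out of
gaps and heights. -/
theorem Iso.scaled (h : S.Iso S') : Scaled S S' := by
  obtain ⟨σ, hσ, φ, h1, h2, h3, h4, h5⟩ := h
  have hm := hσ.isMorphism
  refine ⟨σ, hσ, fun v => ?_⟩
  obtain ⟨α, β, hα, haff⟩ := (h1 v).exists_affine (h2 v)
  have hpos : ∀ i, S.tree.Below (S.tree.leaf i) v → S'.pos (σ v) i = α * S.pos v i + β := by
    intro i hi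
    have h6 := (haff _ (Circle.coe_mem_closedBall _)
      (fun h => S.leafPoint_ne_out hi (Circle.ext h))).2
    rw [leafPoint_map hσ h3 h4 hi, toHalfPlane_leafPoint, toHalfPlane_leafPoint] at h6
    exact_mod_cast h6
  refine ⟨α, hα, fun i hi => ?_, fun h h' => ?_⟩
  · rw [gap_eq, gap_eq, hpos _ ((upper_below_gapVertex i).trans hi),
      hpos _ ((lower_below_gapVertex i).trans hi)]
    ring
  · have h6 := haff _ (S.seam_subset ⟨v, h⟩ (S.seamPoint_mem_seam ⟨v, h⟩)) (S.seamPoint_ne ⟨v, h⟩)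
    have h7 : φ v (S.seamPoint ⟨v, h⟩) ∈ S'.seam ⟨σ v, h'⟩ := by
      rw [← h5 ⟨v, h⟩ ⟨σ v, h'⟩ rfl]
      exact ⟨_, S.seamPoint_mem_seam _, rfl⟩
    rw [S'.mem_seam_iff _ h6.1, h6.2, S.toHalfPlane_seamPoint' ⟨v, h⟩] at h7
    rw [← h7]
    simp

/-- Differences of positions are sums of gaps, so relations between gaps extend to arbitrary pairs
of leaves. -/
theorem telescope {g g' : Fin n → ℝ} {α : ℝ} {a b : Fin n} (hab : a ≤ b)
    (h : ∀ i, GapIn a b i →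
      g' (upperLeaf i) - g' (lowerLeaf i) = α * (g (upperLeaf i) - g (lowerLeaf i))) :
    g' b - g' a = α * (g b - g a) := by
  obtain ⟨b, hb⟩ := b
  induction b with
  | zero =>
    have : a = ⟨0, hb⟩ := Fin.ext (Nat.le_zero.1 hab)
    simp [this]
  | succ b ih =>
    by_cases hlt : a.1 ≤ b
    · have h1 := ih (Nat.lt_of_succ_lt hb) hlt fun i hi => h i
        ⟨hi.1, hi.2.trans (Nat.le_succ b)⟩
      have h2 := h ⟨b, by omega⟩ (gapIn_iff.2 ⟨hlt, Nat.lt_succ_self b⟩)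
      simp only [upperLeaf, lowerLeaf] at h2
      linarith
    · have hab' : a.1 ≤ b + 1 := hab
      have : a = ⟨b + 1, hb⟩ := Fin.ext (by simp only; omega)
      simp [this]

/-- The translation part on each component is chosen to match one marking beyond it; the others then
match because the gaps do, and the seams because the heights do. -/
theorem Scaled.iso (h : Scaled S S') : S.Iso S' := by
  obtain ⟨σ, hσ, hs⟩ := h
  have hm := hσ.isMorphism
  choose α hα hgap hheight using hs
  choose x hx using fun v : Fin S.tree.m => exists_leaf_below v
  let β : Fin S.tree.m → ℝ := fun v => S'.pos (σ v) (x v) - α v * S.pos v (x v)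
  have hpos : ∀ v i, S.tree.Below (S.tree.leaf i) v → S'.pos (σ v) i = α v * S.pos v i + β v := by
    intro v i hi
    have key : ∀ a b, a ≤ b → S.tree.Below (S.tree.leaf a) v → S.tree.Below (S.tree.leaf b) v →
        S'.pos (σ v) b - S'.pos (σ v) a = α v * (S.pos v b - S.pos v a) := fun a b hab ha hb =>
      telescope hab fun k hk => hgap v k (hk.gapVertex_below ha hb)
    rcases le_total i (x v) with h1 | h1
    · linarith [key i (x v) h1 hi (hx v)]
    · linarith [key (x v) i h1 (hx v) hi]
  let φ : Fin S.tree.m → ℂ → ℂ := fun v => affineDisk (S.out v) (S'.out (σ v)) (α v) (β v)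
  have hφ : ∀ v i, S.tree.Below (S.tree.leaf i) v →
      φ v (S.leafPoint v i) = S'.leafPoint (σ v) i := by
    intro v i hi
    have hi' : S'.tree.Below (S'.tree.leaf i) (σ v) := hm.leaf_below_map hi
    rw [← S'.boundaryPoint_pos hi', hpos v i hi, coe_boundaryPoint]
    show affineDisk _ _ _ _ _ = _
    rw [affineDisk_of_ne fun h => S.leafPoint_ne_out hi (Circle.ext h), toHalfPlane_leafPoint]
    push_cast
    rfl
  refine ⟨σ, hσ, φ, fun v => isDiskIso_affineDisk (hα v), fun v => affineDisk_self (hα v), ?_, ?_, ?_⟩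
  · intro i
    have h := hφ (S.tree.leaf i) i (Below.refl _ _)
    rwa [S.leafPoint_eq (v := S.tree.leaf i) (a := .inr i) rfl rfl,
      S'.leafPoint_eq (a := .inr i) (hσ.leaf i).symm rfl] at h
  · intro e e' he
    obtain ⟨i, hi⟩ := exists_leaf_below e.1
    have h := hφ (S.tree.parent e.1) i (hi.trans (below_parent _))
    rwa [S.leafPoint_eq (v := S.tree.parent e.1) (a := .inl e) rfl hi, S'.leafPoint_eq (a := .inl e')
      (by rw [hσ.parent, he]; rfl) (he ▸ hm.leaf_below_map hi :)] at h
  · rintro ⟨v, hv⟩ ⟨v', hv'⟩ (hvv : σ v = v')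
    subst hvv
    have key : ∀ z ∈ Metric.closedBall (0 : ℂ) 1, z ∈ S.seam ⟨v, hv⟩ ↔
        φ v z ∈ S'.seam ⟨σ v, hv'⟩ := by
      intro z hz
      by_cases hzu : z = S.out v
      · have h1 : φ v z = S'.out (σ v) := hzu ▸ affineDisk_self (hα v)
        rw [hzu]
        refine iff_of_true (S.out_mem_seam ⟨v, hv⟩) ?_
        rw [← hzu, h1]
        exact S'.out_mem_seam ⟨σ v, hv'⟩
      · rw [S.mem_seam_iff ⟨v, hv⟩ hzu,
          S'.mem_seam_iff ⟨σ v, hv'⟩ (affineDisk_ne (hα v) hz hzu)]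
        show _ ↔ (toHalfPlane _ (affineDisk _ _ _ _ _)).im = _
        rw [toHalfPlane_affineDisk (hα v) hz hzu, hheight v hv hv']
        simp [(hα v).ne']
    ext z
    constructor
    · rintro ⟨w, hw, rfl⟩
      exact (key w (S.seam_subset _ hw)).1 hw
    · intro hz
      obtain ⟨ψ, -, hψ, -, hinv⟩ := isDiskIso_affineDisk (u := S.out v) (u' := S'.out (σ v))
        (β := β v) (hα v)
      have hz' := S'.seam_subset _ hz
      refine ⟨ψ z, (key _ (hψ.2.2 hz')).2 ?_, hinv hz'⟩
      rw [show φ v (ψ z) = z from hinv hz']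
      exact hz

theorem iso_iff_diskData_eq : S.Iso S' ↔ S.diskData = S'.diskData :=
  ⟨fun h => h.scaled.diskData_eq, fun h => (scaled_of_diskData_eq h).iso⟩

end Isomorphisms

end NodalQuiltedDisk


open ColoredTree

namespace NodalQuiltedDisk

variable {n : ℕ}

/-! ### Disks with prescribed gaps and heights -/

section OfSizes

variable (T : ColoredTree n) (x : Fin (n - 1) → ℝ) (y : Fin T.m → ℝ)

open Classical in
/-- The coordinate of a leaf on the component of `v`, for given sizes of the gaps. -/
noncomputable def coord (v : Fin T.m) (l : Fin n) : ℝ :=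
  ∑ i ∈ Finset.univ.filter (fun i => lowerLeaf i < l ∧ T.gapVertex i = v), x i

variable {T x}

/-- A gap between two leaves on one incoming edge has its vertex strictly beyond the end of that
edge, so it contributes nothing there. -/
theorem coord_eq_of_carries {a : T.InEdge} {i j : Fin n} (hij : i < j) (hi : T.Carries a i)
    (hj : T.Carries a j) : coord T x (T.target a) i = coord T x (T.target a) j := by
  classical
  refine Finset.sum_congr (Finset.filter_congr fun k _ => ?_) fun _ _ => rfl
  refine ⟨fun h => ⟨h.1.trans hij, h.2⟩, fun h => ⟨?_, h.2⟩⟩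
  by_contra hk
  have hg : GapIn i j k := ⟨not_lt.1 hk, Nat.succ_le_of_lt h.1⟩
  rcases a with e | l
  · have h1 : T.Below (T.gapVertex k) e.1 := hg.gapVertex_below hi hj
    rw [h.2] at h1
    exact parent_ne e.2 (Below.antisymm h1 (below_parent e.1))
  · exact hij.ne ((show l = i from hi).symm.trans (show l = j from hj))

theorem coord_lt (hx : ∀ i, 0 < x i) {a b : T.InEdge} (hab : a ≠ b) (ht : T.target a = T.target b)
    {i j : Fin n} (hij : i < j) (hi : T.Carries a i) (hj : T.Carries b j) :
    coord T x (T.target a) i < coord T x (T.target a) j := by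
  classical
  obtain ⟨k, hk, hk', -⟩ := exists_gap_of_inEdges hab ht hi hj hij
  refine Finset.sum_lt_sum_of_subset (i := k) ?_ ?_ ?_ (hx k) fun l _ _ => (hx l).le
  · intro l hl
    simp only [Finset.mem_filter, Finset.mem_univ, true_and] at hl ⊢
    exact ⟨hl.1.trans hij, hl.2⟩
  · simp only [Finset.mem_filter, Finset.mem_univ, true_and]
    exact ⟨(lowerLeaf_lt_upperLeaf k).trans_le hk.2, hk'⟩
  · simp only [Finset.mem_filter, Finset.mem_univ, true_and, not_and]
    exact fun h => absurd h (not_lt.2 hk.1)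

theorem coord_upper (i : Fin (n - 1)) : coord T x (T.gapVertex i) (upperLeaf i) =
    coord T x (T.gapVertex i) (lowerLeaf i) + x i := by
  classical
  rw [coord, coord, add_comm]
  have : (Finset.univ.filter fun j => lowerLeaf j < upperLeaf i ∧ T.gapVertex j = T.gapVertex i) =
      insert i (Finset.univ.filter fun j => lowerLeaf j < lowerLeaf i ∧
        T.gapVertex j = T.gapVertex i) := by
    ext j
    simp only [Finset.mem_filter, Finset.mem_univ, true_and, Finset.mem_insert]
    have h1 : lowerLeaf j < upperLeaf i ↔ j = i ∨ lowerLeaf j < lowerLeaf i := by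
      simp only [lowerLeaf, upperLeaf, Fin.lt_def, Fin.ext_iff]
      omega
    rw [h1]
    constructor
    · rintro ⟨h | h, h'⟩
      · exact Or.inl h
      · exact Or.inr ⟨h, h'⟩
    · rintro (rfl | h)
      · exact ⟨Or.inl rfl, rfl⟩
      · exact ⟨Or.inr h.1, h.2⟩
  rw [this, Finset.sum_insert (by simp)]

variable (T x)

/-- The nodal quilted disk of type `T` with given gaps and seam heights. -/
noncomputable def ofSizes (hx : ∀ i, 0 < x i) (hy : ∀ v, 0 < y v) : NodalQuiltedDisk n where
  tree := T
  out _ := 1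
  inc a := boundaryPoint 1 (coord T x (T.target a) (exists_carries a).choose)
  inc_ne_out _ := boundaryPoint_ne _ _
  inc_ne_inc a b ht hab h := by
    have h1 := congrArg (fun p : Circle => (toHalfPlane (1 : Circle) p).re) h
    simp only [toHalfPlane_boundaryPoint, Complex.ofReal_re] at h1
    have ha := (exists_carries a).choose_spec
    have hb := (exists_carries b).choose_spec
    rcases lt_trichotomy (exists_carries a).choose (exists_carries b).choose with hlt | heq | hlt
    · have := coord_lt hx hab ht hlt ha hb
      rw [h1, ht] at this
      exact lt_irrefl _ this
    · exact hab (inEdge_unique ht ha (heq ▸ hb))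
    · have := coord_lt hx hab.symm ht.symm hlt hb ha
      rw [← h1, ht] at this
      exact lt_irrefl _ this
  ordered a b i j hab ht hi hj hij := by
    rw [counterclockwise_boundaryPoint, ← ht]
    have key : ∀ (a : T.InEdge) (i : Fin n), T.Carries a i →
        coord T x (T.target a) (exists_carries a).choose = coord T x (T.target a) i := by
      intro a i hi
      have ha := (exists_carries a).choose_spec
      rcases lt_trichotomy (exists_carries a).choose i with h | h | h
      · exact coord_eq_of_carries h ha hi
      · rw [h]
      · exact (coord_eq_of_carries h hi ha).symm
    rw [key a i hi, ht, key b j hj, ← ht]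
    exact coord_lt hx hab ht hij hi hj
  -- This radius solves `(1 - r) / r = y`.
  radius v := (1 + y v.1)⁻¹
  radius_mem v := ⟨inv_pos.2 (by linarith [hy v.1]), inv_lt_one_of_one_lt₀ (by linarith [hy v.1])⟩

variable {T x y} (hx : ∀ i, 0 < x i) (hy : ∀ v, 0 < y v)

theorem pos_ofSizes {v : Fin T.m} {i : Fin n} (hi : T.Below (T.leaf i) v) :
    (ofSizes T x y hx hy).pos v i = coord T x v i := by
  obtain ⟨a, rfl, ha⟩ := exists_inEdge hi
  have h1 : toHalfPlane (1 : Circle)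
      (boundaryPoint 1 (coord T x (T.target a) (exists_carries a).choose)) = _ :=
    toHalfPlane_boundaryPoint _ _
  have h2 : (ofSizes T x y hx hy).leafPoint (T.target a) i = _ :=
    (ofSizes T x y hx hy).leafPoint_eq (a := a) rfl ha
  refine (congrArg (fun p : Circle => (toHalfPlane (1 : Circle) p).re) h2).trans
    ((congrArg Complex.re h1).trans ?_)
  rw [Complex.ofReal_re]
  have ha' := (exists_carries a).choose_spec
  rcases lt_trichotomy (exists_carries a).choose i with h | h | h
  · exact coord_eq_of_carries h ha' ha
  · rw [h]
  · exact (coord_eq_of_carries h ha ha').symm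

theorem gap_ofSizes (i : Fin (n - 1)) :
    (ofSizes T x y hx hy).gap (T.gapVertex i) i = x i := by
  refine ((ofSizes T x y hx hy).gap_eq (T.gapVertex i) i).trans ?_
  refine (congrArg₂ (· - ·) (pos_ofSizes hx hy (upper_below_gapVertex i))
    (pos_ofSizes hx hy (lower_below_gapVertex i))).trans ?_
  rw [coord_upper, add_sub_cancel_left]

theorem height_ofSizes (c : {v // v ∈ T.col}) : (ofSizes T x y hx hy).height c = y c.1 := by
  have h : (1 + y c.1) ≠ 0 := by linarith [hy c.1]
  refine ((ofSizes T x y hx hy).height_eq c).trans ?_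
  show (1 - (1 + y c.1)⁻¹) / (1 + y c.1)⁻¹ = y c.1
  field_simp
  ring

end OfSizes

/-! ### From lengths to disks: sizes of vertices -/

section Adapted

/-- The edge lengths of `T` are the logarithms of the ratios of sizes `X` of its vertices, measured
on the components of `S`. -/
structure Adapted (T : ColoredTree n) (len : T.Edge → ENNReal) (S : NodalQuiltedDisk n)
    (f : Fin T.m → Fin S.tree.m) (X : Fin T.m → ℝ) : Prop where
  morphism : T.IsMorphism S.tree f
  pos : ∀ v, 0 < X v
  gap : ∀ i, S.gap (S.tree.gapVertex i) i = X (T.gapVertex i)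
  height : ∀ c ∈ T.col, ∀ h : f c ∈ S.tree.col, S.height ⟨f c, h⟩ = X c
  edge_of_eq : ∀ e : T.Edge, f (T.parent e.1) = f e.1 → expNeg (len e) = X e.1 / X (T.parent e.1)
  edge_of_ne : ∀ e : T.Edge, f (T.parent e.1) ≠ f e.1 → expNeg (len e) = 0

namespace Adapted

variable {T : ColoredTree n} {len : T.Edge → ENNReal} {S : NodalQuiltedDisk n}
  {f : Fin T.m → Fin S.tree.m} {X : Fin T.m → ℝ} (h : Adapted T len S f X)
include h

/-- The ratios along a path telescope as long as the path stays in one component of `S`; a single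
node on it contributes the factor 0. -/
theorem expNeg_pathLength {u v : Fin T.m} (huv : T.Below u v) :
    (f u = f v → expNeg (T.pathLength len u v) = X u / X v) ∧
      (f u ≠ f v → expNeg (T.pathLength len u v) = 0) := by
  refine Below.induction (P := fun u => (f u = f v → expNeg (T.pathLength len u v) = X u / X v) ∧
      (f u ≠ f v → expNeg (T.pathLength len u v) = 0)) ?_ ?_ huv
  · refine ⟨fun _ => ?_, fun h => absurd rfl h⟩
    rw [pathLength_self, expNeg_zero, div_self (h.pos v).ne']
  · intro u hne hr hp ih
    have hm := h.morphism
    rw [pathLength_step ((below_parent u).trans hp) hne hr, expNeg_add]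
    by_cases hc : f (T.parent u) = f u
    · rw [h.edge_of_eq ⟨u, hr⟩ hc, ← hc]
      refine ⟨fun h1 => ?_, fun h1 => ?_⟩
      · rw [ih.1 h1, div_mul_div_cancel₀ (h.pos _).ne']
      · rw [ih.2 h1, mul_zero]
    · rw [h.edge_of_ne ⟨u, hr⟩ hc, zero_mul]
      refine ⟨fun h1 => absurd ?_ hc, fun _ => rfl⟩
      exact Below.antisymm (h1 ▸ hm.mono hp) (hm.mono (below_parent u))

theorem map_eq_of_col {c v : Fin T.m} (hc : c ∈ T.col) (hcv : T.Below c v ∨ T.Below v c) :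
    f c = f v ↔ f v ∈ S.tree.col := by
  have hc' : f c ∈ S.tree.col := (h.morphism.col _).2 ⟨c, hc, rfl⟩
  refine ⟨fun h1 => h1 ▸ hc', fun h1 => ?_⟩
  rcases hcv with hcv | hcv
  · exact eq_of_col_below hc' h1 (h.morphism.mono hcv)
  · exact (eq_of_col_below h1 hc' (h.morphism.mono hcv)).symm

/-- Coloured vertices merged with `v` share one seam and so have the same size; if `v` is not on a
quilted component, both lengths are infinite. -/
theorem balanced : T.Balanced len := by
  intro v c hc c' hc' h1 h2
  apply expNeg_injective
  have e1 := h.map_eq_of_col hc (Or.inl h1)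
  have e2 := h.map_eq_of_col hc' (Or.inl h2)
  by_cases hv : f v ∈ S.tree.col
  · rw [(h.expNeg_pathLength h1).1 (e1.2 hv), (h.expNeg_pathLength h2).1 (e2.2 hv)]
    congr 1
    rw [← h.height c hc ((e1.2 hv).symm ▸ hv), ← h.height c' hc' ((e2.2 hv).symm ▸ hv)]
    congr 1
    exact Subtype.ext ((e1.2 hv).trans (e2.2 hv).symm)
  · rw [(h.expNeg_pathLength h1).2 (mt e1.1 hv), (h.expNeg_pathLength h2).2 (mt e2.1 hv)]

theorem expNeg_pathLength_gap {a b : Fin n} {i : Fin (n - 1)} (hi : GapIn a b i) :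
    expNeg (T.pathLength len (T.gapVertex i) (T.meet a b)) =
      S.gap (S.tree.meet a b) i / X (T.meet a b) := by
  have hm := h.morphism
  have h1 := h.expNeg_pathLength (hi.gapVertex_below_meet (T := T))
  rw [hm.map_gapVertex, hm.map_meet hi.lt.ne] at h1
  by_cases hv : S.tree.gapVertex i = S.tree.meet a b
  · rw [h1.1 hv, ← h.gap, hv]
  · rw [h1.2 hv, S.gap_eq_zero hi.gapVertex_below_meet hv, zero_div]

/-- A gap whose vertex in `T` is the meet is the largest, because lengths are nonnegative and all
other gaps are obtained from it by factors at most 1. -/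
theorem scale_eq {a b : Fin n} (hab : a < b) : S.scale a b = X (T.meet a b) := by
  have hm := h.morphism
  obtain ⟨i, hi, hi'⟩ := exists_gapVertex_eq_meet (T := T) hab
  have hg : S.gap (S.tree.meet a b) i = X (T.meet a b) := by
    rw [← hm.map_meet hab.ne, ← hi', hm.map_gapVertex, h.gap]
  rw [← hg]
  refine S.scale_eq hi fun j hj => ?_
  have h1 := h.expNeg_pathLength_gap hj
  rw [eq_div_iff (h.pos _).ne'] at h1
  rw [hg, ← h1]
  exact mul_le_of_le_one_left (h.pos _).le (expNeg_le_one _)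

/-- This is the bridge between the two sides: with vertex sizes as intermediary, path lengths in `T`
and ratios on components of `S` give the same entries. The truncations at 1 correspond to path
lengths in the wrong direction. -/
theorem metricData_eq : T.metricData len = S.diskData := by
  classical
  have hm := h.morphism
  have hcol : ∀ a b, a < b → (f (T.cv a) = f (T.meet a b) ↔ S.tree.meet a b ∈ S.tree.col) := by
    intro a b hab
    rw [h.map_eq_of_col (cv_mem a) (cv_below_or (leaf_below_meet_left hab.ne)),
      hm.map_meet hab.ne]
  have hheight : ∀ a b (hab : a < b) (hc : S.tree.meet a b ∈ S.tree.col),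
      S.height ⟨_, hc⟩ = X (T.cv a) := by
    intro a b hab hc
    rw [← h.height _ (cv_mem a) ((hm.map_cv a).symm ▸ cv_mem a)]
    congr 1
    exact Subtype.ext ((hm.map_meet hab.ne).symm.trans ((hcol a b hab).2 hc).symm)
  refine Prod.ext ?_ (Prod.ext ?_ ?_)
  · funext a b i
    by_cases hi : GapIn a b i
    · rw [metricData_gap hi, diskData_gap hi, h.expNeg_pathLength_gap hi, h.scale_eq hi.lt]
    · simp [metricData, diskData, hi]
  · funext a b
    by_cases hab : a < b
    swap
    · simp [metricData, diskData, hab]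
    rw [metricData_below hab]
    rcases cv_below_or (T := T) (leaf_below_meet_left hab.ne) with hb | hb
    · have h1 := h.expNeg_pathLength hb
      by_cases hc : S.tree.meet a b ∈ S.tree.col
      · have h2 := h1.1 ((hcol a b hab).2 hc)
        rw [diskData_low_of_col hab hc, hheight a b hab hc, h.scale_eq hab, ← h2,
          min_eq_right (expNeg_le_one _)]
      · rw [h1.2 (mt (hcol a b hab).1 hc), diskData_low_of_not_below hab]
        intro h3
        have h4 := hm.mono hb
        rw [hm.map_cv, hm.map_meet hab.ne] at h4
        exact hc (h4.antisymm h3 ▸ cv_mem a)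
    · rw [pathLength_eq_zero_of_below hb, expNeg_zero]
      have h1 := h.expNeg_pathLength hb
      by_cases hc : S.tree.meet a b ∈ S.tree.col
      · have h2 := h1.1 ((hcol a b hab).2 hc).symm
        rw [diskData_low_of_col hab hc, hheight a b hab hc, h.scale_eq hab, ← inv_div, ← h2,
          min_eq_left]
        refine (one_le_inv₀ ?_).2 (expNeg_le_one _)
        rw [h2]
        exact div_pos (h.pos _) (h.pos _)
      · rw [diskData_low_of_below hab hc]
        have h4 := hm.mono hb
        rwa [hm.map_cv, hm.map_meet hab.ne] at h4
  · funext a b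
    by_cases hab : a < b
    swap
    · simp [metricData, diskData, hab]
    rw [metricData_above hab]
    rcases cv_below_or (T := T) (leaf_below_meet_left hab.ne) with hb | hb
    · rw [pathLength_eq_zero_of_below hb, expNeg_zero]
      have h1 := h.expNeg_pathLength hb
      by_cases hc : S.tree.meet a b ∈ S.tree.col
      · have h2 := h1.1 ((hcol a b hab).2 hc)
        rw [diskData_high_of_col hab hc, hheight a b hab hc, h.scale_eq hab, ← inv_div, ← h2,
          min_eq_left]
        refine (one_le_inv₀ ?_).2 (expNeg_le_one _)
        rw [h2]
        exact div_pos (h.pos _) (h.pos _)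
      · rw [diskData_high_of_not_below hab]
        intro h3
        have h4 := hm.mono hb
        rw [hm.map_cv, hm.map_meet hab.ne] at h4
        exact hc (h4.antisymm h3 ▸ cv_mem a)
    · have h1 := h.expNeg_pathLength hb
      by_cases hc : S.tree.meet a b ∈ S.tree.col
      · have h2 := h1.1 ((hcol a b hab).2 hc).symm
        rw [diskData_high_of_col hab hc, hheight a b hab hc, h.scale_eq hab, ← h2,
          min_eq_right (expNeg_le_one _)]
      · rw [h1.2 (fun h' => hc ((hcol a b hab).1 h'.symm)), diskData_high_of_below hab hc]
        have h4 := hm.mono hb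
        rwa [hm.map_cv, hm.map_meet hab.ne] at h4

end Adapted

/-- Every balanced metric tree defines a nodal quilted disk. -/
theorem exists_diskData_eq (T : ColoredTree n) (l : T.Cell) :
    ∃ S : NodalQuiltedDisk n, S.diskData = T.metricData l.1 := by
  have finite_iff : ∀ u v : Fin T.m, T.pathLength l.1 u v ≠ ⊤ ↔
      ∀ e : T.Edge, T.Below u e.1 → T.Below e.1 v → e.1 ≠ v → l.1 e ≠ ⊤ := by
    classical
    intro u v
    rw [pathLength, ENNReal.sum_ne_top]
    constructor
    · intro h e h1 h2 h3
      have := h e (Finset.mem_univ _)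
      rwa [if_pos ⟨h1, h2, h3⟩] at this
    · intro h e _
      split_ifs with he
      · exact h e he.1 he.2.1 he.2.2
      · exact ENNReal.zero_ne_top
  -- The edges of infinite length become the nodes of the disk; balancing shows that finiteness of
  -- the path to `v` is the same for all coloured vertices beyond `v`.
  obtain ⟨T', f, hf, hA⟩ := exists_contraction (T := T) (fun v => ∀ h : v ≠ T.root, l.1 ⟨v, h⟩ ≠ ⊤)
    (by
      intro v c hc c' hc' h1 h2 h u hu1 hu2 hu3 hr
      have h0 : T.pathLength l.1 c v ≠ ⊤ :=
        (finite_iff c v).2 fun e he1 he2 he3 => h e.1 he1 he2 he3 e.2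
      rw [l.2 v c hc c' hc' h1 h2, finite_iff] at h0
      exact h0 ⟨u, hr⟩ hu1 hu2 hu3)
  choose t ht ht' using fun w => hf.fibre w
  have htop : ∀ v, T.Below v (t (f v)) := by
    intro v
    obtain ⟨x, hx1, hx2⟩ := hf.exists_of_below_map (Below.refl T' (f v))
    exact (hf.fibre (f v)).unique (ht (f v)) hx2 ▸ hx1
  -- The size of a vertex is measured from the top of its component, where the scale is normalized
  -- to 1.
  let X : Fin T.m → ℝ := fun v => expNeg (T.pathLength l.1 v (t (f v)))
  have hX : ∀ v, 0 < X v := by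
    intro v
    refine lt_of_le_of_ne (expNeg_nonneg _) (Ne.symm ?_)
    rw [Ne, expNeg_eq_zero]
    refine (finite_iff _ _).2 fun e h1 h2 h3 => ?_
    refine (hA e).1 ?_ e.2
    have h4 : f e.1 = f v := by
      refine Below.antisymm ?_ (hf.mono h1)
      rw [← (ht (f v)).1]
      exact hf.mono h2
    refine Below.antisymm ?_ (hf.mono (below_parent _))
    rw [h4]
    have := hf.mono (h2.parent_of_ne h3)
    rwa [(ht (f v)).1] at this
  -- By balancing, the coloured vertices in one fibre are equally far from its top, so the seam has
  -- a well-defined height. The value 1 on unquilted components plays no role.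
  have exY : ∀ w, ∃ y : ℝ, 0 < y ∧ ∀ c ∈ T.col, f c = w → y = X c := by
    intro w
    by_cases hw : ∃ c ∈ T.col, f c = w
    · obtain ⟨c, hc, rfl⟩ := hw
      refine ⟨X c, hX c, fun c' hc' hcc' => congrArg expNeg ?_⟩
      have := htop c'
      rw [hcc'] at this ⊢
      exact l.2 _ c hc c' hc' (htop c) this
    · exact ⟨1, one_pos, fun c hc hcw => absurd ⟨c, hc, hcw⟩ hw⟩
  choose y hy hy' using exY
  have hx : ∀ i, 0 < X (T.gapVertex i) := fun i => hX _
  refine ⟨ofSizes T' (fun i => X (T.gapVertex i)) y hx hy, Eq.symm ?_⟩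
  refine Adapted.metricData_eq (f := f) (X := X) ⟨hf, hX, fun i => gap_ofSizes hx hy i,
    fun c hc h => ?_, fun e he => ?_, fun e he => ?_⟩
  · exact (height_ofSizes hx hy ⟨f c, h⟩).trans (hy' _ c hc rfl)
  · have h1 := htop (T.parent e.1)
    have h2 : e.1 ≠ t (f e.1) := by
      intro h2
      rw [he, ← h2] at h1
      exact parent_ne e.2 (h1.antisymm (below_parent _))
    have h3 : X e.1 = expNeg (l.1 e) * X (T.parent e.1) := by
      show expNeg _ = _ * expNeg _
      rw [pathLength_step (htop e.1) h2 e.2, expNeg_add, he]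
    rw [h3, mul_div_cancel_right₀ _ (hX _).ne']
  · rw [expNeg_eq_zero]
    by_contra h
    exact he ((hA e).2 fun _ => h)

end Adapted

/-! ### Simple ratios and equality of data -/

section SimpleRatios

variable {T : ColoredTree n} {S : NodalQuiltedDisk n}

/-- The sizes of the vertices of a maximal tree, measured on the components of `S`. -/
theorem exists_sizes (hT : T.IsMaximal) {f : Fin T.m → Fin S.tree.m}
    (hf : T.IsMorphism S.tree f) : ∃ X : Fin T.m → ℝ, (∀ v, 0 < X v) ∧
      (∀ i, S.gap (S.tree.gapVertex i) i = X (T.gapVertex i)) ∧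
      ∀ c ∈ T.col, ∀ h : f c ∈ S.tree.col, S.height ⟨f c, h⟩ = X c := by
  have key : ∀ v, ∃ r : ℝ, 0 < r ∧ (∀ i, v = T.gapVertex i → S.gap (S.tree.gapVertex i) i = r) ∧
      (v ∈ T.col → ∀ h : f v ∈ S.tree.col, S.height ⟨f v, h⟩ = r) := by
    intro v
    by_cases hv : v ∈ T.col
    · have hv' : f v ∈ S.tree.col := (hf.col _).2 ⟨v, hv, rfl⟩
      exact ⟨S.height ⟨f v, hv'⟩, S.height_pos _,
        fun i hi => absurd (hi ▸ hv) (hT.gapVertex_notMem_col i), fun _ _ => rfl⟩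
    · obtain ⟨i, rfl⟩ := exists_gapVertex hv
      refine ⟨S.gap (S.tree.gapVertex i) i, S.gap_pos rfl, fun j hj => ?_, fun h => absurd h hv⟩
      rw [hT.gapVertex_injective hj]
  choose X h1 h2 h3 using key
  exact ⟨X, h1, fun i => h2 _ i rfl, fun c hc h => h3 c hc h⟩

/-- On a maximal tree each uncoloured vertex belongs to one gap, so the simple ratio equations are
the edge conditions of `Adapted`. This gives uniqueness of the map. -/
theorem metricData_eq_of_hasSimpleRatios (hT : T.IsMaximal) {len : T.Edge → ENNReal}
    {f : Fin T.m → Fin S.tree.m} (hf : T.IsMorphism S.tree f)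
    (h : S.HasSimpleRatios T fun e => expNeg (len e)) : T.metricData len = S.diskData := by
  obtain ⟨X, h1, h2, h3⟩ := exists_sizes hT hf
  have hcol : ∀ u v, v ∈ T.col → (T.Below u v ∨ T.Below v u) → f u ∈ S.tree.col → f u = f v := by
    intro u v hv huv hu
    have hv' : f v ∈ S.tree.col := (hf.col _).2 ⟨v, hv, rfl⟩
    rcases huv with huv | huv
    · exact eq_of_col_below hu hv' (hf.mono huv)
    · exact (eq_of_col_below hv' hu (hf.mono huv)).symm
  have key : ∀ e : T.Edge,
      (f (T.parent e.1) = f e.1 → expNeg (len e) = X e.1 / X (T.parent e.1)) ∧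
      (f (T.parent e.1) ≠ f e.1 → expNeg (len e) = 0) := by
    intro e
    have hb := below_parent (T := T) e.1
    by_cases he : e.1 ∈ T.col
    · have hp : T.parent e.1 ∉ T.col := fun hp => parent_ne e.2 (eq_of_col_below he hp hb).symm
      obtain ⟨i, hi⟩ := exists_gapVertex hp
      have hi' : f (T.parent e.1) = S.tree.gapVertex i := by rw [← hi, hf.map_gapVertex]
      rw [h.colored_below e i he hi]
      constructor
      · intro h4
        have h5 : f e.1 ∈ S.tree.col := (hf.col _).2 ⟨_, he, rfl⟩
        have h6 : f e.1 = S.tree.gapVertex i := h4.symm.trans hi'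
        rw [dif_pos (h6 ▸ h5), h2, hi, ← h3 _ he h5]
        congr 2
        exact Subtype.ext h6.symm
      · intro h4
        rw [dif_neg]
        intro h5
        exact h4 (hcol _ _ he (Or.inr hb) (hi' ▸ h5))
    · obtain ⟨i, hi⟩ := exists_gapVertex he
      have hi' : f e.1 = S.tree.gapVertex i := by rw [← hi, hf.map_gapVertex]
      by_cases hp : T.parent e.1 ∈ T.col
      · rw [h.colored_above e i hi hp]
        constructor
        · intro h4
          have h5 : f (T.parent e.1) ∈ S.tree.col := (hf.col _).2 ⟨_, hp, rfl⟩
          have h6 : f (T.parent e.1) = S.tree.gapVertex i := h4.trans hi'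
          rw [dif_pos (h6 ▸ h5), h2, hi, ← h3 _ hp h5]
          congr 2
          exact Subtype.ext h6.symm
        · intro h4
          rw [dif_neg]
          intro h5
          exact h4 (hcol _ _ hp (Or.inl hb) (hi' ▸ h5)).symm
      · obtain ⟨j, hj⟩ := exists_gapVertex hp
        have hj' : f (T.parent e.1) = S.tree.gapVertex j := by rw [← hj, hf.map_gapVertex]
        rw [h.uncolored e i j hi hj]
        constructor
        · intro h4
          rw [hi', hj'] at h4
          rw [h2 j, hj, h4, h2 i, hi]
        · intro h4
          have h5 := hf.mono hb
          rw [hi', hj'] at h4 h5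
          rw [S.gap_eq_zero h5 (Ne.symm h4), zero_div]
  exact Adapted.metricData_eq ⟨hf, h1, h2, h3, fun e => (key e).1, fun e => (key e).2⟩

theorem scale_adjacent (i : Fin (n - 1)) :
    S.scale (lowerLeaf i) (upperLeaf i) = S.gap (S.tree.gapVertex i) i := by
  refine S.scale_eq (gapIn_self i) fun j hj => ?_
  have : j = i := by
    simp only [gapIn_iff, lowerLeaf, upperLeaf] at hj
    exact Fin.ext (by omega)
  rw [this]

theorem degenerates_of_metricData_eq {len : T.Edge → ENNReal}
    (h : T.metricData len = S.diskData) : T.Degenerates S.tree := by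
  refine ⟨fun a b i hi h1 => ?_, fun a b hab h1 => ?_, fun a b hab h1 => ?_⟩
  · rw [← diskData_gap_pos_iff hi, ← h, metricData_gap hi, h1, pathLength_self, expNeg_zero]
    exact one_pos
  · rw [← diskData_high_pos_iff hab, ← h, metricData_above hab, pathLength_eq_zero_of_below h1,
      expNeg_zero]
    exact one_pos
  · rw [← diskData_low_pos_iff hab, ← h, metricData_below hab, pathLength_eq_zero_of_below h1,
      expNeg_zero]
    exact one_pos

/-- The outermost leaves of the two gaps meet at the upper gap vertex, so the data of that interval
compares both gaps. -/
theorem exists_gapIn_of_below {i j : Fin (n - 1)} (h : T.Below (T.gapVertex i) (T.gapVertex j)) :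
    ∃ a b, GapIn a b i ∧ GapIn a b j ∧ T.gapVertex j = T.meet a b := by
  refine ⟨min (lowerLeaf i) (lowerLeaf j), max (upperLeaf i) (upperLeaf j),
    ⟨min_le_left _ _, le_max_left _ _⟩, ⟨min_le_right _ _, le_max_right _ _⟩,
    meet_eq_gapVertex_of_below ⟨min_le_right _ _, le_max_right _ _⟩ ?_ ?_⟩
  · rcases min_choice (lowerLeaf i) (lowerLeaf j) with h1 | h1 <;> rw [h1]
    · exact (lower_below_gapVertex i).trans h
    · exact lower_below_gapVertex j
  · rcases max_choice (upperLeaf i) (upperLeaf j) with h1 | h1 <;> rw [h1]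
    · exact (upper_below_gapVertex i).trans h
    · exact upper_below_gapVertex j

theorem metricData_of_colored_parent (len : T.Edge → ENNReal) {e : T.Edge} {i : Fin (n - 1)}
    (hi : T.gapVertex i = e.1) (hp : T.parent e.1 ∈ T.col) :
    T.parent e.1 = T.cv (lowerLeaf i) ∧
      (T.metricData len).2.2 (lowerLeaf i) (upperLeaf i) = expNeg (len e) ∧
      (T.metricData len).2.1 (lowerLeaf i) (upperLeaf i) = 1 := by
  have hlt := lowerLeaf_lt_upperLeaf i
  have hb : T.Below (T.gapVertex i) (T.parent e.1) := hi ▸ below_parent e.1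
  have hc : T.parent e.1 = T.cv (lowerLeaf i) := eq_cv hp ((lower_below_gapVertex i).trans hb)
  refine ⟨hc, ?_, ?_⟩
  · rw [metricData_above hlt, ← hc, show T.meet (lowerLeaf i) (upperLeaf i) = e.1 from hi,
      pathLength_edge]
  · rw [metricData_below hlt, ← hc, show T.meet (lowerLeaf i) (upperLeaf i) = e.1 from hi,
      pathLength_eq_zero_of_below (below_parent _), expNeg_zero]

theorem metricData_of_colored_child (l : T.Cell) {e : T.Edge} {i : Fin (n - 1)}
    (he : e.1 ∈ T.col) (hi : T.gapVertex i = T.parent e.1) :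
    T.Below (T.cv (lowerLeaf i)) (T.gapVertex i) ∧
      (T.metricData l.1).2.1 (lowerLeaf i) (upperLeaf i) = expNeg (l.1 e) ∧
      (T.metricData l.1).2.2 (lowerLeaf i) (upperLeaf i) = 1 := by
  have hlt := lowerLeaf_lt_upperLeaf i
  have hb : T.Below e.1 (T.gapVertex i) := hi ▸ below_parent e.1
  obtain ⟨x, hx⟩ := exists_eq_cv he
  have hcb : T.Below (T.cv (lowerLeaf i)) (T.gapVertex i) :=
    cv_below_of_cv_below ((leaf_below_cv x).trans (hx ▸ hb)) (lower_below_gapVertex i) (hx ▸ hb)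
  refine ⟨hcb, ?_, ?_⟩
  · rw [metricData_below hlt, show T.meet (lowerLeaf i) (upperLeaf i) = T.gapVertex i from rfl,
      l.2 _ _ (cv_mem _) _ he hcb hb, hi, pathLength_edge]
  · rw [metricData_above hlt, show T.meet (lowerLeaf i) (upperLeaf i) = T.gapVertex i from rfl,
      pathLength_eq_zero_of_below hcb, expNeg_zero]

/-- Edge lengths are path lengths, so each simple ratio is an entry of the data or a quotient of
two. In the coloured cases the complementary entry 1 shows that the relevant ratio is not truncated.
-/
theorem exists_morphism_and_hasSimpleRatios (l : T.Cell)
    (h : T.metricData l.1 = S.diskData) :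
    (∃ f, T.IsMorphism S.tree f) ∧ S.HasSimpleRatios T fun e => expNeg (l.1 e) := by
  obtain ⟨f, hf⟩ := (degenerates_of_metricData_eq h).exists_isMorphism
  refine ⟨⟨f, hf⟩, fun e i j hi hj => ?_, fun e i hi hp => ?_, fun e i he hi => ?_⟩
  · have hb : T.Below (T.gapVertex i) (T.gapVertex j) := by
      rw [hi, hj]
      exact below_parent _
    obtain ⟨a, b, gi, gj, hm⟩ := exists_gapIn_of_below hb
    have h1 := congrFun (congrFun (congrFun (congrArg Prod.fst h) a) b) i
    have h2 := congrFun (congrFun (congrFun (congrArg Prod.fst h) a) b) j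
    rw [metricData_gap gi, diskData_gap gi, ← hf.map_meet gi.lt.ne, ← hm, hf.map_gapVertex, hi, hj,
      pathLength_edge] at h1
    rw [metricData_gap gj, diskData_gap gj, ← hf.map_meet gi.lt.ne, ← hm, hf.map_gapVertex,
      pathLength_self, expNeg_zero, eq_div_iff (S.scale_pos gi.lt).ne', one_mul] at h2
    rw [h1, h2]
  · have hlt := lowerLeaf_lt_upperLeaf i
    have hb : T.Below (T.gapVertex i) (T.parent e.1) := hi ▸ below_parent e.1
    obtain ⟨hc, h1, h2⟩ := metricData_of_colored_parent l.1 hi hp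
    rw [h] at h1 h2
    rw [← h1]
    by_cases hcol : S.tree.gapVertex i ∈ S.tree.col
    · rw [dif_pos hcol]
      rw [diskData_low_of_col hlt hcol, scale_adjacent, min_eq_left_iff,
        one_le_div (S.gap_pos rfl)] at h2
      rw [diskData_high_of_col hlt hcol, scale_adjacent, min_eq_right]
      · rfl
      · exact (div_le_one (S.height_pos _)).2 h2
    · rw [dif_neg hcol, diskData_high_of_below hlt hcol]
      have h3 := hf.mono hb
      rwa [hc, hf.map_cv, hf.map_gapVertex] at h3
  · have hlt := lowerLeaf_lt_upperLeaf i
    obtain ⟨hcb, h1, h2⟩ := metricData_of_colored_child l he hi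
    rw [h] at h1 h2
    rw [← h1]
    by_cases hcol : S.tree.gapVertex i ∈ S.tree.col
    · rw [dif_pos hcol]
      rw [diskData_high_of_col hlt hcol, scale_adjacent, min_eq_left_iff,
        one_le_div (S.height_pos _)] at h2
      rw [diskData_low_of_col hlt hcol, scale_adjacent, min_eq_right]
      · rfl
      · exact (div_le_one (S.gap_pos rfl)).2 h2
    · rw [dif_neg hcol, diskData_low_of_not_below hlt]
      intro h3
      have h4 := hf.mono hcb
      rw [hf.map_cv, hf.map_gapVertex] at h4
      exact hcol (h4.antisymm h3 ▸ cv_mem _)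

/-- Every nodal quilted disk is given by the lengths of a maximal tree. -/
theorem exists_metricData_eq (S : NodalQuiltedDisk n) :
    ∃ (T : ColoredTree n) (l : T.Cell), T.IsMaximal ∧ T.metricData l.1 = S.diskData := by
  classical
  -- On a quilted component gaps are measured in units of the seam height, so that the threshold 1
  -- of the refinement separates gaps smaller than the height from larger ones.
  obtain ⟨T, f, hT, hf, h1, h2, h3⟩ := exists_refinement S.tree fun i =>
    if h : S.tree.gapVertex i ∈ S.tree.col then
      S.gap (S.tree.gapVertex i) i / S.height ⟨_, h⟩ else S.gap (S.tree.gapVertex i) i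
  obtain ⟨X, hX, hgap, hheight⟩ := exists_sizes hT hf
  -- Within a component sizes do not decrease towards the root; this makes the logarithmic lengths
  -- nonnegative.
  have hle : ∀ e : T.Edge, f (T.parent e.1) = f e.1 → X e.1 ≤ X (T.parent e.1) := by
    intro e hfe
    have hb := below_parent (T := T) e.1
    by_cases he : e.1 ∈ T.col
    · have hp : T.parent e.1 ∉ T.col := fun hp => parent_ne e.2 (eq_of_col_below he hp hb).symm
      obtain ⟨i, hi⟩ := exists_gapVertex hp
      obtain ⟨a, ha⟩ := exists_eq_cv he
      have hc : f e.1 ∈ S.tree.col := (hf.col _).2 ⟨_, he, rfl⟩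
      have hv : S.tree.gapVertex i = f e.1 := by rw [← hf.map_gapVertex, hi, hfe]
      have h4 := h2 i a (by rwa [← ha, hi]) (hv ▸ hc)
      rw [dif_pos (hv ▸ hc), one_le_div (S.height_pos _), hgap, hi] at h4
      refine le_trans (le_of_eq ?_) h4
      rw [← hheight _ he hc]
      congr 1
      exact Subtype.ext hv.symm
    · obtain ⟨i, hi⟩ := exists_gapVertex he
      have hv : S.tree.gapVertex i = f e.1 := by rw [← hf.map_gapVertex, hi]
      by_cases hp : T.parent e.1 ∈ T.col
      · obtain ⟨a, ha⟩ := exists_eq_cv hp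
        have hc : f (T.parent e.1) ∈ S.tree.col := (hf.col _).2 ⟨_, hp, rfl⟩
        have hv' : S.tree.gapVertex i = f (T.parent e.1) := hv.trans hfe.symm
        have h4 := h3 i a (by rwa [← ha, hi]) (hv' ▸ hc)
        rw [dif_pos (hv' ▸ hc), div_le_one (S.height_pos _), hgap, hi] at h4
        refine h4.trans (le_of_eq ?_)
        rw [← hheight _ hp hc]
        congr 1
        exact Subtype.ext hv'
      · obtain ⟨j, hj⟩ := exists_gapVertex hp
        have hij : S.tree.gapVertex i = S.tree.gapVertex j := by
          rw [hv, ← hfe, ← hj, hf.map_gapVertex]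
        have h4 := h1 i j (by rwa [hi, hj]) hij
        have ei : X e.1 = S.gap (S.tree.gapVertex i) i := by rw [← hi, hgap]
        have ej : X (T.parent e.1) = S.gap (S.tree.gapVertex j) j := by rw [← hj, hgap]
        rw [ei, ej]
        by_cases hc : S.tree.gapVertex i ∈ S.tree.col
        · have e1 : S.height ⟨_, hc⟩ = S.height ⟨_, hij ▸ hc⟩ := congrArg S.height (Subtype.ext hij)
          rwa [dif_pos hc, dif_pos (hij ▸ hc), e1, div_le_div_iff_of_pos_right (S.height_pos _)] at h4
        · rwa [dif_neg hc, dif_neg (hij ▸ hc)] at h4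
  let len : T.Edge → ENNReal := fun e => if f (T.parent e.1) = f e.1 then
    ENNReal.ofReal (Real.log (X (T.parent e.1) / X e.1)) else ⊤
  have had : Adapted T len S f X := by
    refine ⟨hf, hX, hgap, hheight, fun e he => ?_, fun e he => ?_⟩
    · simp only [len, if_pos he]
      have hpos : 0 < X (T.parent e.1) / X e.1 := div_pos (hX _) (hX _)
      rw [expNeg_ofReal (Real.log_nonneg ((one_le_div (hX _)).2 (hle e he))), Real.exp_neg,
        Real.exp_log hpos, inv_div]
    · simp only [len, if_neg he, expNeg_top]
  exact ⟨T, ⟨len, had.balanced⟩, hT, had.metricData_eq⟩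

end SimpleRatios

end NodalQuiltedDisk


open ColoredTree

/-! ### Distances and ratios computed from the data -/

namespace ColoredTree

variable {n : ℕ}

open Classical in
/-- The distance of the markings of the leaves `c` and `d`, relative to the largest gap between `a`
and `b`. -/
noncomputable def relDist (D : Data n) (a b c d : Fin n) : ℝ :=
  ∑ i ∈ Finset.univ.filter (fun i => GapIn c d i), D.1 a b i

/-- The ratio `(z_k - z_j) / (z_j - z_i)`. -/
noncomputable def leftRatio (D : Data n) (i j k : Fin n) : ENNReal :=
  ENNReal.ofReal (relDist D i k j k) / ENNReal.ofReal (relDist D i k i j)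

/-- The ratio `(z_k - z_j) / (z_l - z_k)`. -/
noncomputable def rightRatio (D : Data n) (j k l : Fin n) : ENNReal :=
  ENNReal.ofReal (relDist D j l j k) / ENNReal.ofReal (relDist D j l k l)

theorem continuous_relDist (a b c d : Fin n) : Continuous fun D : Data n => relDist D a b c d := by
  unfold relDist
  fun_prop

end ColoredTree

/-! ### Cross-ratios in half-plane coordinates -/

section CrossRatio

theorem ofHalfPlane_sub {u v w : ℂ} (hv : v + Complex.I ≠ 0) (hw : w + Complex.I ≠ 0) :
    ofHalfPlane u v - ofHalfPlane u w =
      2 * Complex.I * u * (v - w) / ((v + Complex.I) * (w + Complex.I)) := by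
  rw [ofHalfPlane, ofHalfPlane]
  field_simp
  ring

theorem sub_ofHalfPlane {u w : ℂ} (hw : w + Complex.I ≠ 0) :
    u - ofHalfPlane u w = 2 * Complex.I * u / (w + Complex.I) := by
  rw [ofHalfPlane]
  field_simp
  ring

theorem ofReal_add_I_ne_zero (t : ℝ) : (t : ℂ) + Complex.I ≠ 0 := add_I_ne_zero (by simp)

/-- The cross-ratio is the same in half-plane coordinates. -/
theorem crossRatio_boundaryPoint (u : Circle) {p q r s : ℝ} (hpq : p ≠ q) (hrs : r ≠ s) :
    crossRatio (boundaryPoint u p) (boundaryPoint u q) (boundaryPoint u r) (boundaryPoint u s) =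
      (((q - r) * (s - p) / ((p - q) * (r - s)) : ℝ) : ℂ) := by
  have hu := Circle.coe_ne_zero u
  have hp := ofReal_add_I_ne_zero p
  have hq := ofReal_add_I_ne_zero q
  have hr := ofReal_add_I_ne_zero r
  have hs := ofReal_add_I_ne_zero s
  have h1 : (p : ℂ) - q ≠ 0 := sub_ne_zero.2 (by exact_mod_cast hpq)
  have h2 : (r : ℂ) - s ≠ 0 := sub_ne_zero.2 (by exact_mod_cast hrs)
  simp only [crossRatio, coe_boundaryPoint, ofHalfPlane_sub, hp, hq, hr, hs, ne_eq,
    not_false_eq_true]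
  push_cast
  have hI := Complex.I_ne_zero
  field_simp

theorem crossRatio_out_first (u : Circle) {q r s : ℝ} (hrs : r ≠ s) :
    crossRatio u (boundaryPoint u q) (boundaryPoint u r) (boundaryPoint u s) =
      (((r - q) / (r - s) : ℝ) : ℂ) := by
  have hu := Circle.coe_ne_zero u
  have hq := ofReal_add_I_ne_zero q
  have hr := ofReal_add_I_ne_zero r
  have hs := ofReal_add_I_ne_zero s
  have h2 : (r : ℂ) - s ≠ 0 := sub_ne_zero.2 (by exact_mod_cast hrs)
  rw [crossRatio, ← neg_sub (u : ℂ) (boundaryPoint u s)]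
  simp only [coe_boundaryPoint, ofHalfPlane_sub, sub_ofHalfPlane, hq, hr, hs, ne_eq,
    not_false_eq_true]
  push_cast
  have hI := Complex.I_ne_zero
  field_simp
  ring

theorem crossRatio_out_last (u : Circle) {p q r : ℝ} (hpq : p ≠ q) :
    crossRatio (boundaryPoint u p) (boundaryPoint u q) (boundaryPoint u r) u =
      (((r - q) / (p - q) : ℝ) : ℂ) := by
  have hu := Circle.coe_ne_zero u
  have hp := ofReal_add_I_ne_zero p
  have hq := ofReal_add_I_ne_zero q
  have hr := ofReal_add_I_ne_zero r
  have h2 : (p : ℂ) - q ≠ 0 := sub_ne_zero.2 (by exact_mod_cast hpq)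
  rw [crossRatio, ← neg_sub (u : ℂ) (boundaryPoint u r)]
  simp only [coe_boundaryPoint, ofHalfPlane_sub, sub_ofHalfPlane, hp, hq, hr, ne_eq,
    not_false_eq_true]
  push_cast
  have hI := Complex.I_ne_zero
  field_simp
  ring

theorem crossRatio_out_third (u : Circle) {p q : ℝ} {w : ℂ} (hpq : p ≠ q)
    (hw : w + Complex.I ≠ 0) :
    crossRatio (boundaryPoint u p) (boundaryPoint u q) u (ofHalfPlane u w) =
      (w - p) / (q - p) := by
  have hu := Circle.coe_ne_zero u
  have hp := ofReal_add_I_ne_zero p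
  have hq := ofReal_add_I_ne_zero q
  have h2 : (p : ℂ) - q ≠ 0 := sub_ne_zero.2 (by exact_mod_cast hpq)
  have h3 : (q : ℂ) - p ≠ 0 := sub_ne_zero.2 (by exact_mod_cast hpq.symm)
  rw [crossRatio, ← neg_sub (u : ℂ) (boundaryPoint u q)]
  simp only [coe_boundaryPoint, ofHalfPlane_sub, sub_ofHalfPlane, hp, hq, hw, ne_eq,
    not_false_eq_true]
  have hI := Complex.I_ne_zero
  field_simp
  ring

/-- For four points on a line with consecutive distances `x, y, z`, the right-hand side is minus the
cross-ratio. The product form on the left continues to make sense when the ratios are 0 or infinite.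
-/
theorem ENNReal.one_add_mul_one_add_sub_one {x y z : ℝ} (hx : 0 < x) (hy : 0 < y) (hz : 0 < z) :
    (((1 + ENNReal.ofReal y / ENNReal.ofReal x) * (1 + ENNReal.ofReal y / ENNReal.ofReal z) - 1 :
      ENNReal) : EReal) = ((y * (x + y + z) / (x * z) : ℝ) : EReal) := by
  rw [← ENNReal.ofReal_div_of_pos hx, ← ENNReal.ofReal_div_of_pos hz, ← ENNReal.ofReal_one,
    ← ENNReal.ofReal_add zero_le_one (by positivity), ← ENNReal.ofReal_add zero_le_one
    (by positivity), ← ENNReal.ofReal_mul (by positivity), ← ENNReal.ofReal_sub _ zero_le_one,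
    EReal.coe_ennreal_ofReal]
  have : (1 + y / x) * (1 + y / z) - 1 = y * (x + y + z) / (x * z) := by
    field_simp
    ring
  rw [this, max_eq_left (by positivity)]

end CrossRatio

namespace NodalQuiltedDisk

variable {n : ℕ} (S : NodalQuiltedDisk n)

theorem pos_eq_of_meet_ne {v : Fin S.tree.m} {i j : Fin n}
    (hi : S.tree.Below (S.tree.leaf i) v) (hj : S.tree.Below (S.tree.leaf j) v)
    (h : S.tree.meet i j ≠ v) : S.pos v i = S.pos v j := by
  rw [pos, pos, S.leafPoint_eq_of_meet_ne hi hj h]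

theorem pos_le {v : Fin S.tree.m} {i j : Fin n} (hij : i < j)
    (hi : S.tree.Below (S.tree.leaf i) v) (hj : S.tree.Below (S.tree.leaf j) v) :
    S.pos v i ≤ S.pos v j := by
  by_cases h : S.tree.meet i j = v
  · exact (S.pos_lt hij h).le
  · exact (S.pos_eq_of_meet_ne hi hj h).le

theorem leafPoint_eq_iff {v : Fin S.tree.m} {i j : Fin n}
    (hi : S.tree.Below (S.tree.leaf i) v) (hj : S.tree.Below (S.tree.leaf j) v) :
    S.leafPoint v i = S.leafPoint v j ↔ S.pos v i = S.pos v j := by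
  refine ⟨fun h => by rw [pos, pos, h], fun h => ?_⟩
  rw [← S.boundaryPoint_pos hi, ← S.boundaryPoint_pos hj, h]

theorem meet_eq_of_leafPoint_ne {v : Fin S.tree.m} {i j : Fin n}
    (hi : S.tree.Below (S.tree.leaf i) v) (hj : S.tree.Below (S.tree.leaf j) v)
    (h : S.leafPoint v i ≠ S.leafPoint v j) : S.tree.meet i j = v := by
  by_contra h1
  exact h (S.leafPoint_eq_of_meet_ne hi hj h1)

variable {S} in
-- The normalized gaps add up to differences of positions on the component where `a` and `b` part,
-- divided by the common scale.
theorem relDist_diskData {a b c d : Fin n} (hab : a < b) (hac : a ≤ c) (hcd : c ≤ d) (hdb : d ≤ b) :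
    relDist S.diskData a b c d =
      (S.pos (S.tree.meet a b) d - S.pos (S.tree.meet a b) c) / S.scale a b := by
  classical
  have hs := (S.scale_pos hab).ne'
  rw [eq_div_iff hs]
  have h := telescope (g := fun e => relDist S.diskData a b c e) (g' := S.pos (S.tree.meet a b))
    (α := S.scale a b) hcd ?_
  · have h0 : relDist S.diskData a b c c = 0 := by
      rw [relDist, Finset.filter_false_of_mem, Finset.sum_empty]
      exact fun i _ hi => lt_irrefl _ hi.lt
    rw [h, h0]
    ring
  · intro i hi
    have hi' : GapIn a b i := ⟨hac.trans hi.1, hi.2.trans hdb⟩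
    have : relDist S.diskData a b c (upperLeaf i) =
        S.diskData.1 a b i + relDist S.diskData a b c (lowerLeaf i) := by
      rw [relDist, relDist, ← Finset.sum_insert]
      · refine Finset.sum_congr ?_ fun _ _ => rfl
        ext j
        have := hi.1
        simp only [Finset.mem_filter, Finset.mem_univ, true_and, Finset.mem_insert, gapIn_iff,
          Fin.ext_iff, lowerLeaf, upperLeaf, Fin.le_def] at this ⊢
        omega
      · simp [gapIn_iff, lowerLeaf]
    rw [this, diskData_gap hi', add_sub_cancel_right, mul_div_cancel₀ _ hs, gap_eq]

variable {S} in
theorem relDist_pos {a b : Fin n} (hab : a < b) : 0 < relDist S.diskData a b a b := by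
  rw [relDist_diskData hab le_rfl hab.le le_rfl]
  exact div_pos (sub_pos.2 (S.pos_lt hab rfl)) (S.scale_pos hab)

variable {S} in
theorem relDist_add {a b c : Fin n} (hac : a < c) (hcb : c < b) :
    relDist S.diskData a b a c + relDist S.diskData a b c b = relDist S.diskData a b a b := by
  have hab := hac.trans hcb
  rw [relDist_diskData hab le_rfl hac.le hcb.le, relDist_diskData hab hac.le hcb.le le_rfl,
    relDist_diskData hab le_rfl hab.le le_rfl]
  ring

variable {S} in
theorem relDist_nonneg {a b c d : Fin n} (hac : a ≤ c) (hcd : c < d) (hdb : d ≤ b) :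
    0 ≤ relDist S.diskData a b c d := by
  have hab := hac.trans_lt (hcd.trans_le hdb)
  rw [relDist_diskData hab hac hcd.le hdb]
  refine div_nonneg (sub_nonneg.2 (S.pos_le hcd ?_ ?_)) (S.scale_pos hab).le
  · exact ribbon' hac (hcd.le.trans hdb) (leaf_below_meet_left hab.ne)
      (leaf_below_meet_right hab.ne)
  · exact ribbon' (hac.trans hcd.le) hdb (leaf_below_meet_left hab.ne)
      (leaf_below_meet_right hab.ne)

theorem meet_eq_of_left {i j k : Fin n} (hij : i < j) (hjk : j < k)
    (hi : S.tree.Below (S.tree.leaf i) (S.tree.meet j k)) : S.tree.meet i k = S.tree.meet j k := by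
  refine Below.antisymm (meet_below (hij.trans hjk).ne hi (leaf_below_meet_right hjk.ne)) ?_
  exact meet_below hjk.ne (ribbon' hij.le hjk.le (leaf_below_meet_left (hij.trans hjk).ne)
    (leaf_below_meet_right (hij.trans hjk).ne)) (leaf_below_meet_right (hij.trans hjk).ne)

theorem meet_eq_of_right {j k l : Fin n} (hjk : j < k) (hkl : k < l)
    (hl : S.tree.Below (S.tree.leaf l) (S.tree.meet j k)) : S.tree.meet j l = S.tree.meet j k := by
  refine Below.antisymm (meet_below (hjk.trans hkl).ne (leaf_below_meet_left hjk.ne) hl) ?_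
  exact meet_below hjk.ne (leaf_below_meet_left (hjk.trans hkl).ne) (ribbon' hjk.le hkl.le
    (leaf_below_meet_left (hjk.trans hkl).ne) (leaf_below_meet_right (hjk.trans hkl).ne))

theorem ofReal_div_div_ofReal_div {x y s : ℝ} (hs : 0 < s) :
    ENNReal.ofReal (x / s) / ENNReal.ofReal (y / s) = ENNReal.ofReal x / ENNReal.ofReal y := by
  rw [ENNReal.ofReal_div_of_pos hs, ENNReal.ofReal_div_of_pos hs,
    div_eq_mul_inv (ENNReal.ofReal x) (ENNReal.ofReal s),
    div_eq_mul_inv (ENNReal.ofReal y) (ENNReal.ofReal s), ENNReal.mul_div_mul_right]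
  · simp
  · simpa using hs

theorem leftRatio_of_below {i j k : Fin n} (hij : i < j) (hjk : j < k)
    (hi : S.tree.Below (S.tree.leaf i) (S.tree.meet j k)) :
    leftRatio S.diskData i j k =
      ENNReal.ofReal (S.pos (S.tree.meet j k) k - S.pos (S.tree.meet j k) j) /
        ENNReal.ofReal (S.pos (S.tree.meet j k) j - S.pos (S.tree.meet j k) i) := by
  have hik := hij.trans hjk
  rw [leftRatio, relDist_diskData hik hij.le hjk.le le_rfl, relDist_diskData hik le_rfl hij.le
    hjk.le, ofReal_div_div_ofReal_div (S.scale_pos hik), S.meet_eq_of_left hij hjk hi]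

/-- When `i` separates first, `j` and `k` coincide as seen from the component where `i` and `k`
part, so the numerator vanishes. -/
theorem leftRatio_of_not_below {i j k : Fin n} (hij : i < j) (hjk : j < k)
    (hi : ¬ S.tree.Below (S.tree.leaf i) (S.tree.meet j k)) : leftRatio S.diskData i j k = 0 := by
  have hik := hij.trans hjk
  have h := leaf_below_meet_left (T := S.tree) hik.ne
  have h' := leaf_below_meet_right (T := S.tree) hik.ne
  rw [leftRatio, relDist_diskData hik hij.le hjk.le le_rfl,
    S.pos_eq_of_meet_ne h' (ribbon' hij.le hjk.le h h')]
  · simp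
  · rw [meet_comm hjk.ne']
    intro h1
    exact hi (h1 ▸ h)

theorem rightRatio_of_below {j k l : Fin n} (hjk : j < k) (hkl : k < l)
    (hl : S.tree.Below (S.tree.leaf l) (S.tree.meet j k)) :
    rightRatio S.diskData j k l =
      ENNReal.ofReal (S.pos (S.tree.meet j k) k - S.pos (S.tree.meet j k) j) /
        ENNReal.ofReal (S.pos (S.tree.meet j k) l - S.pos (S.tree.meet j k) k) := by
  have hjl := hjk.trans hkl
  rw [rightRatio, relDist_diskData hjl le_rfl hjk.le hkl.le, relDist_diskData hjl hjk.le hkl.le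
    le_rfl, ofReal_div_div_ofReal_div (S.scale_pos hjl), S.meet_eq_of_right hjk hkl hl]

theorem rightRatio_of_not_below {j k l : Fin n} (hjk : j < k) (hkl : k < l)
    (hl : ¬ S.tree.Below (S.tree.leaf l) (S.tree.meet j k)) : rightRatio S.diskData j k l = 0 := by
  have hjl := hjk.trans hkl
  have h := leaf_below_meet_left (T := S.tree) hjl.ne
  have h' := leaf_below_meet_right (T := S.tree) hjl.ne
  rw [rightRatio, relDist_diskData hjl le_rfl hjk.le hkl.le,
    S.pos_eq_of_meet_ne (ribbon' hjk.le hkl.le h h') h]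
  · simp
  · rw [meet_comm hjk.ne']
    intro h1
    exact hl (h1 ▸ h')

theorem point_succ (v : Fin S.tree.m) (i : Fin n) : S.point v i.succ = S.leafPoint v i := rfl

theorem point_eq_out_or (v : Fin S.tree.m) (p : Fin (n + 1)) :
    S.point v p = S.out v ∨ ∃ i : Fin n, p = i.succ ∧ S.tree.Below (S.tree.leaf i) v := by
  refine Fin.cases (Or.inl rfl) (fun i => ?_) p
  by_cases h : S.tree.Below (S.tree.leaf i) v
  · exact Or.inr ⟨i, rfl, h⟩
  · exact Or.inl (S.leafPoint_of_not_below h)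

theorem below_of_leafPoint_ne_out {v : Fin S.tree.m} {i : Fin n} (h : S.leafPoint v i ≠ S.out v) :
    S.tree.Below (S.tree.leaf i) v := by
  by_contra h'
  exact h (S.leafPoint_of_not_below h')

/-! ### The cross-ratios of four markings as functions of the data -/

section RhoFour

variable {i : Fin (n + 1)} {j k l : Fin n}

/-- By planarity neither `j` nor `k` can be on the root side here: it would lie between two leaves
beyond `v`. -/
theorem eq_meet_of_distinct (hij : i < j.succ) (hjk : j < k) (hkl : k < l) {v : Fin S.tree.m}
    (h1 : S.point v i ≠ S.leafPoint v j) (h2 : S.point v i ≠ S.leafPoint v k)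
    (h3 : S.leafPoint v j ≠ S.leafPoint v k) (h5 : S.leafPoint v k ≠ S.leafPoint v l) : S.tree.meet j k = v := by
  have hj : S.tree.Below (S.tree.leaf j) v := by
    by_contra hj
    have e := S.leafPoint_of_not_below hj
    rw [e] at h1 h3
    obtain h | ⟨i', rfl, hi'⟩ := S.point_eq_out_or v i
    · exact h1 h
    · exact hj (ribbon' (Fin.succ_lt_succ_iff.1 hij).le hjk.le hi'
        (S.below_of_leafPoint_ne_out h3.symm))
  have hk : S.tree.Below (S.tree.leaf k) v := by
    by_contra hk
    have e := S.leafPoint_of_not_below hk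
    rw [e] at h5
    exact hk (ribbon' hjk.le hkl.le hj (S.below_of_leafPoint_ne_out h5.symm))
  exact S.meet_eq_of_leafPoint_ne hj hk h3

/-- It suffices to look where `j` and `k` part. If both are beyond a separating `v`, then `v` is
their meet; if `k` is on the root side, then `i` and `j` part strictly beyond the meet of `j` and
`k`, and so coincide there. -/
theorem exists_separating_iff (hij : i < j.succ) (hjk : j < k) (hkl : k < l) :
    (∃ v, S.point v i ≠ S.leafPoint v j ∧ S.leafPoint v k = S.leafPoint v l ∧
      S.point v i ≠ S.leafPoint v k ∧ S.leafPoint v j ≠ S.leafPoint v k) ↔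
    S.point (S.tree.meet j k) i = S.leafPoint (S.tree.meet j k) j ∨
      S.leafPoint (S.tree.meet j k) k = S.leafPoint (S.tree.meet j k) l := by
  have bj := leaf_below_meet_left (T := S.tree) hjk.ne
  have bk := leaf_below_meet_right (T := S.tree) hjk.ne
  have hne : S.leafPoint (S.tree.meet j k) j ≠ S.leafPoint (S.tree.meet j k) k := fun h =>
    (S.pos_lt hjk rfl).ne ((S.leafPoint_eq_iff bj bk).1 h)
  constructor
  · rintro ⟨v, h1, h2, h3, h4⟩
    by_cases hj : S.tree.Below (S.tree.leaf j) v
    · by_cases hk : S.tree.Below (S.tree.leaf k) v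
      · rw [S.meet_eq_of_leafPoint_ne hj hk h4]
        exact Or.inr h2
      · rw [S.leafPoint_of_not_below hk] at h3
        obtain h | ⟨i', rfl, hi'⟩ := S.point_eq_out_or v i
        · exact absurd h h3
        have hv := S.meet_eq_of_leafPoint_ne hi' hj h1
        left
        rcases bj.total hj with hb | hb
        · exact absurd (bk.trans hb) hk
        · refine S.leafPoint_eq_of_meet_ne (hi'.trans hb) bj fun h => hk ?_
          rwa [← hv, h]
    · rw [S.leafPoint_of_not_below hj] at h1 h4
      obtain h | ⟨i', rfl, hi'⟩ := S.point_eq_out_or v i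
      · exact absurd h h1
      · exact absurd (ribbon' (Fin.succ_lt_succ_iff.1 hij).le hjk.le hi'
          (S.below_of_leafPoint_ne_out h4.symm)) hj
  · intro h
    -- If `i` and `j` coincide at the meet of `j` and `k`, the component where they part sees `k`
    -- and `l` both at its root-side point.
    by_cases h0 : S.point (S.tree.meet j k) i = S.leafPoint (S.tree.meet j k) j
    · obtain h1 | ⟨i', rfl, hi'⟩ := S.point_eq_out_or (S.tree.meet j k) i
      · exact absurd (h0.symm.trans h1) (S.leafPoint_ne_out bj)
      have hij' := Fin.succ_lt_succ_iff.1 hij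
      have ci := leaf_below_meet_left (T := S.tree) hij'.ne
      have cj := leaf_below_meet_right (T := S.tree) hij'.ne
      have hk : ¬ S.tree.Below (S.tree.leaf k) (S.tree.meet i' j) := by
        intro hk
        have := (meet_below hjk.ne cj hk).antisymm (meet_below hij'.ne hi' bj)
        exact (S.pos_lt hij' this.symm).ne ((S.leafPoint_eq_iff hi' bj).1 h0)
      have hl : ¬ S.tree.Below (S.tree.leaf l) (S.tree.meet i' j) := fun hl =>
        hk (ribbon' hjk.le hkl.le cj hl)
      refine ⟨S.tree.meet i' j, ?_, ?_, ?_, ?_⟩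
      · exact fun h => (S.pos_lt hij' rfl).ne ((S.leafPoint_eq_iff ci cj).1 h)
      · rw [S.leafPoint_of_not_below hk, S.leafPoint_of_not_below hl]
      · rw [S.leafPoint_of_not_below hk]
        exact S.leafPoint_ne_out ci
      · rw [S.leafPoint_of_not_below hk]
        exact S.leafPoint_ne_out cj
    · refine ⟨_, h0, h.resolve_left h0, ?_, hne⟩
      intro h1
      obtain h2 | ⟨i', rfl, hi'⟩ := S.point_eq_out_or (S.tree.meet j k) i
      · exact S.leafPoint_ne_out bk (h1.symm.trans h2)
      · have := S.pos_le (Fin.succ_lt_succ_iff.1 hij) hi' bj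
        rw [(S.leafPoint_eq_iff hi' bk).1 h1] at this
        exact this.not_gt (S.pos_lt hjk rfl)

/-- The ratio `(z_k - z_j) / (z_j - z_i)`, which is `0` if `i = 0`. -/
noncomputable def leftRatio' (D : Data n) (i : Fin (n + 1)) (j k : Fin n) : ENNReal :=
  Fin.cases 0 (fun i => leftRatio D i j k) i

theorem rhoFour_eq_bot (hij : i < j.succ) (hjk : j < k) (hkl : k < l)
    (h : S.point (S.tree.meet j k) i = S.leafPoint (S.tree.meet j k) j ∨
      S.leafPoint (S.tree.meet j k) k = S.leafPoint (S.tree.meet j k) l) :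
    S.rhoFour i j.succ k.succ l.succ = ⊥ := by
  classical
  exact if_pos ((S.exists_separating_iff hij hjk hkl).2 h)

theorem rhoFour_eq_crossRatio (hij : i < j.succ) (hjk : j < k) (hkl : k < l)
    (h1 : S.point (S.tree.meet j k) i ≠ S.leafPoint (S.tree.meet j k) j)
    (h2 : S.leafPoint (S.tree.meet j k) k ≠ S.leafPoint (S.tree.meet j k) l)
    (h3 : S.point (S.tree.meet j k) i ≠ S.leafPoint (S.tree.meet j k) k)
    (h4 : S.point (S.tree.meet j k) i ≠ S.leafPoint (S.tree.meet j k) l)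
    (h5 : S.leafPoint (S.tree.meet j k) j ≠ S.leafPoint (S.tree.meet j k) k)
    (h6 : S.leafPoint (S.tree.meet j k) j ≠ S.leafPoint (S.tree.meet j k) l) :
    S.rhoFour i j.succ k.succ l.succ =
      (((crossRatio (S.point (S.tree.meet j k) i) (S.leafPoint (S.tree.meet j k) j)
        (S.leafPoint (S.tree.meet j k) k) (S.leafPoint (S.tree.meet j k) l)).re : ℝ) : EReal) := by
  classical
  have h : ∃ v, S.point v i ≠ S.point v j.succ ∧ S.point v i ≠ S.point v k.succ ∧
      S.point v i ≠ S.point v l.succ ∧ S.point v j.succ ≠ S.point v k.succ ∧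
      S.point v j.succ ≠ S.point v l.succ ∧ S.point v k.succ ≠ S.point v l.succ :=
    ⟨_, h1, h3, h4, h5, h6, h2⟩
  have hv : h.choose = S.tree.meet j k := by
    obtain ⟨a1, a2, -, a4, -, a6⟩ := h.choose_spec
    exact (S.eq_meet_of_distinct hij hjk hkl a1 a2 a4 a6).symm
  refine (if_neg fun h' => ((S.exists_separating_iff hij hjk hkl).1 h').elim h1 h2).trans
    ((dif_pos h).trans ?_)
  rw [hv]
  rfl

theorem rhoFour_eq_zero (hij : i < j.succ) (hjk : j < k) (hkl : k < l)
    (h1 : S.point (S.tree.meet j k) i ≠ S.leafPoint (S.tree.meet j k) j)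
    (h2 : S.leafPoint (S.tree.meet j k) k ≠ S.leafPoint (S.tree.meet j k) l)
    (h3 : S.point (S.tree.meet j k) i = S.leafPoint (S.tree.meet j k) l) :
    S.rhoFour i j.succ k.succ l.succ = 0 := by
  classical
  refine (if_neg fun h' => ((S.exists_separating_iff hij hjk hkl).1 h').elim h1 h2).trans
    (dif_neg ?_)
  rintro ⟨v, a1, a2, a3, a4, -, a6⟩
  rw [← S.eq_meet_of_distinct hij hjk hkl a1 a2 a4 a6] at a3
  exact a3 h3

theorem leftRatio'_cases (hij : i < j.succ) (hjk : j < k) :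
    (S.point (S.tree.meet j k) i = S.out (S.tree.meet j k) ∧ leftRatio' S.diskData i j k = 0) ∨
      ∃ i' : Fin n, i = i'.succ ∧ i' < j ∧ S.tree.Below (S.tree.leaf i') (S.tree.meet j k) ∧
        leftRatio' S.diskData i j k =
          ENNReal.ofReal (S.pos (S.tree.meet j k) k - S.pos (S.tree.meet j k) j) /
            ENNReal.ofReal (S.pos (S.tree.meet j k) j - S.pos (S.tree.meet j k) i') := by
  induction i using Fin.cases with
  | zero => exact Or.inl ⟨rfl, rfl⟩
  | succ i =>
    have hij' := Fin.succ_lt_succ_iff.1 hij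
    by_cases hi : S.tree.Below (S.tree.leaf i) (S.tree.meet j k)
    · exact Or.inr ⟨i, rfl, hij', hi, S.leftRatio_of_below hij' hjk hi⟩
    · exact Or.inl ⟨S.leafPoint_of_not_below hi, S.leftRatio_of_not_below hij' hjk hi⟩

/-- One formula covers all configurations: a ratio is 0 when the outer marking is at infinity on the
component where `j` and `k` part, and infinite when it coincides with its neighbour there. The
values `0` and `-∞` come out accordingly. -/
theorem rhoFour_eq (hij : i < j.succ) (hjk : j < k) (hkl : k < l) :
    S.rhoFour i j.succ k.succ l.succ =
      -(((1 + leftRatio' S.diskData i j k) * (1 + rightRatio S.diskData j k l) - 1 : ENNReal) :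
        EReal) := by
  have bj := leaf_below_meet_left (T := S.tree) hjk.ne
  have bk := leaf_below_meet_right (T := S.tree) hjk.ne
  have hjk' := S.pos_lt (v := S.tree.meet j k) hjk rfl
  have hI := S.leftRatio'_cases hij hjk
  have hL := S.rightRatio_of_below hjk hkl
  have hL' := S.rightRatio_of_not_below hjk hkl
  have hbot := S.rhoFour_eq_bot hij hjk hkl
  have hcr := S.rhoFour_eq_crossRatio hij hjk hkl
  have hzero := S.rhoFour_eq_zero hij hjk hkl
  generalize S.tree.meet j k = v at *
  have hy := sub_pos.2 hjk'
  have eq_iff : ∀ {a b : Fin n}, S.tree.Below (S.tree.leaf a) v → S.tree.Below (S.tree.leaf b) v →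
      (S.leafPoint v a = S.leafPoint v b ↔ S.pos v a = S.pos v b) := S.leafPoint_eq_iff
  have hne := mt (eq_iff bj bk).1 hjk'.ne
  have hjo := S.leafPoint_ne_out bj
  have hko := S.leafPoint_ne_out bk
  by_cases bl : S.tree.Below (S.tree.leaf l) v
  · rw [hL bl]
    rcases (S.pos_le hkl bk bl).eq_or_lt with hz | hz
    · rw [hbot (Or.inr ((eq_iff bk bl).2 hz)), hz, sub_self, ENNReal.ofReal_zero,
        ENNReal.div_zero (ENNReal.ofReal_pos.2 (hz ▸ hy)).ne']
      simp [ENNReal.mul_top]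
    · have hkl' := mt (eq_iff bk bl).1 hz.ne
      have hjl' := mt (eq_iff bj bl).1 (hjk'.trans hz).ne
      obtain ⟨hi, hi0⟩ | ⟨i', rfl, hij', bi, hi⟩ := hI
      · rw [hi] at hcr
        rw [hi0, hcr hjo.symm hkl' hko.symm (S.leafPoint_ne_out bl).symm hne hjl',
          ← S.boundaryPoint_pos bj, ← S.boundaryPoint_pos bk, ← S.boundaryPoint_pos bl,
          crossRatio_out_first _ hz.ne, Complex.ofReal_re, add_zero, one_mul,
          ENNReal.add_sub_cancel_left ENNReal.one_ne_top,
          ← ENNReal.ofReal_div_of_pos (sub_pos.2 hz), EReal.coe_ennreal_ofReal,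
          max_eq_left (div_nonneg hy.le (sub_pos.2 hz).le), ← neg_sub (S.pos v l), div_neg]
        rfl
      · rw [hi]
        rcases (S.pos_le hij' bi bj).eq_or_lt with hx | hx
        · rw [hbot (Or.inl ((eq_iff bi bj).2 hx)), hx, sub_self, ENNReal.ofReal_zero,
            ENNReal.div_zero (ENNReal.ofReal_pos.2 hy).ne']
          simp [ENNReal.top_mul]
        · rw [hcr (mt (eq_iff bi bj).1 hx.ne) hkl' (mt (eq_iff bi bk).1 (hx.trans hjk').ne)
            (mt (eq_iff bi bl).1 (hx.trans (hjk'.trans hz)).ne) hne hjl', point_succ,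
            ← S.boundaryPoint_pos bi,
            ← S.boundaryPoint_pos bj, ← S.boundaryPoint_pos bk, ← S.boundaryPoint_pos bl,
            crossRatio_boundaryPoint _ hx.ne hz.ne, Complex.ofReal_re,
            ENNReal.one_add_mul_one_add_sub_one (sub_pos.2 hx) hy (sub_pos.2 hz), ← EReal.coe_neg]
          congr 1
          rw [← neg_div]
          congr 1 <;> ring
  · rw [hL' bl]
    have hlo := S.leafPoint_of_not_below bl
    rw [hlo] at hbot hcr hzero
    obtain ⟨hi, hi0⟩ | ⟨i', rfl, hij', bi, hi⟩ := hI
    · rw [hi] at hzero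
      rw [hi0, hzero hjo.symm hko rfl]
      simp
    · rw [hi]
      rcases (S.pos_le hij' bi bj).eq_or_lt with hx | hx
      · rw [hbot (Or.inl ((eq_iff bi bj).2 hx)), hx, sub_self, ENNReal.ofReal_zero,
          ENNReal.div_zero (ENNReal.ofReal_pos.2 hy).ne']
        simp
      · rw [hcr (mt (eq_iff bi bj).1 hx.ne) hko (mt (eq_iff bi bk).1 (hx.trans hjk').ne)
          (S.leafPoint_ne_out bi) hne hjo, point_succ, ← S.boundaryPoint_pos bi,
          ← S.boundaryPoint_pos bj, ← S.boundaryPoint_pos bk,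
          crossRatio_out_last _ hx.ne, Complex.ofReal_re, add_zero, mul_one,
          ENNReal.add_sub_cancel_left ENNReal.one_ne_top,
          ← ENNReal.ofReal_div_of_pos (sub_pos.2 hx), EReal.coe_ennreal_ofReal,
          max_eq_left (div_nonneg hy.le (sub_pos.2 hx).le), ← neg_sub (S.pos v j) (S.pos v i'),
          div_neg]
        rfl

end RhoFour

/-! ### The cross-ratios of two leaves as functions of the data -/

section RhoTwo

variable {S} {i j : Fin n}

/-- The quotient of the two truncated colour entries is the untruncated ratio of height to scale,
and dividing by the normalized distance removes the scale. On unquilted components exactly one entry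
vanishes, giving 0 or infinity. -/
theorem rhoTwo_eq (hij : i < j) : S.rhoTwo i j =
    ((ENNReal.ofReal (S.diskData.2.1 i j) / (ENNReal.ofReal (S.diskData.2.2 i j) *
      ENNReal.ofReal (relDist S.diskData i j i j)) : ENNReal) : EReal) := by
  classical
  have bi := leaf_below_meet_left (T := S.tree) hij.ne
  have bj := leaf_below_meet_right (T := S.tree) hij.ne
  by_cases hc : S.tree.meet i j ∈ S.tree.col
  · have hs := S.scale_pos hij
    have hh := S.height_pos ⟨_, hc⟩
    have hp := S.pos_lt hij rfl
    refine (dif_pos hc).trans ?_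
    have h1 : (((1 - 2 * S.radius ⟨S.tree.meet i j, hc⟩ : ℝ) : ℂ) *
        (S.out (S.tree.meet i j) : ℂ)) = ofHalfPlane (S.out (S.tree.meet i j))
          ((S.height ⟨_, hc⟩ : ℝ) * Complex.I) := by
      rw [← S.toHalfPlane_seamPoint' ⟨_, hc⟩]
      exact (ofHalfPlane_toHalfPlane (Circle.coe_ne_zero _) (S.seamPoint_ne ⟨_, hc⟩)).symm
    rw [h1, ← S.boundaryPoint_pos bi, ← S.boundaryPoint_pos bj,
      crossRatio_out_third _ hp.ne (add_I_ne_zero (by simpa using hh.le)),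
      diskData_low_of_col hij hc, diskData_high_of_col hij hc,
      relDist_diskData hij le_rfl hij.le le_rfl]
    have hpos := sub_pos.2 hp
    generalize S.height ⟨_, hc⟩ = h at *
    generalize S.scale i j = s at *
    have e1 : min 1 (h / s) / (min 1 (s / h) *
        ((S.pos (S.tree.meet i j) j - S.pos (S.tree.meet i j) i) / s)) =
        h / (S.pos (S.tree.meet i j) j - S.pos (S.tree.meet i j) i) := by
      rcases le_total h s with hle | hle
      · rw [min_eq_right ((div_le_one hs).2 hle), min_eq_left ((one_le_div hh).2 hle)]
        field_simp
      · rw [min_eq_left ((one_le_div hs).2 hle), min_eq_right ((div_le_one hh).2 hle)]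
        field_simp
    rw [← ENNReal.ofReal_mul (by positivity), ← ENNReal.ofReal_div_of_pos (by positivity), e1,
      EReal.coe_ennreal_ofReal, max_eq_left (by positivity), ← Complex.ofReal_sub,
      Complex.div_ofReal_im]
    simp
  · have ht := ENNReal.ofReal_pos.2 (relDist_pos (S := S) hij)
    by_cases hb : S.tree.Below (S.tree.meet i j) (S.tree.cv i)
    · rw [diskData_low_of_below hij hc hb, diskData_high_of_below hij hc hb]
      refine (dif_neg hc).trans ((if_pos ⟨_, cv_mem i, hb⟩).trans ?_)
      simp
    · rw [diskData_low_of_not_below hij hb]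
      refine (dif_neg hc).trans ((if_neg ?_).trans ?_)
      · rintro ⟨c, hc, h⟩
        exact hb (eq_cv hc (bi.trans h) ▸ h)
      · simp

theorem low_or_high_eq_one (hij : i < j) :
    S.diskData.2.1 i j = 1 ∧ S.diskData.2.2 i j ≤ 1 ∧ 0 ≤ S.diskData.2.2 i j ∨
      S.diskData.2.2 i j = 1 ∧ S.diskData.2.1 i j ≤ 1 ∧ 0 ≤ S.diskData.2.1 i j := by
  by_cases hc : S.tree.meet i j ∈ S.tree.col
  · have hs := S.scale_pos hij
    have hh := S.height_pos ⟨_, hc⟩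
    rw [diskData_low_of_col hij hc, diskData_high_of_col hij hc]
    rcases le_total (S.height ⟨_, hc⟩) (S.scale i j) with hle | hle
    · exact Or.inr ⟨min_eq_left ((one_le_div hh).2 hle), min_le_left _ _, by positivity⟩
    · exact Or.inl ⟨min_eq_left ((one_le_div hs).2 hle), min_le_left _ _, by positivity⟩
  · by_cases hb : S.tree.Below (S.tree.meet i j) (S.tree.cv i)
    · rw [diskData_low_of_below hij hc hb, diskData_high_of_below hij hc hb]
      simp
    · rw [diskData_low_of_not_below hij hb, diskData_high_of_not_below hij hb]
      simp

end RhoTwo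

end NodalQuiltedDisk


open ColoredTree

/-! ### Cross-ratios determine the data and depend continuously on it -/

/-- A pair of nonnegative numbers, not both zero, is a point of a projective half-line with
coordinate in `[0, ∞]`; equal coordinates mean proportional pairs, also when the denominators
vanish. -/
theorem ENNReal.mul_eq_mul_of_ofReal_div_eq {x y x' y' : ℝ} (hx : 0 ≤ x) (hy : 0 ≤ y)
    (hx' : 0 ≤ x') (hy' : 0 ≤ y') (h : 0 < x ∨ 0 < y) (h' : 0 < x' ∨ 0 < y')
    (heq : ENNReal.ofReal x / ENNReal.ofReal y = ENNReal.ofReal x' / ENNReal.ofReal y') :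
    x * y' = x' * y := by
  have key : ∀ {a b : ℝ}, 0 ≤ b → (0 < a ∨ 0 < b) →
      (ENNReal.ofReal a / ENNReal.ofReal b = ⊤ ↔ b = 0) := by
    intro a b hb h
    constructor
    · intro h1
      by_contra hb0
      have := ENNReal.div_ne_top (x := ENNReal.ofReal a) ENNReal.ofReal_ne_top
        (ENNReal.ofReal_pos.2 (lt_of_le_of_ne hb (Ne.symm hb0))).ne'
      exact this h1
    · rintro rfl
      rw [ENNReal.ofReal_zero, ENNReal.div_zero]
      exact (ENNReal.ofReal_pos.2 (h.resolve_right (lt_irrefl _))).ne'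
  by_cases hy0 : y = 0
  · have : y' = 0 := (key hy' h').1 (heq ▸ (key hy h).2 hy0)
    rw [hy0, this, mul_zero, mul_zero]
  · have hy0' : y' ≠ 0 := fun h0 => hy0 ((key hy h).1 (heq ▸ (key hy' h').2 h0))
    have py := lt_of_le_of_ne hy (Ne.symm hy0)
    have py' := lt_of_le_of_ne hy' (Ne.symm hy0')
    rw [← ENNReal.ofReal_div_of_pos py, ← ENNReal.ofReal_div_of_pos py',
      ENNReal.ofReal_eq_ofReal_iff (by positivity) (by positivity), div_eq_div_iff hy0 hy0'] at heq
    exact heq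

theorem continuous_ofReal_div_ofReal {X : Type*} [TopologicalSpace X] {g h : X → ℝ}
    (hg : Continuous g) (hh : Continuous h) (hpos : ∀ x, 0 < g x ∨ 0 < h x) :
    Continuous fun x => ENNReal.ofReal (g x) / ENNReal.ofReal (h x) := by
  rw [continuous_iff_continuousAt]
  intro x
  refine ENNReal.Tendsto.div ((ENNReal.continuous_ofReal.comp hg).tendsto x) ?_
    ((ENNReal.continuous_ofReal.comp hh).tendsto x) (Or.inl ENNReal.ofReal_ne_top)
  exact (hpos x).imp (fun h => (ENNReal.ofReal_pos.2 h).ne') fun h => (ENNReal.ofReal_pos.2 h).ne'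

namespace NodalQuiltedDisk

variable {n : ℕ} {S S' : NodalQuiltedDisk n}

theorem pos_or_pos_of_add_pos {x y : ℝ} (h : 0 < x + y) : 0 < x ∨ 0 < y := by
  by_contra! h'
  linarith

theorem relDist_pos_or_pos {a b c : Fin n} (hac : a < c) (hcb : c < b) :
    0 < relDist S.diskData a b a c ∨ 0 < relDist S.diskData a b c b :=
  pos_or_pos_of_add_pos ((relDist_add hac hcb).symm ▸ relDist_pos (hac.trans hcb))

/-- With `z_0` as first marking the left factor in `rhoFour_eq` is 1, so the cross-ratio is minus
the right ratio. -/
theorem rightRatio_eq_of_crossRatios_eq (h : S.crossRatios = S'.crossRatios) {j k l : Fin n}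
    (hjk : j < k) (hkl : k < l) :
    rightRatio S.diskData j k l = rightRatio S'.diskData j k l := by
  have hm : StrictMono ![0, j.succ, k.succ, l.succ] := by
    rw [Fin.strictMono_iff_lt_succ]
    intro i
    fin_cases i
    · exact Fin.succ_pos j
    · exact Fin.succ_lt_succ_iff.2 hjk
    · exact Fin.succ_lt_succ_iff.2 hkl
  have h1 : S.rhoFour 0 j.succ k.succ l.succ = S'.rhoFour 0 j.succ k.succ l.succ :=
    congrFun (congrArg Prod.fst h) ⟨_, hm⟩
  rw [rhoFour_eq S (Fin.succ_pos j) hjk hkl, rhoFour_eq S' (Fin.succ_pos j) hjk hkl, neg_inj,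
    EReal.coe_ennreal_eq_coe_ennreal_iff] at h1
  have h0 : ∀ D : Data n, leftRatio' D 0 j k = 0 := fun D => rfl
  simpa only [h0, add_zero, one_mul, ENNReal.add_sub_cancel_left ENNReal.one_ne_top] using h1

/-- The ratio in which `c` divides the interval is known, hence also its distance from `a` relative
to the total length. -/
theorem relDist_mul_eq (h : S.crossRatios = S'.crossRatios) {a b c : Fin n} (hab : a < b)
    (hac : a ≤ c) (hcb : c ≤ b) :
    relDist S.diskData a b a c * relDist S'.diskData a b a b =
      relDist S'.diskData a b a c * relDist S.diskData a b a b := by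
  rcases hac.eq_or_lt with rfl | hac
  · rw [relDist_diskData hab le_rfl le_rfl hab.le, relDist_diskData hab le_rfl le_rfl hab.le]
    simp
  rcases hcb.eq_or_lt with rfl | hcb
  · exact mul_comm _ _
  have h1 := ENNReal.mul_eq_mul_of_ofReal_div_eq (relDist_nonneg le_rfl hac hcb.le)
    (relDist_nonneg hac.le hcb le_rfl) (relDist_nonneg le_rfl hac hcb.le)
    (relDist_nonneg hac.le hcb le_rfl) (relDist_pos_or_pos hac hcb) (relDist_pos_or_pos hac hcb)
    (rightRatio_eq_of_crossRatios_eq h hac hcb)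
  rw [← relDist_add hac hcb, ← relDist_add hac hcb]
  linear_combination h1

theorem gap_mul_eq (h : S.crossRatios = S'.crossRatios) {a b : Fin n} {i : Fin (n - 1)}
    (hi : GapIn a b i) : S.diskData.1 a b i * relDist S'.diskData a b a b =
      S'.diskData.1 a b i * relDist S.diskData a b a b := by
  have key : ∀ S : NodalQuiltedDisk n, S.diskData.1 a b i =
      relDist S.diskData a b a (upperLeaf i) - relDist S.diskData a b a (lowerLeaf i) := by
    intro S
    have hl := lowerLeaf_lt_upperLeaf i
    rw [relDist_diskData hi.lt le_rfl (hi.1.trans hl.le) hi.2,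
      relDist_diskData hi.lt le_rfl hi.1 (hl.le.trans hi.2), diskData_gap hi, gap_eq]
    ring
  have hl := lowerLeaf_lt_upperLeaf i
  have h1 := relDist_mul_eq h hi.lt (hi.1.trans hl.le) hi.2
  have h2 := relDist_mul_eq h hi.lt hi.1 (hl.le.trans hi.2)
  rw [key S, key S']
  linear_combination h1 - h2

/-- Gaps are known up to the total length; the normalization removes this ambiguity. The largest gap
of `S` has entry 1, while the corresponding entry for `S'` is at most 1. -/
theorem relDist_le_of_crossRatios_eq (h : S.crossRatios = S'.crossRatios) {a b : Fin n}
    (hab : a < b) : relDist S'.diskData a b a b ≤ relDist S.diskData a b a b := by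
  obtain ⟨i, hi, h1⟩ := S.exists_gap_eq_scale hab
  have h2 := gap_mul_eq h hi
  rw [diskData_gap hi, h1, div_self (S.scale_pos hab).ne', one_mul, diskData_gap hi] at h2
  rw [h2]
  exact mul_le_of_le_one_left (relDist_pos hab).le
    ((div_le_one (S'.scale_pos hab)).2 (S'.gap_le_scale hi))

theorem relDist_eq_of_crossRatios_eq (h : S.crossRatios = S'.crossRatios) {a b : Fin n}
    (hab : a < b) : relDist S.diskData a b a b = relDist S'.diskData a b a b :=
  (relDist_le_of_crossRatios_eq h.symm hab).antisymm (relDist_le_of_crossRatios_eq h hab)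

/-- The cross-ratios determine a nodal quilted disk. -/
theorem diskData_eq_of_crossRatios_eq (h : S.crossRatios = S'.crossRatios) :
    S.diskData = S'.diskData := by
  classical
  have key : ∀ a b, a < b → S.diskData.2.1 a b = S'.diskData.2.1 a b ∧
      S.diskData.2.2 a b = S'.diskData.2.2 a b := by
    intro a b hab
    have h1 : S.rhoTwo a b = S'.rhoTwo a b := congrFun (congrArg Prod.snd h) ⟨(a, b), hab⟩
    have ht := relDist_eq_of_crossRatios_eq h hab
    have hpos := relDist_pos (S := S) hab
    rw [rhoTwo_eq hab, rhoTwo_eq hab, EReal.coe_ennreal_eq_coe_ennreal_iff, ← ht] at h1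
    have hS := low_or_high_eq_one (S := S) hab
    have hS' := low_or_high_eq_one (S := S') hab
    generalize S.diskData.2.1 a b = x at *
    generalize S.diskData.2.2 a b = y at *
    generalize S'.diskData.2.1 a b = x' at *
    generalize S'.diskData.2.2 a b = y' at *
    generalize relDist S.diskData a b a b = t at *
    have e : ∀ {x y : ℝ}, (x = 1 ∧ y ≤ 1 ∧ 0 ≤ y ∨ y = 1 ∧ x ≤ 1 ∧ 0 ≤ x) →
        0 ≤ x ∧ 0 ≤ y ∧ (0 < x ∨ 0 < y * t) := by
      rintro x y (⟨rfl, -, hy⟩ | ⟨rfl, -, hx⟩)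
      · exact ⟨zero_le_one, hy, Or.inl one_pos⟩
      · exact ⟨hx, zero_le_one, Or.inr (by simpa using hpos)⟩
    obtain ⟨hx, hy, hxy⟩ := e hS
    obtain ⟨hx', hy', hxy'⟩ := e hS'
    rw [← ENNReal.ofReal_mul hy, ← ENNReal.ofReal_mul hy'] at h1
    have h2 := ENNReal.mul_eq_mul_of_ofReal_div_eq hx (mul_nonneg hy hpos.le) hx'
      (mul_nonneg hy' hpos.le) hxy hxy' h1
    -- The ratio of the two colour entries is thus known, and since their maximum is 1, so are the
    -- entries.
    have h3 : x * y' = x' * y := mul_right_cancel₀ hpos.ne' (by linear_combination h2)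
    rcases hS with ⟨rfl, hy1, -⟩ | ⟨rfl, hx1, -⟩ <;> rcases hS' with ⟨rfl, hy1', -⟩ | ⟨rfl, hx1', -⟩
    · exact ⟨rfl, by linarith⟩
    · constructor <;> nlinarith
    · constructor <;> nlinarith
    · exact ⟨by linarith, rfl⟩
  refine Prod.ext ?_ (Prod.ext ?_ ?_)
  · funext a b i
    by_cases hi : GapIn a b i
    · have h1 := gap_mul_eq h hi
      rw [relDist_eq_of_crossRatios_eq h hi.lt] at h1
      exact mul_right_cancel₀ (relDist_pos hi.lt).ne' h1
    · exact (if_neg hi).trans (if_neg hi).symm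
  · funext a b
    by_cases hab : a < b
    · exact (key a b hab).1
    · exact (if_neg hab).trans (if_neg hab).symm
  · funext a b
    by_cases hab : a < b
    · exact (key a b hab).2
    · exact (if_neg hab).trans (if_neg hab).symm

/-- The cross-ratios depend continuously on the relative sizes. -/
theorem continuous_crossRatios {X : Type*} [TopologicalSpace X] {f : X → NodalQuiltedDisk n}
    (hf : Continuous fun x => (f x).diskData) : Continuous fun x => (f x).crossRatios := by
  have hdist : ∀ a b c d, Continuous fun x => relDist (f x).diskData a b c d := fun a b c d =>
    (continuous_relDist a b c d).comp hf
  refine Continuous.prodMk (continuous_pi fun q => ?_) (continuous_pi fun p => ?_)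
  · obtain ⟨q, hq⟩ := q
    have h01 : q 0 < q 1 := hq (by decide)
    have h12 : q 1 < q 2 := hq (by decide)
    have h23 : q 2 < q 3 := hq (by decide)
    obtain ⟨j, hj⟩ := Fin.exists_succ_eq.2 ((Fin.zero_le _).trans_lt h01).ne'
    obtain ⟨k, hk⟩ := Fin.exists_succ_eq.2 ((Fin.zero_le _).trans_lt h12).ne'
    obtain ⟨l, hl⟩ := Fin.exists_succ_eq.2 ((Fin.zero_le _).trans_lt h23).ne'
    simp only
    generalize q 0 = i at *
    rw [← hj] at h01 h12
    rw [← hk] at h12 h23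
    rw [← hl] at h23
    have hjk := Fin.succ_lt_succ_iff.1 h12
    have hkl := Fin.succ_lt_succ_iff.1 h23
    simp only [← hj, ← hk, ← hl]
    rw [funext fun x => rhoFour_eq (f x) h01 hjk hkl]
    refine continuous_neg.comp (continuous_coe_ennreal_ereal.comp
      ((ENNReal.continuous_sub_right 1).comp ?_))
    have hleft : Continuous fun x => leftRatio' (f x).diskData i j k := by
      induction i using Fin.cases with
      | zero => exact continuous_const
      | succ i => exact continuous_ofReal_div_ofReal (hdist _ _ _ _) (hdist _ _ _ _) fun x =>
          (relDist_pos_or_pos (Fin.succ_lt_succ_iff.1 h01) hjk).symm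
    have hright : Continuous fun x => rightRatio (f x).diskData j k l :=
      continuous_ofReal_div_ofReal (hdist _ _ _ _) (hdist _ _ _ _) fun x =>
        relDist_pos_or_pos hjk hkl
    -- Multiplication on `[0, ∞]` fails to be continuous only at a product of 0 and infinity, which
    -- is excluded because both factors are at least 1.
    rw [continuous_iff_continuousAt]
    intro x
    exact ENNReal.Tendsto.mul ((continuous_const.add hleft).tendsto x) (Or.inl (by simp))
      ((continuous_const.add hright).tendsto x) (Or.inl (by simp))
  · obtain ⟨⟨i, j⟩, hij⟩ := p
    rw [funext fun x => rhoTwo_eq (S := f x) hij]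
    refine continuous_coe_ennreal_ereal.comp ?_
    have hhigh : ∀ x, 0 ≤ (f x).diskData.2.2 i j := by
      intro x
      rcases low_or_high_eq_one (S := f x) hij with h | h
      · exact h.2.2
      · rw [h.1]
        exact zero_le_one
    have : ∀ x, ENNReal.ofReal ((f x).diskData.2.2 i j) *
        ENNReal.ofReal (relDist (f x).diskData i j i j) =
        ENNReal.ofReal ((f x).diskData.2.2 i j * relDist (f x).diskData i j i j) := fun x =>
      (ENNReal.ofReal_mul (hhigh x)).symm
    simp only [this]
    refine continuous_ofReal_div_ofReal ?_ (Continuous.mul ?_ (hdist _ _ _ _)) fun x => ?_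
    · exact (continuous_apply_apply i j).comp (continuous_fst.comp (continuous_snd.comp hf))
    · exact (continuous_apply_apply i j).comp (continuous_snd.comp (continuous_snd.comp hf))
    · rcases low_or_high_eq_one (S := f x) hij with h | h
      · exact Or.inl (h.1 ▸ one_pos)
      · refine Or.inr ?_
        rw [h.1, one_mul]
        exact relDist_pos hij

end NodalQuiltedDisk


open ColoredTree

/-! ### Compactness of the space of metric trees -/

namespace ColoredTree

variable {n : ℕ} {T T' : ColoredTree n}

theorem IsMorphism.degenerates {f : Fin T.m → Fin T'.m} (hf : T.IsMorphism T' f) :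
    T.Degenerates T' where
  gap a b i hi h := by rw [← hf.map_gapVertex, h, hf.map_meet hi.lt.ne]
  above a b hab h := by
    rw [← hf.map_cv, ← hf.map_meet hab.ne]
    exact hf.mono h
  below a b hab h := by
    rw [← hf.map_cv, ← hf.map_meet hab.ne]
    exact hf.mono h

/-- Vertices are enumerated by the gaps and by the coloured vertices of the leaves. The bound leaves
only finitely many trees. -/
theorem m_le (T : ColoredTree n) : T.m ≤ n - 1 + n := by
  have hs : Function.Surjective (Sum.elim T.gapVertex T.cv) := by
    intro v
    obtain ⟨i, hi⟩ | ⟨-, i, hi⟩ := mem_col_or_exists_gapVertex v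
    · exact ⟨Sum.inr i, hi.symm⟩
    · exact ⟨Sum.inl i, hi.symm⟩
  simpa using Fintype.card_le_of_surjective _ hs

instance (n : ℕ) : Finite (ColoredTree n) := by
  let F : ColoredTree n → Σ m : Fin (n - 1 + n + 1),
      Fin m.1 × (Fin m.1 → Fin m.1) × (Fin n → Fin m.1) × Finset (Fin m.1) := fun T =>
    ⟨⟨T.m, Nat.lt_succ_of_le T.m_le⟩, T.root, T.parent, T.leaf, T.col⟩
  refine Finite.of_injective F fun T T' h => ?_
  obtain ⟨m, _, _, _, _, _, _, _, _, _, _⟩ := T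
  obtain ⟨m', _, _, _, _, _, _, _, _, _, _⟩ := T'
  have hm : m = m' := congrArg (fun x => (Sigma.fst x).1) h
  subst hm
  have h1 := eq_of_heq (Sigma.mk.inj h).2
  simp only [Prod.mk.injEq] at h1
  obtain ⟨rfl, rfl, rfl, rfl⟩ := h1
  rfl

instance (T : ColoredTree n) : CompactSpace T.Cell := by
  refine isCompact_iff_compactSpace.1 (IsClosed.isCompact (s := {len : T.Edge → ENNReal |
    ∀ v, ∀ c ∈ T.col, ∀ c' ∈ T.col, T.Below c v → T.Below c' v →
      T.pathLength len c v = T.pathLength len c' v}) ?_)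
  simp only [Set.ofPred_forall]
  exact isClosed_iInter fun v => isClosed_iInter fun c => isClosed_iInter fun _ =>
    isClosed_iInter fun c' => isClosed_iInter fun _ => isClosed_iInter fun _ =>
      isClosed_iInter fun _ => isClosed_eq (continuous_pathLength c v) (continuous_pathLength c' v)

theorem pathLength_top {u v : Fin T.m} (h : T.Below u v) (hne : u ≠ v) :
    T.pathLength (fun _ => ⊤) u v = ⊤ := by
  rw [pathLength_step h hne (h.ne_root_of_ne hne), top_add]

/-- The point of the cell of `T` at which all edges have infinite length. -/
def infiniteCell (T : ColoredTree n) : T.Cell :=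
  ⟨fun _ => ⊤, by
    intro v c hc c' hc' h h'
    by_cases h1 : c = v
    · subst h1
      rw [eq_of_col_below hc' hc h']
    · have h2 : c' ≠ v := fun h2 => h1 (eq_of_col_below hc (h2 ▸ hc') h)
      rw [pathLength_top h h1, pathLength_top h' h2]⟩

theorem pos_of_pathLength_top {u v : Fin T.m} (h : T.Below u v)
    (hpos : 0 < expNeg (T.pathLength (fun _ => ⊤) u v)) : u = v := by
  by_contra hne
  rw [pathLength_top h hne, expNeg_top] at hpos
  exact lt_irrefl _ hpos

end ColoredTree

instance (n : ℕ) : CompactSpace (MetricTrees n) := Quot.compactSpace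

/-! ### The exponentiation map -/

section Exponentiation

variable {n : ℕ}

theorem QuiltedDisks.mk_eq_iff {S S' : NodalQuiltedDisk n} :
    QuiltedDisks.mk S = QuiltedDisks.mk S' ↔ S.diskData = S'.diskData :=
  Quotient.eq.trans NodalQuiltedDisk.iso_iff_diskData_eq

/-- The cross-ratios embed the moduli space injectively in a product of copies of the extended
reals. -/
instance (n : ℕ) : T2Space (QuiltedDisks n) := by
  refine T2Space.of_injective_continuous
    (f := fun x : QuiltedDisks n => (Quotient.out x).crossRatios) ?_ continuous_induced_dom
  intro x y h
  rw [← Quotient.out_eq x, ← Quotient.out_eq y]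
  exact QuiltedDisks.mk_eq_iff.2 (NodalQuiltedDisk.diskData_eq_of_crossRatios_eq h)

/-- The nodal quilted disk whose relative sizes are given by the edge lengths. -/
noncomputable def exponentiation (p : MetricTrees n) : QuiltedDisks n :=
  Quot.lift (fun p : Σ T : ColoredTree n, T.Cell =>
    QuiltedDisks.mk (NodalQuiltedDisk.exists_diskData_eq p.1 p.2).choose) (by
      intro p q h
      rw [QuiltedDisks.mk_eq_iff, (NodalQuiltedDisk.exists_diskData_eq p.1 p.2).choose_spec,
        (NodalQuiltedDisk.exists_diskData_eq q.1 q.2).choose_spec, ← MetricTrees.mk_eq_iff]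
      exact Quot.sound h) p

theorem exponentiation_eq_iff {T : ColoredTree n} {l : T.Cell} {S : NodalQuiltedDisk n} :
    exponentiation (MetricTrees.mk T l) = QuiltedDisks.mk S ↔ T.metricData l.1 = S.diskData := by
  rw [← (NodalQuiltedDisk.exists_diskData_eq T l).choose_spec]
  exact QuiltedDisks.mk_eq_iff

/-- The detour through a disk with the same data replaces a direct refinement of metric trees. -/
theorem MetricTrees.exists_eq_mk_of_isMaximal (p : MetricTrees n) :
    ∃ (T : ColoredTree n) (l : T.Cell), T.IsMaximal ∧ p = MetricTrees.mk T l := by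
  obtain ⟨⟨T, l⟩, rfl⟩ := Quot.exists_rep p
  obtain ⟨S, hS⟩ := NodalQuiltedDisk.exists_diskData_eq T l
  obtain ⟨T', l', hT', h⟩ := NodalQuiltedDisk.exists_metricData_eq S
  exact ⟨T', l', hT', (MetricTrees.mk_eq_iff l l').2 (hS.symm.trans h.symm)⟩

theorem exponentiation_bijective : Function.Bijective (exponentiation (n := n)) := by
  constructor
  · intro p q h
    obtain ⟨⟨T, l⟩, rfl⟩ := Quot.exists_rep p
    obtain ⟨⟨T', l'⟩, rfl⟩ := Quot.exists_rep q
    obtain ⟨S, hS⟩ := NodalQuiltedDisk.exists_diskData_eq T' l'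
    have h1 : exponentiation (MetricTrees.mk T' l') = QuiltedDisks.mk S :=
      exponentiation_eq_iff.2 hS.symm
    have h2 : exponentiation (MetricTrees.mk T l) = QuiltedDisks.mk S := Eq.trans h h1
    exact (MetricTrees.mk_eq_iff l l').2 ((exponentiation_eq_iff.1 h2).trans hS)
  · intro x
    obtain ⟨S, rfl⟩ := Quotient.exists_rep x
    obtain ⟨T, l, -, h⟩ := NodalQuiltedDisk.exists_metricData_eq S
    exact ⟨MetricTrees.mk T l, exponentiation_eq_iff.2 h⟩

/-- On each cell the cross-ratios of the image depend on the lengths only through `metricData`, and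
both dependences are continuous. -/
theorem continuous_exponentiation : Continuous (exponentiation (n := n)) := by
  refine continuous_induced_rng.2 (isQuotientMap_quot_mk.continuous_iff.2
    (continuous_sigma fun T => ?_))
  refine NodalQuiltedDisk.continuous_crossRatios
    (f := fun l : T.Cell => Quotient.out (exponentiation (MetricTrees.mk T l))) ?_
  have h : ∀ l : T.Cell, (Quotient.out (exponentiation (MetricTrees.mk T l))).diskData =
      T.metricData l.1 := fun l =>
    (exponentiation_eq_iff.1 (Quotient.out_eq (exponentiation (MetricTrees.mk T l))).symm).symm
  simp only [h]
  exact (continuous_metricData T).comp continuous_subtype_val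

theorem isExponentiation_iff {Θ : MetricTrees n → QuiltedDisks n} :
    IsExponentiation Θ ↔ Θ = exponentiation := by
  constructor
  · intro h
    funext p
    obtain ⟨T, l, hT, rfl⟩ := p.exists_eq_mk_of_isMaximal
    obtain ⟨S, hS, ⟨f, hf⟩, hr⟩ := h T hT l
    rw [← hS, exponentiation_eq_iff.2 (NodalQuiltedDisk.metricData_eq_of_hasSimpleRatios hT hf hr)]
  · rintro rfl T - l
    obtain ⟨S, hS⟩ := NodalQuiltedDisk.exists_diskData_eq T l
    exact ⟨S, (exponentiation_eq_iff.2 hS.symm).symm,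
      NodalQuiltedDisk.exists_morphism_and_hasSimpleRatios l hS.symm⟩

/-- When all edges are infinite, a positive entry can only come from a trivial path, so the
positivity pattern of the disk is visible as coincidences in `T`. -/
theorem degenerates_of_infiniteCell {T : ColoredTree n} {S : NodalQuiltedDisk n}
    (h : T.metricData T.infiniteCell.1 = S.diskData) : S.tree.Degenerates T := by
  refine ⟨fun a b i hi h1 => ?_, fun a b hab h1 => ?_, fun a b hab h1 => ?_⟩
  · rw [← NodalQuiltedDisk.diskData_gap_pos_iff hi, ← h, metricData_gap hi] at h1
    exact pos_of_pathLength_top hi.gapVertex_below_meet h1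
  · rw [← NodalQuiltedDisk.diskData_high_pos_iff hab, ← h, metricData_above hab] at h1
    rcases cv_below_or (T := T) (leaf_below_meet_left hab.ne) with h2 | h2
    · exact h2
    · rw [← pos_of_pathLength_top h2 h1]
      exact Below.refl _ _
  · rw [← NodalQuiltedDisk.diskData_low_pos_iff hab, ← h, metricData_below hab] at h1
    rcases cv_below_or (T := T) (leaf_below_meet_left hab.ne) with h2 | h2
    · rw [pos_of_pathLength_top h2 h1]
      exact Below.refl _ _
    · exact h2

/-- An edge of finite length makes an entry of the data positive, which expresses a relation between
meets and colours in `S.tree`. Carried over to `T` by the degeneration, it would identify the two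
ends of the edge. -/
theorem eq_top_of_degenerates {T : ColoredTree n} {S : NodalQuiltedDisk n} {l : T.Cell}
    (h : T.metricData l.1 = S.diskData) (hd : S.tree.Degenerates T) (e : T.Edge) : l.1 e = ⊤ := by
  rw [← expNeg_eq_zero]
  refine le_antisymm (not_lt.1 fun hpos => ?_) (expNeg_nonneg _)
  have hb := below_parent (T := T) e.1
  have hne := parent_ne e.2
  by_cases he : e.1 ∈ T.col
  · have hp : T.parent e.1 ∉ T.col := fun hp => hne (eq_of_col_below he hp hb).symm
    obtain ⟨i, hi⟩ := exists_gapVertex hp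
    obtain ⟨hc, h1, -⟩ := NodalQuiltedDisk.metricData_of_colored_child l he hi
    rw [← h1, h, NodalQuiltedDisk.diskData_low_pos_iff (lowerLeaf_lt_upperLeaf i)] at hpos
    have := hd.below _ _ (lowerLeaf_lt_upperLeaf i) hpos
    exact hp (hi ▸ hc.antisymm this ▸ cv_mem _)
  · obtain ⟨i, hi⟩ := exists_gapVertex he
    by_cases hp : T.parent e.1 ∈ T.col
    · obtain ⟨hc, h1, -⟩ := NodalQuiltedDisk.metricData_of_colored_parent l.1 hi hp
      rw [← h1, h, NodalQuiltedDisk.diskData_high_pos_iff (lowerLeaf_lt_upperLeaf i)] at hpos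
      have := hd.above _ _ (lowerLeaf_lt_upperLeaf i) hpos
      rw [← hc, show T.meet (lowerLeaf i) (upperLeaf i) = e.1 from hi] at this
      exact hne (this.antisymm hb)
    · obtain ⟨j, hj⟩ := exists_gapVertex hp
      obtain ⟨a, b, gi, gj, hm⟩ := NodalQuiltedDisk.exists_gapIn_of_below (T := T) (i := i) (j := j)
        (by rw [hi, hj]; exact hb)
      have h1 : (T.metricData l.1).1 a b i = expNeg (l.1 e) := by
        rw [metricData_gap gi, ← hm, hi, hj, pathLength_edge]
      rw [← h1, h, NodalQuiltedDisk.diskData_gap_pos_iff gi] at hpos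
      have := hd.gap a b i gi hpos
      rw [← hm, hi, hj] at this
      exact hne this.symm

/-- Having type `T` inside the image of the cell of `T` forces all lengths to be infinite;
conversely the point with infinite lengths has type `T`, by degenerations in both directions. -/
theorem image_closedCell_inter_stratum (T : ColoredTree n) :
    exponentiation '' MetricTrees.closedCell T ∩ QuiltedDisks.stratum T =
      {exponentiation (MetricTrees.mk T T.infiniteCell)} := by
  refine Set.Subset.antisymm ?_ (Set.singleton_subset_iff.2 ⟨⟨_, ⟨_, rfl⟩, rfl⟩, ?_⟩)
  · rintro _ ⟨⟨_, ⟨l, rfl⟩, rfl⟩, S, hS, σ, hσ⟩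
    have h := eq_top_of_degenerates (exponentiation_eq_iff.1 hS.symm) hσ.isMorphism.degenerates
    have : l = T.infiniteCell := Subtype.ext (funext h)
    rw [this]
    rfl
  · obtain ⟨S, hS⟩ := NodalQuiltedDisk.exists_diskData_eq T T.infiniteCell
    obtain ⟨f, hf⟩ := (degenerates_of_infiniteCell hS.symm).exists_isMorphism
    obtain ⟨g, hg⟩ := (NodalQuiltedDisk.degenerates_of_metricData_eq hS.symm).exists_isMorphism
    exact ⟨S, (exponentiation_eq_iff.2 hS.symm).symm, hf.exists_isIso hg.card_le⟩

end Exponentiation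

/-- There is exactly one map that is given by exponentiation of the edge lengths in every simple
ratio chart; it is a homeomorphism, and the image of the closed cell of each tree `T` meets the
stratum of `T` in exactly one point. -/
theorem mainTheorem7 (n : ℕ) (hn : 2 ≤ n) :
    ∃ Θ : MetricTrees n ≃ₜ QuiltedDisks n,
      (∀ Θ' : MetricTrees n → QuiltedDisks n, IsExponentiation Θ' ↔ Θ' = Θ) ∧
      ∀ T : ColoredTree n, ∃ x : QuiltedDisks n,
        Θ '' MetricTrees.closedCell T ∩ QuiltedDisks.stratum T = {x} :=
  ⟨Continuous.homeoOfEquivCompactToT2 (f := Equiv.ofBijective _ exponentiation_bijective)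
    continuous_exponentiation, fun _ => isExponentiation_iff,
    fun T => ⟨_, image_closedCell_inter_stratum T⟩⟩
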